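/- **Setting.** Clusters $i=1,\dots,N$ give i.i.d. pairs $(L_i,O_i)$, where $L_i\in\{1,\dots,K\}$ is the cluster type and, given $L_i=k$, $O_i=(Y_i,A_i,X_i)$ with outcome vector $Y_i\in\mathbb R^{M_k}$, treatment vector $A_i\in\mathcal A(M_k)=\{0,1\}^{M_k}$ and covariate vector $X_i\in\mathbb R^{d_k}$. The law $P$ of $(L_i,O_i)$ is otherwise unrestricted (the nonparametric model $\mathcal M_{\rm NP}$); in particular $p_k=P(L_i=k)$ is unknown. Let $Y_i(a)$, $a\in\mathcal A(M_k)$, be the potential outcome vectors, and put $g(a,x,k)=E(Y_i\mid A_i=a,X_i=x,L_i=k)$, $\Sigma(a,x,k)=\mathrm{var}(Y_i\mid A_i=a,X_i=x,L_i=k)$, $e(a\mid x,k)=P(A_i=a\mid X_i=x,L_i=k)$. A star marks the value at the true law $P^*$, and $p_k^*>0$ for all $k$. Let $w_k(a,x)\in\mathbb R^{M_k}$ be bounded measurable weights, let $v_k$ be continuously differentiable on $(0,1)$, and let $$\theta_k^*=\sum_{a\in\mathcal A(M_k)}E\{w_k(a,X_i)^{\mathsf T}Y_i(a)\mid L_i=k\},\qquad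 \tau^*=\sum_{k=1}^K v_k(p_k^*)\,\theta_k^* .$$ **Assumptions.** For all $k$ and $a\in\mathcal A(M_k)$: (A1) $Y_i=Y_i(A_i)$ almost surely; (A2) $Y_i(a)$ is independent of $A_i$ given $X_i$ and $L_i=k$; (A3) there is $c>0$ with $c<e^*(a\mid x,k)<1-c$ for almost all $x$ given $L_i=k$; (A4) given $L_i=k$, $g^*(a,X_i,k)$ has a finite second moment and $\Sigma^*(a,X_i,k)$ a finite mean, and $\Sigma^*(a,x,k)$ is positive definite for almost all $x$. **Efficiency notions.** Consider the observed-data functional $$\tau(P)=\sum_k v_k(p_k)\,\theta_k(P),\qquad \theta_k(P)=\sum_{a}E_P\{w_k(a,X)^{\mathsf T}g_P(a,X,k)\mid L=k\}.$$ A regular parametric submodel is a dominated family $(P_\eta)$, $\eta$ in an open subset of some $\mathbb R^m$, with $P_{\eta^*}=P^*$, whose square-root densities are continuously differentiable in $\eta$ in mean square, whose information matrix $I=E_{P^*}(ss^{\mathsf T})$ at $\eta^*$ is nonsingular ($s$ is the score at $\eta^*$), and such that, for $\eta$ near $\eta^*$, all $p_k$ are positive, the propensities satisfy (A3) with one constant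 $c>0$, and $E_{P_\eta}(\|Y\|^2\mid L=k)$ is bounded. The tangent space is the $L^2(P^*)$-closure of the set of linear combinations of the components of the scores of such submodels. An efficient influence function of $\tau$ is an element $\varphi$ of the tangent space such that, along every such submodel, $\tau(P_\eta)$ is differentiable at $\eta^*$ with gradient $E_{P^*}(\varphi s)$. The semiparametric efficiency bound is the supremum of the Cramér–Rao bounds $\nabla\tau^{\mathsf T}I^{-1}\nabla\tau$ over these submodels, where $\nabla\tau$ is the gradient of $\eta\mapsto\tau(P_\eta)$ at $\eta^*$. **Theorem.** Under these assumptions the expectations defining $\theta_k^*$ exist, $\theta_k^*=\theta_k(P^*)$ and $\tau^*=\tau(P^*)$. The efficient influence function of $\tau^*$ under $\mathcal M_{\rm NP}$ with unknown $p_k^*$ exists, is unique up to $P^*$-null sets, and equals $$\varphi(\tau^*)=\sum_{k=1}^K v_k(p_k^*)\,\varphi_k(\theta_k^*)+\sum_{k=1}^K\{\mathbb 1(L_i=k)-p_k^*\}\,v_k'(p_k^*)\,\theta_k^*,$$ where $\varphi_k(\theta_k^*)=\mathbb 1(L_i=k)\{\phi_k(O_i,e^*,g^*)-\theta_k^*\}/p_k^*$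 and $$\phi_k(O_i,e^*,g^*)=\mathbb 1(L_i=k)\Big[\frac{w_k(A_i,X_i)^{\mathsf T}\{Y_i-g^*(A_i,X_i,k)\}}{e^*(A_i\mid X_i,k)}+\sum_{a\in\mathcal A(M_k)}w_k(a,X_i)^{\mathsf T}g^*(a,X_i,k)\Big].$$ The semiparametric efficiency bound of $\tau^*$ in $\mathcal M_{\rm NP}$ is $\mathrm{var}\{\varphi(\tau^*)\}$, which is finite. (If $p_k^*=1$, which forces $K=1$, the second sum in $\varphi(\tau^*)$ is read as $0$.) -/

import Mathlib

open MeasureTheory ProbabilityTheory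
open scoped ENNReal NNReal Topology

noncomputable section

/-! ### Regular parametric submodels, tangent space, efficient influence function, efficiency bound

Everything in this section refers to the law `P` of one observation (here: one cluster) of an
independent and identically distributed sample. -/

section Semiparametric

variable {Z : Type*} [MeasurableSpace Z]

/-- A smooth regular `m`-dimensional parametric submodel through the law `P`: a dominated family of
laws, indexed by an open set `U` of parameters, which equals `P` at the parameter `truth`.
`root η` is the square root of the density at `η` with respect to the dominating measure; it is a
continuously differentiable function of `η` in the mean-square sense, that is, as a map
into `L²(dominating)`. -/
structure RegularSubmodel (P : Measure Z) (m : ℕ) where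
  dominating : Measure Z
  sigmaFinite : SigmaFinite dominating
  U : Set (EuclideanSpace ℝ (Fin m))
  isOpen_U : IsOpen U
  truth : EuclideanSpace ℝ (Fin m)
  truth_mem : truth ∈ U
  root : EuclideanSpace ℝ (Fin m) → Lp ℝ 2 dominating
  root_nonneg : ∀ η ∈ U, 0 ≤ root η
  norm_root : ∀ η ∈ U, ‖root η‖ = 1
  contDiffOn_root : ContDiffOn ℝ 1 root U
  law_truth : dominating.withDensity (fun z => ENNReal.ofReal (root truth z ^ 2)) = P
  /-- The information matrix at the truth is nonsingular; its entries are
  `E_P(s_i s_j) = ∫ (2 ∂_i √f / √f) (2 ∂_j √f / √f) dP`. -/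
  information_nonsingular : IsUnit (Matrix.det (Matrix.of fun i j : Fin m =>
    ∫ z, (2 * (fderiv ℝ root truth (EuclideanSpace.single i 1)) z / root truth z) *
      (2 * (fderiv ℝ root truth (EuclideanSpace.single j 1)) z / root truth z) ∂P))

namespace RegularSubmodel

variable {P : Measure Z} {m : ℕ} (S : RegularSubmodel P m)

/-- The law `P_η` of the submodel. -/
def law (η : EuclideanSpace ℝ (Fin m)) : Measure Z :=
  S.dominating.withDensity (fun z => ENNReal.ofReal (S.root η z ^ 2))

/-- The `j`-th coordinate of the score at the truth, `∂_j log f = 2 (∂_j √f) / √f`. -/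
def score (j : Fin m) (z : Z) : ℝ :=
  2 * (fderiv ℝ S.root S.truth (EuclideanSpace.single j 1)) z / S.root S.truth z

/-- The information matrix `E_P(s sᵀ)` at the truth. -/
def information : Matrix (Fin m) (Fin m) ℝ :=
  Matrix.of fun i j => ∫ z, S.score i z * S.score j z ∂P

/-- `b` is the Cramér–Rao bound `Dᵀ I⁻¹ D` of the submodel for the parameter `τ`, where `D` is the
gradient at the truth of `η ↦ τ(P_η)`. -/
def IsCramerRaoBound (τ : Measure Z → ℝ) (b : ℝ) : Prop :=
  ∃ D : EuclideanSpace ℝ (Fin m), HasGradientAt (fun η => τ (S.law η)) D S.truth ∧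
    b = D.ofLp ⬝ᵥ (S.information⁻¹.mulVec D.ofLp)

end RegularSubmodel

variable {P : Measure Z} (𝒮 : ∀ m : ℕ, Set (RegularSubmodel P m))

/-- The tangent space: the mean-square closure of the linear combinations of scores of the regular
parametric submodels in `𝒮`. -/
def tangentSpace : Set (Z → ℝ) :=
  {t | MemLp t 2 P ∧ ∀ ε : ℝ, 0 < ε → ∃ m : ℕ, ∃ S ∈ 𝒮 m, ∃ b : Fin m → ℝ,
    eLpNorm (fun z => t z - ∑ j, b j * S.score j z) 2 P ≤ ENNReal.ofReal ε}

/-- `φ` is the efficient influence function of `τ` at `P`: along every submodel in `𝒮` the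
parameter `τ` is differentiable at the truth with gradient `E_P(φ s)`, and `φ` belongs to the
tangent space. -/
structure IsEfficientInfluenceFunction (τ : Measure Z → ℝ) (φ : Z → ℝ) : Prop where
  hasGradientAt : ∀ m : ℕ, ∀ S ∈ 𝒮 m, HasGradientAt (fun η => τ (S.law η))
    (WithLp.toLp 2 fun j => ∫ z, φ z * S.score j z ∂P) S.truth
  mem_tangentSpace : φ ∈ tangentSpace 𝒮

/-- `V` is the semiparametric efficiency bound of `τ` at `P`: the supremum of the Cramér–Rao bounds
of the submodels in `𝒮`. -/
def IsEfficiencyBound (τ : Measure Z → ℝ) (V : ℝ) : Prop :=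
  IsLUB {b | ∃ m : ℕ, ∃ S ∈ 𝒮 m, S.IsCramerRaoBound τ b} V

end Semiparametric

/-! ### Clusters: observed data and functionals of their law -/

/-- Outcome vectors of a cluster with `m` units. -/
abbrev Outcome (m : ℕ) := EuclideanSpace ℝ (Fin m)

/-- Treatment vectors of a cluster with `m` units, the binary vectors of length `m`. -/
abbrev Treatment (m : ℕ) := Fin m → Bool

/-- Vectors of pre-treatment covariates of a cluster, of total dimension `d`. -/
abbrev Covariate (d : ℕ) := EuclideanSpace ℝ (Fin d)

/-- Observed data `O = (Y, A, X)` of a cluster. -/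
abbrev Obs (m d : ℕ) := Outcome m × Treatment m × Covariate d

/-- The space of the pairs `(L, O)`: a cluster type `k` and the data of a cluster of type `k`, where
`M k` is the cluster size and `d k` the dimension of the covariates. -/
abbrev ClusterObs {K : ℕ} (M d : Fin K → ℕ) := (k : Fin K) × Obs (M k) (d k)

section Functionals

variable {K : ℕ} {M d : Fin K → ℕ}

/-- The point `(L, O) = (k, o)`. -/
def ofType (k : Fin K) (o : Obs (M k) (d k)) : ClusterObs M d := ⟨k, o⟩

/-- `p_k = P(L = k)`. -/
def typeProb (P : Measure (ClusterObs M d)) (k : Fin K) : ℝ := P.real {z | z.1 = k}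

/-- The conditional law of `O` given `L = k`. -/
def typeLaw (P : Measure (ClusterObs M d)) (k : Fin K) : Measure (Obs (M k) (d k)) :=
  (ProbabilityTheory.cond P {z | z.1 = k}).comap (ofType k)

instance (P : Measure (ClusterObs M d)) (k : Fin K) : IsFiniteMeasure (typeLaw P k) := by
  unfold typeLaw; infer_instance

/-- The conditional law of `X` given `L = k`. -/
def covLaw (P : Measure (ClusterObs M d)) (k : Fin K) : Measure (Covariate (d k)) :=
  (typeLaw P k).map (fun o => o.2.2)

/-- The propensity score `e(a | x, k) = P(A = a | X = x, L = k)`. -/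
def propensity (P : Measure (ClusterObs M d)) (k : Fin K) (a : Treatment (M k))
    (x : Covariate (d k)) : ℝ :=
  (condDistrib (fun o => o.2.1) (fun o => o.2.2) (typeLaw P k) x).real {a}

/-- The conditional law of `Y` given `A = a`, `X = x`, `L = k`. -/
def outcomeLaw (P : Measure (ClusterObs M d)) (k : Fin K) (a : Treatment (M k))
    (x : Covariate (d k)) : Measure (Outcome (M k)) :=
  condDistrib (fun o => o.1) (fun o => o.2) (typeLaw P k) (a, x)

/-- The outcome regression `g(a, x, k) = E(Y | A = a, X = x, L = k)`. -/
def outcomeReg (P : Measure (ClusterObs M d)) (k : Fin K) (a : Treatment (M k))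
    (x : Covariate (d k)) : Outcome (M k) :=
  ∫ y, y ∂outcomeLaw P k a x

/-- The conditional covariance matrix `Σ(a, x, k) = var(Y | A = a, X = x, L = k)`. -/
def outcomeCov (P : Measure (ClusterObs M d)) (k : Fin K) (a : Treatment (M k))
    (x : Covariate (d k)) : Matrix (Fin (M k)) (Fin (M k)) ℝ :=
  Matrix.of fun i j =>
    ∫ y, (y i - outcomeReg P k a x i) * (y j - outcomeReg P k a x j) ∂outcomeLaw P k a x

/-- Positivity with constant `c`: `c < e(a | x, k) < 1 - c` for all `a`, `k` and almost all `x`. -/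
def Overlap (P : Measure (ClusterObs M d)) (c : ℝ) : Prop :=
  ∀ k, ∀ a : Treatment (M k), ∀ᵐ x ∂covLaw P k,
    c < propensity P k a x ∧ propensity P k a x < 1 - c

/-- Moment conditions: the conditional means and covariances of the outcome exist, `g(a, X, k)` has
a finite second moment and `Σ(a, X, k)` a finite mean given `L = k`, and `Σ(a, x, k)` is positive
definite. -/
structure MomentConditions (P : Measure (ClusterObs M d)) : Prop where
  memLp_outcomeLaw : ∀ k a, ∀ᵐ x ∂covLaw P k, MemLp (fun y => y) 2 (outcomeLaw P k a x)
  memLp_outcomeReg : ∀ k a, MemLp (outcomeReg P k a) 2 (covLaw P k)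
  integrable_outcomeCov : ∀ k a i j, Integrable (fun x => outcomeCov P k a x i j) (covLaw P k)
  posDef_outcomeCov : ∀ k a, ∀ᵐ x ∂covLaw P k, (outcomeCov P k a x).PosDef

/-- A family of weights `w_k(a, x)`. -/
abbrev Weights (M d : Fin K → ℕ) :=
  (k : Fin K) → Treatment (M k) → Covariate (d k) → Outcome (M k)

/-- The functional `θ_k(P) = ∑_a E{w_k(a, X)ᵀ g(a, X, k) | L = k}`. -/
def thetaFunctional (w : Weights M d) (k : Fin K) (P : Measure (ClusterObs M d)) : ℝ :=
  ∑ a : Treatment (M k), ∫ x, inner ℝ (w k a x) (outcomeReg P k a x) ∂covLaw P k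

/-- The functional `τ(P) = ∑_k v_k(p_k) θ_k(P)`. -/
def tauFunctional (v : Fin K → ℝ → ℝ) (w : Weights M d) (P : Measure (ClusterObs M d)) : ℝ :=
  ∑ k, v k (typeProb P k) * thetaFunctional w k P

/-- The nonparametric model: all laws of `(L, O)` under which every type occurs, positivity
holds with constant `c` and the outcome given the type has second moment at most `C`. Nothing else
is assumed about the type probabilities or about the law of `O` given `L`. -/
def npModel (M d : Fin K → ℕ) (c : ℝ) (C : ℝ≥0) : Set (Measure (ClusterObs M d)) :=
  {P | IsProbabilityMeasure P ∧ (∀ k, 0 < typeProb P k) ∧ Overlap P c ∧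
    ∀ k, ∫⁻ o, ‖o.1‖ₑ ^ 2 ∂typeLaw P k ≤ C}

/-- The regular parametric submodels of the nonparametric model: the positivity constant and the
bound on the second moments of the outcome are locally uniform in the parameter, and otherwise
arbitrary. -/
def npSubmodels (P : Measure (ClusterObs M d)) (m : ℕ) : Set (RegularSubmodel P m) :=
  {S | ∃ c : ℝ, 0 < c ∧ ∃ C : ℝ≥0, ∀ᶠ η in 𝓝 S.truth, S.law η ∈ npModel M d c C}

/-- `1(L = k) f(O)` as a function of `(L, O)`. -/
def onType (k : Fin K) (f : Obs (M k) (d k) → ℝ) : ClusterObs M d → ℝ :=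
  Function.extend (ofType k) f 0

/-- `φ_k(O, e, g) = 1(L = k) [w_k(A, X)ᵀ {Y - g(A, X, k)} / e(A | X, k) + ∑_a w_k(a, X)ᵀ g(a, X, k)]`
with `e`, `g` those of the law `P`. -/
def aipw (P : Measure (ClusterObs M d)) (w : Weights M d) (k : Fin K) : ClusterObs M d → ℝ :=
  onType k fun (y, a, x) =>
    inner ℝ (w k a x) (y - outcomeReg P k a x) / propensity P k a x +
      ∑ a' : Treatment (M k), inner ℝ (w k a' x) (outcomeReg P k a' x)

/-- `φ_k(θ_k) = 1(L = k) {φ_k(O, e, g) - θ_k} / p_k`. -/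
def phiType (P : Measure (ClusterObs M d)) (w : Weights M d) (θ : Fin K → ℝ) (k : Fin K)
    (z : ClusterObs M d) : ℝ :=
  (if z.1 = k then 1 else 0) * (aipw P w k z - θ k) / typeProb P k

/-- `φ(τ) = ∑_k v_k(p_k) φ_k(θ_k) + ∑_k {1(L = k) - p_k} v_k'(p_k) θ_k`. -/
def phi (P : Measure (ClusterObs M d)) (v : Fin K → ℝ → ℝ) (w : Weights M d) (θ : Fin K → ℝ)
    (z : ClusterObs M d) : ℝ :=
  ∑ k, v k (typeProb P k) * phiType P w θ k z +
    ∑ k, ((if z.1 = k then 1 else 0) - typeProb P k) * deriv (v k) (typeProb P k) * θ k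

end Functionals

/-! ### Potential outcomes -/

/-- A random cluster on the sample space `Ω`: its type `L`, and, on the event `L = k`, its outcomes
`Y k`, treatments `A k`, covariates `X k` and potential outcomes `Ypot k a`; the values of these
variables outside of the event `L = k` are irrelevant. -/
structure RandomCluster {K : ℕ} (M d : Fin K → ℕ) (Ω : Type*) [MeasurableSpace Ω] where
  L : Ω → Fin K
  Y : (k : Fin K) → Ω → Outcome (M k)
  A : (k : Fin K) → Ω → Treatment (M k)
  X : (k : Fin K) → Ω → Covariate (d k)
  Ypot : (k : Fin K) → Treatment (M k) → Ω → Outcome (M k)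
  measurable_L : Measurable L
  measurable_Y : ∀ k, Measurable (Y k)
  measurable_A : ∀ k, Measurable (A k)
  measurable_X : ∀ k, Measurable (X k)
  measurable_Ypot : ∀ k a, Measurable (Ypot k a)

namespace RandomCluster

variable {K : ℕ} {M d : Fin K → ℕ} {Ω : Type*} [MeasurableSpace Ω] (D : RandomCluster M d Ω)

/-- The observed data `(L, O)`, with `O = (Y, A, X)`. -/
def obs (ω : Ω) : ClusterObs M d := ⟨D.L ω, D.Y (D.L ω) ω, D.A (D.L ω) ω, D.X (D.L ω) ω⟩

/-- The conditional probability given `L = k`. -/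
def given (μ : Measure Ω) (k : Fin K) : Measure Ω := ProbabilityTheory.cond μ {ω | D.L ω = k}

instance (μ : Measure Ω) (k : Fin K) : IsFiniteMeasure (D.given μ k) := by
  unfold given; infer_instance

/-- Consistency: the observed outcome is the potential outcome of the received treatment. -/
def Consistency (μ : Measure Ω) : Prop :=
  ∀ᵐ ω ∂μ, ∀ k, D.L ω = k → D.Y k ω = D.Ypot k (D.A k ω) ω

/-- Conditional ignorability: `Y(a)` and `A` are independent given `X` and `L = k`. -/
def Ignorability [StandardBorelSpace Ω] (μ : Measure Ω) : Prop :=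
  ∀ k, ∀ a : Treatment (M k),
    CondIndepFun (MeasurableSpace.comap (D.X k) inferInstance) (D.measurable_X k).comap_le
      (D.Ypot k a) (D.A k) (D.given μ k)

/-- The causal estimand `θ_k = ∑_a E{w_k(a, X)ᵀ Y(a) | L = k}`. -/
def causalTheta (μ : Measure Ω) (w : Weights M d) (k : Fin K) : ℝ :=
  ∑ a : Treatment (M k), ∫ ω, inner ℝ (w k a (D.X k ω)) (D.Ypot k a ω) ∂D.given μ k

/-- The causal estimand `τ = ∑_k v_k(p_k) θ_k`, where `p_k` is the probability of `L = k`. -/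
def causalTau (μ : Measure Ω) (v : Fin K → ℝ → ℝ) (w : Weights M d) : ℝ :=
  ∑ k, v k (μ.real {ω | D.L ω = k}) * D.causalTheta μ w k

end RandomCluster

end

/-! Efficiency theory is first reduced to two facts about `phi`. For any class of submodels, if `φ`
is an efficient influence function then the gradient along a submodel is `D = E(φ s)`, and `Dᵀ I⁻¹
D` is the squared norm of the L² projection of `φ` on the span of the scores
(`RegularSubmodel.integral_sub_sum_score_sq_eq`). So no Cramér–Rao bound exceeds `E φ²`, and
membership of `φ` in the tangent space makes the bounds approach it. Two efficient influence
functions differ by a function orthogonal to all scores, hence to the tangent space, which gives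
uniqueness. It remains to show that `τ` has gradient `E(φ s)` and that `φ` is a limit of scores.

Gradient. A submodel provides differentiability of the root density `r_η` only, not of the
propensity or the regression. For fixed `k` and `a`, put `T = w_k(a, X)ᵀ Y` and `α = 1(A = a)`; then
`p_k E{w_kᵀ g | L = k} = ∫ α T / e_η · r_η²`, where `e_η` is known only through the balance
equations `∫ (e_η - α) h(X) r_η² = 0`. Testing them with `h = e₀ - e_η` shows that `e₀ - e_η` is of
the order of `‖r_η - r₀‖` in L² (`lpNorm_weight_sub_le`). Testing them with `h = G / e`, where `G =
w_kᵀ g` at the truth, adds the augmentation term. In the augmented form the first-order effect of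
`e_η - e₀` cancels, because `T - G` has conditional mean zero at the truth given `X` and `A = a`;
what is left is a product of two first-order quantities. Unbounded outcomes are truncated, the tails
being controlled by the locally uniform second moment (`abs_ipw_sub_le`, `hasFDerivAt_ipw`). The
quotient, product and chain rules then assemble `phi`.

Tangent space. For bounded `h` with mean zero and unit variance, the root `cos η + sin η · h` moves
on the unit sphere of L²(P) and has score `2 h`. Near the truth its laws lie between two multiples
of `P`, and such laws inherit overlap and moment bounds with uniform constants
(`exists_mem_npModel_of_comparable`). Bounded functions are dense, so the tangent space contains
every square integrable function of mean zero.

Identification. Under ignorability, the law of `(X, Y(a))` on the event `A = a` has density `e(a |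
X)` with respect to the law of `(X, Y(a))`. Dividing by `e ≥ c` recovers both the integrability and
the mean of `wᵀ Y(a)` from observed data (`integral_inner_potentialOutcome`). -/

noncomputable section

/-! ### Square integrable functions and laws given by a root density -/

section SquareIntegrable

variable {Z : Type*} [MeasurableSpace Z] {ν : Measure Z}

theorem lpNorm_two_sq {f : Z → ℝ} (hf : MemLp f 2 ν) : lpNorm f 2 ν ^ 2 = ∫ z, f z ^ 2 ∂ν := by
  have h1 : lpNorm f 2 ν = ‖hf.toLp f‖ := by
    rw [Lp.norm_toLp, toReal_eLpNorm hf.1]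
  rw [h1, ← real_inner_self_eq_norm_sq, L2.inner_def]
  refine integral_congr_ae ?_
  filter_upwards [hf.coeFn_toLp] with z hz
  simp [hz, sq]

theorem MeasureTheory.MemLp.integrable_mul_two {f g : Z → ℝ} (hf : MemLp f 2 ν)
    (hg : MemLp g 2 ν) : Integrable (fun z => f z * g z) ν :=
  hf.integrable_mul hg

theorem abs_integral_mul_le_lpNorm_two {f g : Z → ℝ} (hf : MemLp f 2 ν) (hg : MemLp g 2 ν) :
    |∫ z, f z * g z ∂ν| ≤ lpNorm f 2 ν * lpNorm g 2 ν := by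
  have h1 : lpNorm f 2 ν = ‖hf.toLp f‖ := by rw [Lp.norm_toLp, toReal_eLpNorm hf.1]
  have h2 : lpNorm g 2 ν = ‖hg.toLp g‖ := by rw [Lp.norm_toLp, toReal_eLpNorm hg.1]
  have h3 : ∫ z, f z * g z ∂ν = inner ℝ (hf.toLp f) (hg.toLp g) := by
    rw [L2.inner_def]
    refine integral_congr_ae ?_
    filter_upwards [hf.coeFn_toLp, hg.coeFn_toLp] with z hz hz'
    simp [hz, hz', mul_comm]
  rw [h1, h2, h3]
  exact abs_real_inner_le_norm _ _

theorem lpNorm_two_mono {f g : Z → ℝ} (hg : MemLp g 2 ν) (h : ∀ᵐ z ∂ν, |f z| ≤ |g z|) :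
    lpNorm f 2 ν ≤ lpNorm g 2 ν := by
  by_cases hf : AEStronglyMeasurable f ν
  · rw [← toReal_eLpNorm hf, ← toReal_eLpNorm hg.1]
    exact ENNReal.toReal_mono hg.2.ne (eLpNorm_mono_ae h)
  · rw [lpNorm_of_not_aestronglyMeasurable hf]; exact lpNorm_nonneg

theorem lpNorm_two_const_mul (c : ℝ) (f : Z → ℝ) :
    lpNorm (fun z => c * f z) 2 ν = |c| * lpNorm f 2 ν := by
  have := lpNorm_const_smul (p := 2) c f ν
  simpa [Pi.smul_def] using this

theorem norm_eq_lpNorm_two (r : Lp ℝ 2 ν) : ‖r‖ = lpNorm r 2 ν := by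
  rw [Lp.norm_def, toReal_eLpNorm (Lp.aestronglyMeasurable r)]

theorem lpNorm_two_congr {f g : Z → ℝ} (h : f =ᵐ[ν] g) : lpNorm f 2 ν = lpNorm g 2 ν := by
  by_cases hf : AEStronglyMeasurable f ν
  · rw [← toReal_eLpNorm hf, ← toReal_eLpNorm (hf.congr h), eLpNorm_congr_ae h]
  · rw [lpNorm_of_not_aestronglyMeasurable hf,
      lpNorm_of_not_aestronglyMeasurable (fun hg => hf (hg.congr h.symm))]

theorem MeasureTheory.MemLp.bdd_mul_two {f g : Z → ℝ} {B : ℝ} (hg : MemLp g 2 ν)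
    (hf : AEStronglyMeasurable f ν) (hB : ∀ z, |f z| ≤ B) : MemLp (fun z => f z * g z) 2 ν :=
  hg.of_le_mul (c := B) (hf.mul hg.1) (ae_of_all _ fun z => by
    rw [norm_mul]; exact mul_le_mul_of_nonneg_right (hB z) (norm_nonneg _))

theorem integral_withDensity_sq {r : Z → ℝ} (hr : Measurable r) (f : Z → ℝ) :
    ∫ z, f z ∂ν.withDensity (fun z => ENNReal.ofReal (r z ^ 2)) = ∫ z, r z ^ 2 * f z ∂ν := by
  rw [integral_withDensity_eq_integral_toReal_smul (by fun_prop)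
    (ae_of_all _ fun _ => ENNReal.ofReal_lt_top)]
  simp [ENNReal.toReal_ofReal (sq_nonneg _)]

theorem integrable_withDensity_sq_iff {r : Z → ℝ} (hr : Measurable r) {f : Z → ℝ} :
    Integrable f (ν.withDensity (fun z => ENNReal.ofReal (r z ^ 2))) ↔
      Integrable (fun z => r z ^ 2 * f z) ν := by
  rw [integrable_withDensity_iff_integrable_smul' (by fun_prop)
    (ae_of_all _ fun _ => ENNReal.ofReal_lt_top)]
  simp [ENNReal.toReal_ofReal (sq_nonneg _)]

theorem memLp_two_withDensity_sq_iff {r : Z → ℝ} (hr : Measurable r) {f : Z → ℝ}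
    (hf : Measurable f) :
    MemLp f 2 (ν.withDensity (fun z => ENNReal.ofReal (r z ^ 2))) ↔
      MemLp (fun z => f z * r z) 2 ν := by
  rw [memLp_two_iff_integrable_sq hf.aestronglyMeasurable,
    memLp_two_iff_integrable_sq (f := fun z => f z * r z) (hf.mul hr).aestronglyMeasurable,
    integrable_withDensity_sq_iff hr]
  simp only [mul_pow, mul_comm]

end SquareIntegrable

/-! ### Scores of a regular submodel and their projections -/

namespace RegularSubmodel

variable {Z : Type*} [MeasurableSpace Z] {P : Measure Z} {m : ℕ} (S : RegularSubmodel P m)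

/-- The partial derivative of the square root of the density at the truth. -/
def rootDeriv (j : Fin m) : Lp ℝ 2 S.dominating :=
  fderiv ℝ S.root S.truth (EuclideanSpace.single j 1)

theorem measurable_root (η : EuclideanSpace ℝ (Fin m)) : Measurable (S.root η) :=
  (Lp.stronglyMeasurable _).measurable

theorem measurable_score (j : Fin m) : Measurable (S.score j) :=
  (((Lp.stronglyMeasurable (S.rootDeriv j)).measurable.const_mul 2).div (S.measurable_root _))

theorem law_eq_truth : S.law S.truth = P := S.law_truth

theorem hasFDerivAt_root :
    HasFDerivAt S.root (fderiv ℝ S.root S.truth) S.truth :=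
  ((S.contDiffOn_root.contDiffAt (S.isOpen_U.mem_nhds S.truth_mem)).differentiableAt
    (by norm_num)).hasFDerivAt

/-- The weight `root ^ 2` cancels the denominator of the score and annihilates the set where the
root vanishes, so nothing has to be known about the derivative on that set. -/
theorem integral_mul_score (f : Z → ℝ) (j : Fin m) :
    ∫ z, f z * S.score j z ∂P =
      ∫ z, 2 * (f z * S.root S.truth z) * S.rootDeriv j z ∂S.dominating := by
  have h0 : ∫ z, f z * S.score j z ∂P = ∫ z, f z * S.score j z ∂S.dominating.withDensity
      (fun z => ENNReal.ofReal (S.root S.truth z ^ 2)) := by rw [S.law_truth]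
  rw [h0, integral_withDensity_sq (S.measurable_root _)]
  refine integral_congr_ae (ae_of_all _ fun z => ?_)
  simp only [score, rootDeriv]
  by_cases h : S.root S.truth z = 0
  · simp [h]
  · field_simp

/-- Score times root is twice the derivative of the root, or 0 where the root vanishes; in both
cases it is dominated by an element of L². -/
theorem memLp_score (j : Fin m) : MemLp (S.score j) 2 P := by
  have h0 : MemLp (S.score j) 2 P ↔ MemLp (S.score j) 2 (S.dominating.withDensity
      (fun z => ENNReal.ofReal (S.root S.truth z ^ 2))) := by rw [S.law_truth]
  rw [h0, memLp_two_withDensity_sq_iff (S.measurable_root _) (S.measurable_score j)]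
  refine ((Lp.memLp (S.rootDeriv j)).const_mul 2).of_le
    ((S.measurable_score j).mul (S.measurable_root _)).aestronglyMeasurable
    (ae_of_all _ fun z => ?_)
  simp only [score, rootDeriv]
  by_cases h : S.root S.truth z = 0
  · simp [h]
  · rw [div_mul_cancel₀ _ h]

/-- The roots stay on the unit sphere, so velocity is orthogonal to position. This is the mean-zero
property of scores. -/
theorem inner_root_fderiv (u : EuclideanSpace ℝ (Fin m)) :
    inner ℝ (S.root S.truth) (fderiv ℝ S.root S.truth u) = 0 := by
  have h1 := S.hasFDerivAt_root.norm_sq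
  have h2 : HasFDerivAt (fun η => ‖S.root η‖ ^ 2)
      (0 : EuclideanSpace ℝ (Fin m) →L[ℝ] ℝ) S.truth := by
    refine (hasFDerivAt_const (1 : ℝ) S.truth).congr_of_eventuallyEq ?_
    filter_upwards [S.isOpen_U.mem_nhds S.truth_mem] with η hη
    simp [S.norm_root η hη]
  have h3 := congrArg (fun L => L u) (h1.unique h2)
  simpa using h3

theorem integral_score (j : Fin m) : ∫ z, S.score j z ∂P = 0 := by
  have h1 := S.integral_mul_score (fun _ => 1) j
  have h2 := S.inner_root_fderiv (EuclideanSpace.single j 1)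
  rw [L2.inner_def] at h2
  simp only [one_mul] at h1
  rw [h1]
  have : ∀ z, 2 * S.root S.truth z * S.rootDeriv j z =
      2 * (inner ℝ (S.root S.truth z) ((fderiv ℝ S.root S.truth (EuclideanSpace.single j 1)) z)) := by
    intro z; simp [rootDeriv]; ring
  simp_rw [this]
  rw [integral_const_mul, h2, mul_zero]

/-- The squared distance of an `L²(P)` function from a linear combination of scores. -/
theorem integral_sub_sum_score_sq {φ : Z → ℝ} (hφ : MemLp φ 2 P) (b : Fin m → ℝ) :
    ∫ z, (φ z - ∑ j, b j * S.score j z) ^ 2 ∂P =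
      ∫ z, φ z ^ 2 ∂P - 2 * (b ⬝ᵥ fun j => ∫ z, φ z * S.score j z ∂P) +
        b ⬝ᵥ (S.information.mulVec b) := by
  have hφs : ∀ j, Integrable (fun z => φ z * S.score j z) P := fun j =>
    hφ.integrable_mul_two (S.memLp_score j)
  have hss : ∀ i j, Integrable (fun z => S.score i z * S.score j z) P := fun i j =>
    (S.memLp_score i).integrable_mul_two (S.memLp_score j)
  have h1 : ∀ z, (φ z - ∑ j, b j * S.score j z) ^ 2 =
      φ z ^ 2 - 2 * ∑ j, b j * (φ z * S.score j z) +
        ∑ i, ∑ j, b i * (b j * (S.score i z * S.score j z)) := by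
    intro z
    have : (∑ i, ∑ j, b i * (b j * (S.score i z * S.score j z))) =
        (∑ j, b j * S.score j z) ^ 2 := by
      rw [sq, Finset.sum_mul_sum]
      exact Finset.sum_congr rfl fun i _ => Finset.sum_congr rfl fun j _ => by ring
    rw [this]
    have : (∑ j, b j * (φ z * S.score j z)) = φ z * ∑ j, b j * S.score j z := by
      rw [Finset.mul_sum]; exact Finset.sum_congr rfl fun i _ => by ring
    rw [this]; ring
  simp_rw [h1]
  have i1 : Integrable (fun z => ∑ j, b j * (φ z * S.score j z)) P :=
    integrable_finsetSum _ fun j _ => (hφs j).const_mul _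
  have i2 : ∀ i, Integrable (fun z => ∑ j, b i * (b j * (S.score i z * S.score j z))) P :=
    fun i => integrable_finsetSum _ fun j _ => ((hss i j).const_mul _).const_mul _
  have i3 : Integrable (fun z => φ z ^ 2 - 2 * ∑ j, b j * (φ z * S.score j z)) P :=
    hφ.integrable_sq.sub (i1.const_mul 2)
  rw [integral_add i3 (integrable_finsetSum _ fun i _ => i2 i),
    integral_sub hφ.integrable_sq (i1.const_mul 2), integral_const_mul,
    integral_finsetSum _ fun j _ => (hφs j).const_mul _, integral_finsetSum _ fun i _ => i2 i]
  congr 1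
  · congr 2
    simp [dotProduct, integral_const_mul]
  · simp only [dotProduct, Matrix.mulVec, information, Matrix.of_apply]
    refine Finset.sum_congr rfl fun i _ => ?_
    rw [integral_finsetSum _ fun j _ => ((hss i j).const_mul _).const_mul _, Finset.mul_sum]
    refine Finset.sum_congr rfl fun j _ => ?_
    rw [integral_const_mul, integral_const_mul]; ring

theorem isUnit_det_information : IsUnit S.information.det := S.information_nonsingular

theorem information_transpose : S.information.transpose = S.information := by
  ext i j; simp only [information, Matrix.transpose_apply, Matrix.of_apply]
  simp_rw [mul_comm]

/-- Pythagoras: the Cramér–Rao bound is the squared norm of the projection on the scores. -/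
theorem integral_sub_sum_score_sq_eq {φ : Z → ℝ} (hφ : MemLp φ 2 P) (b : Fin m → ℝ) :
    ∫ z, (φ z - ∑ j, b j * S.score j z) ^ 2 ∂P =
      ∫ z, φ z ^ 2 ∂P - (fun j => ∫ z, φ z * S.score j z ∂P) ⬝ᵥ
          (S.information⁻¹.mulVec fun j => ∫ z, φ z * S.score j z ∂P) +
        ∫ z, (∑ j, (b j - S.information⁻¹.mulVec
          (fun j => ∫ z, φ z * S.score j z ∂P) j) * S.score j z) ^ 2 ∂P := by
  set D : Fin m → ℝ := fun j => ∫ z, φ z * S.score j z ∂P with hD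
  set c := S.information⁻¹.mulVec D with hc
  -- The normal equations: `c` holds the coefficients of the projection of `φ` on the scores.
  have hIc : S.information.mulVec c = D := by
    rw [hc, Matrix.mulVec_mulVec, Matrix.mul_nonsing_inv _ S.isUnit_det_information,
      Matrix.one_mulVec]
  -- The expansion with `φ = 0` evaluates the squared norm of the score combination with
  -- coefficients `b - c`.
  have hsq := S.integral_sub_sum_score_sq (φ := fun _ => 0) MemLp.zero' (b - c)
  have h0 : ((b - c) ⬝ᵥ fun j => ∫ z, (0 : ℝ) * S.score j z ∂P) = 0 := by
    simp [dotProduct]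
  simp only [zero_sub, neg_sq, h0, ne_eq, OfNat.ofNat_ne_zero, not_false_eq_true, zero_pow,
    integral_zero, mul_zero, sub_zero, zero_add, Pi.sub_apply] at hsq
  rw [S.integral_sub_sum_score_sq hφ, hsq]
  have hsymm : c ⬝ᵥ S.information.mulVec b = D ⬝ᵥ b := by
    rw [Matrix.dotProduct_mulVec, ← Matrix.mulVec_transpose, S.information_transpose, hIc]
  rw [Matrix.mulVec_sub, dotProduct_sub, sub_dotProduct, sub_dotProduct, hIc, hsymm,
    dotProduct_comm D b, dotProduct_comm D c]
  ring

end RegularSubmodel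

/-! ### Uniqueness of the efficient influence function and the efficiency bound -/

section Efficiency

variable {Z : Type*} [MeasurableSpace Z] {P : Measure Z}
  {𝒮 : ∀ m : ℕ, Set (RegularSubmodel P m)} {τ : Measure Z → ℝ}

theorem exists_lpNorm_sub_sum_score_le {t : Z → ℝ} (ht : t ∈ tangentSpace 𝒮) {ε : ℝ} (hε : 0 < ε) :
    ∃ m : ℕ, ∃ S ∈ 𝒮 m, ∃ b : Fin m → ℝ,
      lpNorm (fun z => t z - ∑ j, b j * S.score j z) 2 P ≤ ε := by
  obtain ⟨m, S, hS, b, h⟩ := ht.2 ε hε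
  refine ⟨m, S, hS, b, ?_⟩
  rw [← toReal_eLpNorm (f := fun z => t z - ∑ j, b j * S.score j z) (ht.1.1.sub (Finset.measurable_sum _ fun j _ =>
    (S.measurable_score j).const_mul (b j)).aestronglyMeasurable)]
  exact ENNReal.toReal_le_of_le_ofReal hε.le h

theorem memLp_sub_sum_score {m : ℕ} (S : RegularSubmodel P m) {t : Z → ℝ} (ht : MemLp t 2 P)
    (b : Fin m → ℝ) : MemLp (fun z => t z - ∑ j, b j * S.score j z) 2 P :=
  ht.sub (memLp_finsetSum _ fun j _ => (S.memLp_score j).const_mul (b j))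

/-- Orthogonality to the scores passes to their L² limits by Cauchy–Schwarz. -/
theorem integral_mul_eq_zero_of_mem_tangentSpace {t f : Z → ℝ} (ht : t ∈ tangentSpace 𝒮)
    (hf : MemLp f 2 P) (h : ∀ m, ∀ S ∈ 𝒮 m, ∀ j, ∫ z, f z * S.score j z ∂P = 0) :
    ∫ z, f z * t z ∂P = 0 := by
  refine abs_eq_zero.1 (le_antisymm (le_of_forall_pos_le_add fun ε hε => ?_) (abs_nonneg _))
  have hN : 0 < lpNorm f 2 P + 1 := add_pos_of_nonneg_of_pos lpNorm_nonneg one_pos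
  obtain ⟨m, S, hS, b, hb⟩ := exists_lpNorm_sub_sum_score_le ht (div_pos hε hN)
  have h2 : ∫ z, f z * t z ∂P = ∫ z, f z * (t z - ∑ j, b j * S.score j z) ∂P := by
    have i1 : ∀ j ∈ Finset.univ, Integrable (fun z => b j * (f z * S.score j z)) P := fun j _ =>
      (hf.integrable_mul_two (S.memLp_score j)).const_mul _
    have : ∀ z, f z * (t z - ∑ j, b j * S.score j z) =
        f z * t z - ∑ j, b j * (f z * S.score j z) := by
      intro z; rw [mul_sub, Finset.mul_sum]
      congr 1; exact Finset.sum_congr rfl fun j _ => by ring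
    simp_rw [this]
    rw [integral_sub (hf.integrable_mul_two ht.1) (integrable_finsetSum _ i1),
      integral_finsetSum _ i1]
    simp [integral_const_mul, h m S hS]
  rw [h2, zero_add]
  refine (abs_integral_mul_le_lpNorm_two hf (memLp_sub_sum_score S ht.1 b)).trans ?_
  calc _ ≤ (lpNorm f 2 P + 1) * (ε / (lpNorm f 2 P + 1)) :=
        mul_le_mul (by linarith) hb lpNorm_nonneg hN.le
    _ = ε := by field_simp

/-- Gradients are unique, so both functions have the same inner products with every score; their
difference is orthogonal to the tangent space and finally to itself. -/
theorem IsEfficientInfluenceFunction.ae_eq {φ ψ : Z → ℝ}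
    (hφ : IsEfficientInfluenceFunction 𝒮 τ φ) (hψ : IsEfficientInfluenceFunction 𝒮 τ ψ) :
    ψ =ᵐ[P] φ := by
  have hφ2 := hφ.mem_tangentSpace.1
  have hψ2 := hψ.mem_tangentSpace.1
  have hd : MemLp (fun z => ψ z - φ z) 2 P := hψ2.sub hφ2
  have horth : ∀ m, ∀ S ∈ 𝒮 m, ∀ j, ∫ z, (ψ z - φ z) * S.score j z ∂P = 0 := by
    intro m S hS j
    have h := (hψ.hasGradientAt m S hS).unique (hφ.hasGradientAt m S hS)
    have h1 := congrFun (congrArg WithLp.ofLp h) j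
    simp only at h1
    simp_rw [sub_mul]
    rw [integral_sub (hψ2.integrable_mul_two (S.memLp_score j))
      (hφ2.integrable_mul_two (S.memLp_score j)), h1, sub_self]
  -- That `tangentSpace` is closed under subtraction has not been established for a general class,
  -- so orthogonality is used for `φ` and for `ψ` separately.
  have h1 := integral_mul_eq_zero_of_mem_tangentSpace hφ.mem_tangentSpace hd horth
  have h2 := integral_mul_eq_zero_of_mem_tangentSpace hψ.mem_tangentSpace hd horth
  have h3 : ∫ z, (ψ z - φ z) ^ 2 ∂P = 0 := by
    have : ∀ z, (ψ z - φ z) ^ 2 = (ψ z - φ z) * ψ z - (ψ z - φ z) * φ z := fun z => by ring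
    simp_rw [this]
    rw [integral_sub (hd.integrable_mul_two hψ2) (hd.integrable_mul_two hφ2), h1, h2, sub_self]
  rw [integral_eq_zero_iff_of_nonneg (fun z => sq_nonneg _) hd.integrable_sq] at h3
  filter_upwards [h3] with z hz
  simpa [sub_eq_zero] using hz

theorem integral_eq_zero_of_mem_tangentSpace [IsProbabilityMeasure P] {t : Z → ℝ}
    (ht : t ∈ tangentSpace 𝒮) : ∫ z, t z ∂P = 0 := by
  have := integral_mul_eq_zero_of_mem_tangentSpace (f := fun _ => 1) ht (memLp_const 1)
    (fun m S _ j => by simpa using S.integral_score j)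
  simpa using this

theorem IsEfficientInfluenceFunction.isEfficiencyBound [IsProbabilityMeasure P] {φ : Z → ℝ}
    (hφ : IsEfficientInfluenceFunction 𝒮 τ φ) : IsEfficiencyBound 𝒮 τ (variance φ P) := by
  have hφ2 := hφ.mem_tangentSpace.1
  rw [variance_of_integral_eq_zero hφ2.1.aemeasurable
    (integral_eq_zero_of_mem_tangentSpace hφ.mem_tangentSpace)]
  constructor
  · rintro b ⟨m, S, hS, D, hD, rfl⟩
    obtain rfl := hD.unique (hφ.hasGradientAt m S hS)
    -- At the projection coefficients the last term of Pythagoras vanishes, and what remains is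
    -- Bessel's inequality.
    have h := S.integral_sub_sum_score_sq_eq hφ2
      (S.information⁻¹.mulVec fun j => ∫ z, φ z * S.score j z ∂P)
    have h0 : 0 ≤ ∫ z, (φ z - ∑ j, (S.information⁻¹.mulVec
      fun j => ∫ z, φ z * S.score j z ∂P) j * S.score j z) ^ 2 ∂P :=
      integral_nonneg fun z => sq_nonneg _
    simp only [sub_self, zero_mul, Finset.sum_const_zero, ne_eq, OfNat.ofNat_ne_zero,
      not_false_eq_true, zero_pow, integral_zero, add_zero] at h
    rw [h] at h0
    simpa using h0
  · intro x hx
    -- A combination of scores within `√ε` of `φ` forces the Cramér–Rao bound of its submodel above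
    -- `E φ² - ε`.
    refine le_of_forall_pos_le_add fun ε hε => ?_
    obtain ⟨m, S, hS, b, hb⟩ :=
      exists_lpNorm_sub_sum_score_le hφ.mem_tangentSpace (Real.sqrt_pos.2 hε)
    have h1 := hx ⟨m, S, hS, _, hφ.hasGradientAt m S hS, rfl⟩
    have h2 := S.integral_sub_sum_score_sq_eq hφ2 b
    rw [← lpNorm_two_sq (memLp_sub_sum_score S hφ2 b)] at h2
    have h3 : lpNorm (fun z => φ z - ∑ j, b j * S.score j z) 2 P ^ 2 ≤ ε := by
      calc _ ≤ Real.sqrt ε ^ 2 := pow_le_pow_left₀ lpNorm_nonneg hb 2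
        _ = ε := Real.sq_sqrt hε.le
    have h4 : 0 ≤ ∫ z, (∑ j, (b j - S.information⁻¹.mulVec
          (fun j => ∫ z, φ z * S.score j z ∂P) j) * S.score j z) ^ 2 ∂P :=
      integral_nonneg fun z => sq_nonneg _
    simp only at h1
    linarith

end Efficiency

/-! ### Truncation, and stability of balancing weights -/

/-- Truncation at level `t`. -/
def truncAt (t x : ℝ) : ℝ := if |x| ≤ t then x else 0

/-- The indicator of `|x| > t`. -/
def tailInd (t x : ℝ) : ℝ := if |x| ≤ t then 0 else 1

@[fun_prop]
theorem measurable_truncAt (t : ℝ) : Measurable (truncAt t) :=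
  Measurable.ite (measurableSet_le (by fun_prop) (by fun_prop)) measurable_id measurable_const

@[fun_prop]
theorem measurable_tailInd (t : ℝ) : Measurable (tailInd t) :=
  Measurable.ite (measurableSet_le (by fun_prop) (by fun_prop)) measurable_const measurable_const

theorem abs_truncAt_le {t : ℝ} (ht : 0 ≤ t) (x : ℝ) : |truncAt t x| ≤ t := by
  unfold truncAt; split_ifs with h <;> simp [h, ht]

theorem abs_tailInd_le (t x : ℝ) : |tailInd t x| ≤ 1 := by
  unfold tailInd; split_ifs <;> simp

theorem truncAt_eq (t x : ℝ) : truncAt t x = x - tailInd t x * x := by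
  unfold truncAt tailInd; split_ifs <;> simp

section

variable {Z : Type*} [MeasurableSpace Z] {ν : Measure Z}

/-- Dominated convergence with majorant `g²`; `f` only selects the tail set and needs no moment of
its own. -/
theorem tendsto_lpNorm_tailInd_mul {f g : Z → ℝ} (hf : Measurable f) (hg : MemLp g 2 ν) :
    Filter.Tendsto (fun t : ℕ => lpNorm (fun z => tailInd t (f z) * g z) 2 ν) Filter.atTop
      (𝓝 0) := by
  have hm : ∀ t : ℕ, MemLp (fun z => tailInd t (f z) * g z) 2 ν := fun t =>
    hg.bdd_mul_two ((measurable_tailInd t).comp hf).aestronglyMeasurable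
      (fun z => abs_tailInd_le _ _)
  have h1 : Filter.Tendsto (fun t : ℕ => ∫ z, (tailInd t (f z) * g z) ^ 2 ∂ν) Filter.atTop
      (𝓝 (∫ _, (0 : ℝ) ∂ν)) := by
    refine tendsto_integral_of_dominated_convergence (fun z => g z ^ 2)
      (fun t => (hm t).integrable_sq.1) hg.integrable_sq (fun t => ae_of_all _ fun z => ?_)
      (ae_of_all _ fun z => ?_)
    · rw [Real.norm_eq_abs, abs_pow, abs_mul, ← sq_abs (g z)]
      exact pow_le_pow_left₀ (by positivity)
        (mul_le_of_le_one_left (abs_nonneg _) (abs_tailInd_le _ _)) 2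
      
    · refine tendsto_const_nhds.congr' ?_
      filter_upwards [Filter.eventually_ge_atTop ⌈|f z|⌉₊] with t ht
      have : |f z| ≤ t := (Nat.le_ceil _).trans (by exact_mod_cast ht)
      simp [tailInd, this]
  simp_rw [← lpNorm_two_sq (hm _)] at h1
  simpa [Real.sqrt_sq lpNorm_nonneg] using h1.sqrt

theorem integrable_bdd_mul_mul {b f g : Z → ℝ} {B : ℝ} (hb : Measurable b) (hB : ∀ z, |b z| ≤ B)
    (hf : MemLp f 2 ν) (hg : MemLp g 2 ν) : Integrable (fun z => b z * (f z * g z)) ν := by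
  simpa only [mul_assoc] using (hf.bdd_mul_two hb.aestronglyMeasurable hB).integrable_mul_two hg

theorem abs_integral_bdd_mul_mul_le {b f g : Z → ℝ} {B : ℝ} (hb : Measurable b)
    (hB : ∀ z, |b z| ≤ B) (hf : MemLp f 2 ν) (hg : MemLp g 2 ν) :
    |∫ z, b z * (f z * g z) ∂ν| ≤ B * lpNorm f 2 ν * lpNorm g 2 ν := by
  rcases isEmpty_or_nonempty Z with hZ | ⟨⟨z₀⟩⟩
  · simp [Measure.eq_zero_of_isEmpty ν]
  have hB0 : 0 ≤ B := (abs_nonneg _).trans (hB z₀)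
  have h1 := abs_integral_mul_le_lpNorm_two (hf.bdd_mul_two hb.aestronglyMeasurable hB) hg
  simp only [mul_assoc] at h1
  rw [mul_assoc]
  refine h1.trans ?_
  rw [← mul_assoc]
  refine mul_le_mul_of_nonneg_right ?_ lpNorm_nonneg
  calc _ ≤ lpNorm (fun z => B * f z) 2 ν := by
        refine lpNorm_two_mono (hf.const_mul B) (ae_of_all _ fun z => ?_)
        rw [abs_mul, abs_mul, abs_of_nonneg hB0]
        exact mul_le_mul_of_nonneg_right (hB z) (abs_nonneg _)
    _ = B * lpNorm f 2 ν := by rw [lpNorm_two_const_mul, abs_of_nonneg hB0]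

theorem integral_add_six {f₁ f₂ f₃ f₄ f₅ f₆ : Z → ℝ} (h₁ : Integrable f₁ ν)
    (h₂ : Integrable f₂ ν) (h₃ : Integrable f₃ ν) (h₄ : Integrable f₄ ν) (h₅ : Integrable f₅ ν)
    (h₆ : Integrable f₆ ν) :
    ∫ z, (f₁ z + 2 * f₂ z + 2 * f₃ z + f₄ z + f₅ z + f₆ z) ∂ν =
      ∫ z, f₁ z ∂ν + 2 * ∫ z, f₂ z ∂ν + 2 * ∫ z, f₃ z ∂ν + ∫ z, f₄ z ∂ν + ∫ z, f₅ z ∂ν +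
        ∫ z, f₆ z ∂ν := by
  have s₂ : Integrable (fun z => f₁ z + 2 * f₂ z) ν := h₁.add (h₂.const_mul 2)
  have s₃ : Integrable (fun z => f₁ z + 2 * f₂ z + 2 * f₃ z) ν := s₂.add (h₃.const_mul 2)
  have s₄ : Integrable (fun z => f₁ z + 2 * f₂ z + 2 * f₃ z + f₄ z) ν := s₃.add h₄
  have s₅ : Integrable (fun z => f₁ z + 2 * f₂ z + 2 * f₃ z + f₄ z + f₅ z) ν := s₄.add h₅
  rw [integral_add s₅ h₆, integral_add s₄ h₅, integral_add s₃ h₄,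
    integral_add s₂ (h₃.const_mul 2), integral_add h₁ (h₂.const_mul 2), integral_const_mul,
    integral_const_mul]

theorem integral_sub_six {f₁ f₂ f₃ f₄ f₅ f₆ : Z → ℝ} (h₁ : Integrable f₁ ν)
    (h₂ : Integrable f₂ ν) (h₃ : Integrable f₃ ν) (h₄ : Integrable f₄ ν) (h₅ : Integrable f₅ ν)
    (h₆ : Integrable f₆ ν) :
    ∫ z, (f₁ z - f₂ z - f₃ z + f₄ z - f₅ z - f₆ z) ∂ν =
      ∫ z, f₁ z ∂ν - ∫ z, f₂ z ∂ν - ∫ z, f₃ z ∂ν + ∫ z, f₄ z ∂ν - ∫ z, f₅ z ∂ν -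
        ∫ z, f₆ z ∂ν := by
  have s₂ : Integrable (fun z => f₁ z - f₂ z) ν := h₁.sub h₂
  have s₃ : Integrable (fun z => f₁ z - f₂ z - f₃ z) ν := s₂.sub h₃
  have s₄ : Integrable (fun z => f₁ z - f₂ z - f₃ z + f₄ z) ν := s₃.add h₄
  have s₅ : Integrable (fun z => f₁ z - f₂ z - f₃ z + f₄ z - f₅ z) ν := s₄.sub h₅
  rw [integral_sub s₅ h₆, integral_sub s₄ h₅, integral_add s₃ h₄, integral_sub s₂ h₃,
    integral_sub h₁ h₂]

theorem lpNorm_two_add_le {f g : Z → ℝ} (hf : MemLp f 2 ν) :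
    lpNorm (fun z => f z + g z) 2 ν ≤ lpNorm f 2 ν + lpNorm g 2 ν :=
  lpNorm_add_le hf (by norm_num)

/-- Two weights `e₀`, `e₁` that balance the same `α` under the densities `r₀²`, `r₁²` differ by no
more than a multiple of the distance of `r₀` and `r₁`. -/
theorem lpNorm_weight_sub_le {α e₀ e₁ r₀ r₁ : Z → ℝ} (hα : Measurable α) (he₀ : Measurable e₀)
    (he₁ : Measurable e₁) (hα01 : ∀ z, α z ∈ Set.Icc (0 : ℝ) 1)
    (he₀01 : ∀ z, e₀ z ∈ Set.Icc (0 : ℝ) 1) (he₁01 : ∀ z, e₁ z ∈ Set.Icc (0 : ℝ) 1)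
    (hr₀ : MemLp r₀ 2 ν) (hr₁ : MemLp r₁ 2 ν)
    (h₀ : ∫ z, (e₀ z - α z) * (e₀ z - e₁ z) * r₀ z ^ 2 ∂ν = 0)
    (h₁ : ∫ z, (e₁ z - α z) * (e₀ z - e₁ z) * r₁ z ^ 2 ∂ν = 0) :
    lpNorm (fun z => (e₀ z - e₁ z) * r₁ z) 2 ν ≤ 3 * lpNorm (fun z => r₁ z - r₀ z) 2 ν ∧
    lpNorm (fun z => (e₀ z - e₁ z) * r₀ z) 2 ν ≤ 4 * lpNorm (fun z => r₁ z - r₀ z) 2 ν := by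
  have hκ : MemLp (fun z => r₁ z - r₀ z) 2 ν := hr₁.sub hr₀
  have hDm : Measurable (fun z => e₀ z - e₁ z) := he₀.sub he₁
  have hDb : ∀ z, |e₀ z - e₁ z| ≤ 1 := fun z => by
    have := he₀01 z; have := he₁01 z; simp only [Set.mem_Icc] at *
    rw [abs_le]; constructor <;> linarith
  have hEb : ∀ z, |e₀ z - α z| ≤ 1 := fun z => by
    have := he₀01 z; have := hα01 z; simp only [Set.mem_Icc] at *
    rw [abs_le]; constructor <;> linarith
  have hD₁ : MemLp (fun z => (e₀ z - e₁ z) * r₁ z) 2 ν :=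
    hr₁.bdd_mul_two hDm.aestronglyMeasurable hDb
  have hD₀ : MemLp (fun z => (e₀ z - e₁ z) * r₀ z) 2 ν :=
    hr₀.bdd_mul_two hDm.aestronglyMeasurable hDb
  have hDs : MemLp (fun z => (e₀ z - e₁ z) * r₁ z + (e₀ z - e₁ z) * r₀ z) 2 ν := hD₁.add hD₀
  set κ := lpNorm (fun z => r₁ z - r₀ z) 2 ν with hκd
  set a := lpNorm (fun z => (e₀ z - e₁ z) * r₁ z) 2 ν with ha
  set b := lpNorm (fun z => (e₀ z - e₁ z) * r₀ z) 2 ν with hb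
  have hba : b ≤ a + κ := by
    have h1 := lpNorm_two_add_le (g := fun z => (e₀ z - e₁ z) * (r₀ z - r₁ z)) hD₁
    have h2 : (fun z => (e₀ z - e₁ z) * r₁ z + (e₀ z - e₁ z) * (r₀ z - r₁ z)) =
        fun z => (e₀ z - e₁ z) * r₀ z := by ext z; ring
    rw [h2] at h1
    refine h1.trans (add_le_add le_rfl ?_)
    refine lpNorm_two_mono hκ (ae_of_all _ fun z => ?_)
    rw [abs_mul, abs_sub_comm (r₀ z)]
    exact mul_le_of_le_one_left (abs_nonneg _) (hDb z)
  -- With `D = e₀ - e₁`, `D² r₁² = (e₀ - α) D r₁² - (e₁ - α) D r₁²`. The last term integrates to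
  -- zero, and so does `(e₀ - α) D r₀²`, which may be subtracted; this leaves `(e₀ - α) (r₁ - r₀) (D
  -- r₁ + D r₀)`.
  have hsq : a ^ 2 ≤ κ * (a + b) := by
    have h2 : a ^ 2 = ∫ z, (e₀ z - α z) * ((r₁ z - r₀ z) *
        ((e₀ z - e₁ z) * r₁ z + (e₀ z - e₁ z) * r₀ z)) ∂ν := by
      have i0 : Integrable (fun z => (e₀ z - α z) * (e₀ z - e₁ z) * r₀ z ^ 2) ν := by
        refine (integrable_bdd_mul_mul (he₀.sub hα) hEb hD₀ hr₀).congr (ae_of_all _ fun z => ?_)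
        simp only [Pi.sub_apply]; ring
      have i1 : Integrable (fun z => (e₁ z - α z) * (e₀ z - e₁ z) * r₁ z ^ 2) ν := by
        refine (integrable_bdd_mul_mul (b := fun z => e₁ z - α z) (B := 1) (he₁.sub hα)
          (fun z => ?_) hD₁ hr₁).congr (ae_of_all _ fun z => ?_)
        · have := he₁01 z; have := hα01 z; simp only [Set.mem_Icc] at *
          rw [abs_le]; constructor <;> linarith
        · simp only; ring
      have i2 := integrable_bdd_mul_mul (he₀.sub hα) hEb hκ hDs
      rw [ha, lpNorm_two_sq hD₁]
      have h3 : ∫ z, ((e₀ z - e₁ z) * r₁ z) ^ 2 ∂ν =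
          ∫ z, ((e₀ z - α z) * ((r₁ z - r₀ z) *
            ((e₀ z - e₁ z) * r₁ z + (e₀ z - e₁ z) * r₀ z)) +
            (e₀ z - α z) * (e₀ z - e₁ z) * r₀ z ^ 2 -
            (e₁ z - α z) * (e₀ z - e₁ z) * r₁ z ^ 2) ∂ν :=
        integral_congr_ae (ae_of_all _ fun z => by simp only; ring)
      rw [h3, integral_sub, integral_add, h₀, h₁, add_zero, sub_zero]
      exacts [i2, i0, i2.add i0, i1]
    rw [h2]
    refine (le_abs_self _).trans ((abs_integral_bdd_mul_mul_le (he₀.sub hα) hEb hκ hDs).trans ?_)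
    rw [one_mul]
    exact mul_le_mul_of_nonneg_left (lpNorm_two_add_le hD₁) lpNorm_nonneg
  have hκ0 : 0 ≤ κ := lpNorm_nonneg
  have ha0 : 0 ≤ a := lpNorm_nonneg
  -- Together with `b ≤ a + κ` the bound reads `a² ≤ κ (2 a + κ)`, impossible for `a > 3 κ`.
  have h3 : a ≤ 3 * κ := by
    by_contra! h
    nlinarith
  exact ⟨h3, by linarith⟩

end

/-! ### Second-order expansion of the inverse probability weighted mean -/

section

variable {Z 𝒳 : Type*} [MeasurableSpace Z] [MeasurableSpace 𝒳] {ν : Measure Z}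

/-- Expansion of an inverse probability weighted mean with estimated weights. -/
theorem abs_ipw_sub_le {α T r₀ r₁ q : Z → ℝ} {ξ : Z → 𝒳} {e₀ e₁ G : 𝒳 → ℝ} {c t A : ℝ}
    (hc : 0 < c) (hc1 : c ≤ 1) (ht : 0 ≤ t)
    (hα : Measurable α) (hT : Measurable T) (hξ : Measurable ξ) (he₀ : Measurable e₀)
    (he₁ : Measurable e₁) (hG : Measurable G)
    (hα01 : ∀ z, α z ∈ Set.Icc (0 : ℝ) 1) (he₀c : ∀ x, e₀ x ∈ Set.Icc c 1)
    (he₁c : ∀ x, e₁ x ∈ Set.Icc c 1)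
    (hr₀ : MemLp r₀ 2 ν) (hr₁ : MemLp r₁ 2 ν) (hq : MemLp q 2 ν)
    (hTr₀ : MemLp (fun z => T z * r₀ z) 2 ν) (hTr₁ : MemLp (fun z => T z * r₁ z) 2 ν)
    (hGr₀ : MemLp (fun z => G (ξ z) * r₀ z) 2 ν)
    (hA₀ : lpNorm (fun z => T z * r₀ z) 2 ν ≤ A) (hA₁ : lpNorm (fun z => T z * r₁ z) 2 ν ≤ A)
    (h₀ : ∀ h : 𝒳 → ℝ, Measurable h → (∃ B, ∀ x, |h x| ≤ B) →
      ∫ z, (e₀ (ξ z) - α z) * h (ξ z) * r₀ z ^ 2 ∂ν = 0)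
    (h₁ : ∀ h : 𝒳 → ℝ, Measurable h → (∃ B, ∀ x, |h x| ≤ B) →
      ∫ z, (e₁ (ξ z) - α z) * h (ξ z) * r₁ z ^ 2 ∂ν = 0)
    (hTG : ∀ h : 𝒳 → ℝ, Measurable h → (∃ B, ∀ x, |h x| ≤ B) →
      ∫ z, α z * (T z - G (ξ z)) * h (ξ z) * r₀ z ^ 2 ∂ν = 0) :
    |∫ z, α z * T z / e₁ (ξ z) * r₁ z ^ 2 ∂ν - ∫ z, α z * T z / e₀ (ξ z) * r₀ z ^ 2 ∂ν -
      ∫ z, 2 * ((α z * (T z - G (ξ z)) / e₀ (ξ z) + G (ξ z)) * r₀ z) * q z ∂ν| ≤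
      (3 * t / c) * lpNorm (fun z => r₁ z - r₀ z) 2 ν ^ 2 +
      (6 * t / c) * lpNorm r₀ 2 ν * lpNorm (fun z => r₁ z - r₀ z - q z) 2 ν +
      (2 / c * lpNorm (fun z => tailInd t (T z) * (T z * r₀ z)) 2 ν +
        4 / c * lpNorm (fun z => tailInd t (G (ξ z)) * (G (ξ z) * r₀ z)) 2 ν) * lpNorm q 2 ν +
      (14 * t / c ^ 2) * lpNorm (fun z => r₁ z - r₀ z) 2 ν ^ 2 +
      (2 * A / c) * (lpNorm (fun z => r₁ z - r₀ z - q z) 2 ν +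
        lpNorm (fun z => tailInd t (T z) * q z) 2 ν) +
      (4 / c ^ 2) * lpNorm (fun z => tailInd t (G (ξ z)) * (G (ξ z) * r₀ z)) 2 ν *
        lpNorm (fun z => r₁ z - r₀ z) 2 ν := by
  have he₀0 : ∀ x, 0 < e₀ x := fun x => hc.trans_le (he₀c x).1
  have he₁0 : ∀ x, 0 < e₁ x := fun x => hc.trans_le (he₁c x).1
  have hinv₀ : ∀ x, (e₀ x)⁻¹ ≤ c⁻¹ := fun x => inv_anti₀ hc (he₀c x).1
  have hinv₁ : ∀ x, (e₁ x)⁻¹ ≤ c⁻¹ := fun x => inv_anti₀ hc (he₁c x).1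
  have hc1' : 1 ≤ c⁻¹ := (one_le_inv₀ hc).2 hc1
  have hαabs : ∀ z, |α z| ≤ 1 := fun z => by
    rw [abs_of_nonneg (hα01 z).1]; exact (hα01 z).2
  have hαinv₀ : ∀ z, |α z / e₀ (ξ z)| ≤ c⁻¹ := fun z => by
    rw [abs_div, abs_of_pos (he₀0 _), div_eq_mul_inv]
    calc _ ≤ 1 * c⁻¹ := mul_le_mul (hαabs z) (hinv₀ _) (inv_nonneg.2 (he₀0 _).le) zero_le_one
      _ = _ := one_mul _
  have hαinv₁ : ∀ z, |α z / e₁ (ξ z)| ≤ c⁻¹ := fun z => by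
    rw [abs_div, abs_of_pos (he₁0 _), div_eq_mul_inv]
    calc _ ≤ 1 * c⁻¹ := mul_le_mul (hαabs z) (hinv₁ _) (inv_nonneg.2 (he₁0 _).le) zero_le_one
      _ = _ := one_mul _
  have hαinv : ∀ z, |α z / (e₁ (ξ z) * e₀ (ξ z))| ≤ (c ^ 2)⁻¹ := fun z => by
    rw [← div_div, abs_div, abs_of_pos (he₀0 _), div_eq_mul_inv, sq, mul_inv]
    exact mul_le_mul (hαinv₁ z) (hinv₀ _) (inv_nonneg.2 (he₀0 _).le) (inv_nonneg.2 hc.le)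
  have hDb : ∀ x, |e₀ x - e₁ x| ≤ 1 := fun x => by
    have := he₀c x; have := he₁c x; simp only [Set.mem_Icc] at *
    rw [abs_le]; constructor <;> linarith
  have hGtm : Measurable fun x => truncAt t (G x) := (measurable_truncAt t).comp hG
  have hTtm : Measurable fun z => truncAt t (T z) := (measurable_truncAt t).comp hT
  have hGim : Measurable fun x => tailInd t (G x) := (measurable_tailInd t).comp hG
  have hTim : Measurable fun z => tailInd t (T z) := (measurable_tailInd t).comp hT
  have hGtb : ∀ x, |truncAt t (G x)| ≤ t := fun x => abs_truncAt_le ht _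
  have hTtb : ∀ z, |truncAt t (T z)| ≤ t := fun x => abs_truncAt_le ht _
  have hκ : MemLp (fun z => r₁ z - r₀ z) 2 ν := hr₁.sub hr₀
  have hρ : MemLp (fun z => r₁ z - r₀ z - q z) 2 ν := hκ.sub hq
  have hDm : Measurable fun z => e₀ (ξ z) - e₁ (ξ z) := by fun_prop
  have hD₁ : MemLp (fun z => (e₀ (ξ z) - e₁ (ξ z)) * r₁ z) 2 ν :=
    hr₁.bdd_mul_two hDm.aestronglyMeasurable fun z => hDb _
  have hD₀ : MemLp (fun z => (e₀ (ξ z) - e₁ (ξ z)) * r₀ z) 2 ν :=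
    hr₀.bdd_mul_two hDm.aestronglyMeasurable fun z => hDb _
  have hiT : MemLp (fun z => tailInd t (T z) * (T z * r₀ z)) 2 ν :=
    hTr₀.bdd_mul_two hTim.aestronglyMeasurable fun z => abs_tailInd_le _ _
  have hiG : MemLp (fun z => tailInd t (G (ξ z)) * (G (ξ z) * r₀ z)) 2 ν :=
    hGr₀.bdd_mul_two (hGim.comp hξ).aestronglyMeasurable fun z => abs_tailInd_le _ _
  have hiκ : MemLp (fun z => tailInd t (T z) * (r₁ z - r₀ z)) 2 ν :=
    hκ.bdd_mul_two hTim.aestronglyMeasurable fun z => abs_tailInd_le _ _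
  have hiq : MemLp (fun z => tailInd t (T z) * q z) 2 ν :=
    hq.bdd_mul_two hTim.aestronglyMeasurable fun z => abs_tailInd_le _ _
  have hiρ : MemLp (fun z => tailInd t (T z) * (r₁ z - r₀ z - q z)) 2 ν :=
    hρ.bdd_mul_two hTim.aestronglyMeasurable fun z => abs_tailInd_le _ _
  have hTs : MemLp (fun z => T z * r₁ z + T z * r₀ z) 2 ν := hTr₁.add hTr₀
  have hDs : MemLp (fun z => (e₀ (ξ z) - e₁ (ξ z)) * r₁ z + (e₀ (ξ z) - e₁ (ξ z)) * r₀ z) 2 ν :=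
    hD₁.add hD₀
  -- Both balance equations are tested with `h = e₀ - e₁`, itself a bounded function of the
  -- covariate.
  obtain ⟨hd₁, hd₀⟩ := lpNorm_weight_sub_le (e₀ := fun z => e₀ (ξ z)) (e₁ := fun z => e₁ (ξ z)) hα
    (he₀.comp hξ) (he₁.comp hξ) hα01 (fun z => ⟨(he₀0 _).le, (he₀c _).2⟩)
    (fun z => ⟨(he₁0 _).le, (he₁c _).2⟩) hr₀ hr₁
    (h₀ (fun x => e₀ x - e₁ x) (he₀.sub he₁) ⟨1, hDb⟩)
    (h₁ (fun x => e₀ x - e₁ x) (he₀.sub he₁) ⟨1, hDb⟩)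
  -- the truncated influence function and its error
  have hFm : Measurable fun z => α z / e₀ (ξ z) * (truncAt t (T z) - truncAt t (G (ξ z))) +
      truncAt t (G (ξ z)) := by fun_prop
  have hFb : ∀ z, |α z / e₀ (ξ z) * (truncAt t (T z) - truncAt t (G (ξ z))) +
      truncAt t (G (ξ z))| ≤ 3 * t / c := fun z => by
    have h2 : |truncAt t (T z) - truncAt t (G (ξ z))| ≤ 2 * t :=
      (abs_sub _ _).trans (by linarith [hTtb z, hGtb (ξ z)])
    calc _ ≤ |α z / e₀ (ξ z)| * |truncAt t (T z) - truncAt t (G (ξ z))| +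
          |truncAt t (G (ξ z))| := by
            rw [← abs_mul]; exact abs_add_le _ _
      _ ≤ c⁻¹ * (2 * t) + c⁻¹ * t := add_le_add
          (mul_le_mul (hαinv₀ z) h2 (abs_nonneg _) (inv_nonneg.2 hc.le))
          ((hGtb _).trans (le_mul_of_one_le_left ht hc1'))
      _ = 3 * t / c := by ring
  have hEm : Measurable fun z => α z / e₀ (ξ z) := by fun_prop
  -- This function is `(F_t - F) r₀`, where `F = α (T - G) / e₀ + G` and `F_t` is the same
  -- expression with `T` and `G` truncated.
  have hE : MemLp (fun z => α z / e₀ (ξ z) * (tailInd t (G (ξ z)) * (G (ξ z) * r₀ z)) -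
      (α z / e₀ (ξ z) * (tailInd t (T z) * (T z * r₀ z)) +
        tailInd t (G (ξ z)) * (G (ξ z) * r₀ z))) 2 ν :=
    (hiG.bdd_mul_two hEm.aestronglyMeasurable hαinv₀).sub
      ((hiT.bdd_mul_two hEm.aestronglyMeasurable hαinv₀).add hiG)
  have hEb : lpNorm (fun z => α z / e₀ (ξ z) * (tailInd t (G (ξ z)) * (G (ξ z) * r₀ z)) -
      (α z / e₀ (ξ z) * (tailInd t (T z) * (T z * r₀ z)) +
        tailInd t (G (ξ z)) * (G (ξ z) * r₀ z))) 2 ν ≤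
      c⁻¹ * lpNorm (fun z => tailInd t (T z) * (T z * r₀ z)) 2 ν +
        2 * c⁻¹ * lpNorm (fun z => tailInd t (G (ξ z)) * (G (ξ z) * r₀ z)) 2 ν := by
    have hb : ∀ {f : Z → ℝ}, MemLp f 2 ν →
        lpNorm (fun z => α z / e₀ (ξ z) * f z) 2 ν ≤ c⁻¹ * lpNorm f 2 ν := fun {f} hf => by
      calc _ ≤ lpNorm (fun z => c⁻¹ * f z) 2 ν := lpNorm_two_mono (hf.const_mul _)
            (ae_of_all _ fun z => by
              rw [abs_mul, abs_mul, abs_of_nonneg (inv_nonneg.2 hc.le)]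
              exact mul_le_mul_of_nonneg_right (hαinv₀ z) (abs_nonneg _))
        _ = _ := by rw [lpNorm_two_const_mul, abs_of_nonneg (inv_nonneg.2 hc.le)]
    have h1 := lpNorm_sub_le (p := 2) (hiG.bdd_mul_two hEm.aestronglyMeasurable hαinv₀)
      (g := fun z => α z / e₀ (ξ z) * (tailInd t (T z) * (T z * r₀ z)) +
        tailInd t (G (ξ z)) * (G (ξ z) * r₀ z)) (by norm_num)
    have h2 := lpNorm_two_add_le (hiT.bdd_mul_two hEm.aestronglyMeasurable hαinv₀)
      (g := fun z => tailInd t (G (ξ z)) * (G (ξ z) * r₀ z))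
    have h3 := hb hiG
    have h4 := hb hiT
    have h5 : lpNorm (fun z => tailInd t (G (ξ z)) * (G (ξ z) * r₀ z)) 2 ν ≤
      c⁻¹ * lpNorm (fun z => tailInd t (G (ξ z)) * (G (ξ z) * r₀ z)) 2 ν :=
      le_mul_of_one_le_left lpNorm_nonneg hc1'
    simp only [Pi.sub_def] at h1
    linarith
  -- the six terms of the expansion
  have i1 := integrable_bdd_mul_mul hFm hFb hκ hκ
  have i2 := integrable_bdd_mul_mul hFm hFb hr₀ hρ
  have i3 := hE.integrable_mul_two hq
  have hm4 : Measurable fun z => α z / (e₁ (ξ z) * e₀ (ξ z)) *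
      (truncAt t (T z) - truncAt t (G (ξ z))) := by fun_prop
  have hb4 : ∀ z, |α z / (e₁ (ξ z) * e₀ (ξ z)) *
      (truncAt t (T z) - truncAt t (G (ξ z)))| ≤ 2 * t / c ^ 2 := fun z => by
    have h2 : |truncAt t (T z) - truncAt t (G (ξ z))| ≤ 2 * t :=
      (abs_sub _ _).trans (by linarith [hTtb z, hGtb (ξ z)])
    rw [abs_mul]
    calc _ ≤ (c ^ 2)⁻¹ * (2 * t) :=
          mul_le_mul (hαinv z) h2 (abs_nonneg _) (inv_nonneg.2 (sq_nonneg c))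
      _ = _ := by ring
  have i4 := integrable_bdd_mul_mul hm4 hb4 hκ hDs
  have hm5 : Measurable fun z => α z / e₁ (ξ z) := by fun_prop
  have i5 := integrable_bdd_mul_mul hm5 hαinv₁ hiκ hTs
  have hm6 : Measurable fun z => α z / (e₁ (ξ z) * e₀ (ξ z)) := by fun_prop
  have i6 := integrable_bdd_mul_mul hm6 hαinv hiG hD₀
  have j1 : Integrable (fun z => α z * T z / e₁ (ξ z) * r₁ z ^ 2) ν :=
    (integrable_bdd_mul_mul hm5 hαinv₁ hTr₁ hr₁).congr (ae_of_all _ fun z => by simp only; ring)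
  have j0 : Integrable (fun z => α z * T z / e₀ (ξ z) * r₀ z ^ 2) ν :=
    (integrable_bdd_mul_mul hEm hαinv₀ hTr₀ hr₀).congr (ae_of_all _ fun z => by simp only; ring)
  have hFr : MemLp (fun z => 2 * ((α z * (T z - G (ξ z)) / e₀ (ξ z) + G (ξ z)) * r₀ z)) 2 ν := by
    refine ((((hTr₀.bdd_mul_two hEm.aestronglyMeasurable hαinv₀).sub
      (hGr₀.bdd_mul_two hEm.aestronglyMeasurable hαinv₀)).add hGr₀).const_mul 2).ae_eq
      (ae_of_all _ fun z => ?_)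
    simp only [Pi.add_apply, Pi.sub_apply]; ring
  have jF := hFr.integrable_mul_two hq
  -- These two balance equations turn both weighted means into augmented ones at no cost. `G` is
  -- truncated because only bounded test functions are allowed.
  have k1 := h₁ (fun x => truncAt t (G x) / e₁ x) (hGtm.div he₁) ⟨t * c⁻¹, fun x => by
    rw [abs_div, abs_of_pos (he₁0 _), div_eq_mul_inv]
    exact mul_le_mul (hGtb x) (hinv₁ x) (inv_nonneg.2 (he₁0 x).le) ht⟩
  have k0 := h₀ (fun x => truncAt t (G x) / e₀ x) (hGtm.div he₀) ⟨t * c⁻¹, fun x => by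
    rw [abs_div, abs_of_pos (he₀0 _), div_eq_mul_inv]
    exact mul_le_mul (hGtb x) (hinv₀ x) (inv_nonneg.2 (he₀0 x).le) ht⟩
  -- The test function is `1 / e₁ - 1 / e₀`: the first-order effect of changing the weights vanishes
  -- at the truth because the residual `T - G` is conditionally centred.
  have kT := hTG (fun x => (e₀ x - e₁ x) / (e₁ x * e₀ x)) (by fun_prop) ⟨1 * (c⁻¹ * c⁻¹), fun x => by
    rw [abs_div, abs_of_pos (mul_pos (he₁0 _) (he₀0 _)), div_eq_mul_inv, mul_inv]
    exact mul_le_mul (hDb x) (mul_le_mul (hinv₁ x) (hinv₀ x) (inv_nonneg.2 (he₀0 x).le)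
      (inv_nonneg.2 hc.le)) (mul_nonneg (inv_nonneg.2 (he₁0 x).le)
      (inv_nonneg.2 (he₀0 x).le)) zero_le_one⟩
  have l1 : Integrable (fun z => (e₁ (ξ z) - α z) * (truncAt t (G (ξ z)) / e₁ (ξ z)) *
      r₁ z ^ 2) ν := by
    refine (integrable_bdd_mul_mul (b := fun z => truncAt t (G (ξ z)) -
      α z / e₁ (ξ z) * truncAt t (G (ξ z))) (B := t + c⁻¹ * t) (by fun_prop) (fun z => ?_)
      hr₁ hr₁).congr (ae_of_all _ fun z => ?_)
    · refine (abs_sub _ _).trans (add_le_add (hGtb _) ?_)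
      rw [abs_mul]
      exact mul_le_mul (hαinv₁ z) (hGtb _) (abs_nonneg _) (inv_nonneg.2 hc.le)
    · have := (he₁0 (ξ z)).ne'
      simp only; field_simp
  have l0 : Integrable (fun z => (e₀ (ξ z) - α z) * (truncAt t (G (ξ z)) / e₀ (ξ z)) *
      r₀ z ^ 2) ν := by
    refine (integrable_bdd_mul_mul (b := fun z => truncAt t (G (ξ z)) -
      α z / e₀ (ξ z) * truncAt t (G (ξ z))) (B := t + c⁻¹ * t) (by fun_prop) (fun z => ?_)
      hr₀ hr₀).congr (ae_of_all _ fun z => ?_)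
    · refine (abs_sub _ _).trans (add_le_add (hGtb _) ?_)
      rw [abs_mul]
      exact mul_le_mul (hαinv₀ z) (hGtb _) (abs_nonneg _) (inv_nonneg.2 hc.le)
    · have := (he₀0 (ξ z)).ne'
      simp only; field_simp
  have lT : Integrable (fun z => α z * (T z - G (ξ z)) *
      ((e₀ (ξ z) - e₁ (ξ z)) / (e₁ (ξ z) * e₀ (ξ z))) * r₀ z ^ 2) ν :=
    (integrable_bdd_mul_mul hm6 hαinv (hTr₀.sub hGr₀) hD₀).congr (ae_of_all _ fun z => by
      simp only [Pi.sub_apply]; ring)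
  -- With `F` and `F_t` as above, `f1 + 2 f2 + 2 f3 = F_t (r₁² - r₀²) - 2 F r₀ q`. The terms `f4`
  -- and `f5` multiply `r₁² - r₀²` by the effect of the change of weights and by the tail of `α T /
  -- e₁`; `f6` is what the truncation of `G` leaves of the cancelled first-order term.
  set f1 := fun z => (α z / e₀ (ξ z) * (truncAt t (T z) - truncAt t (G (ξ z))) +
    truncAt t (G (ξ z))) * ((r₁ z - r₀ z) * (r₁ z - r₀ z)) with hf1
  set f2 := fun z => (α z / e₀ (ξ z) * (truncAt t (T z) - truncAt t (G (ξ z))) +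
    truncAt t (G (ξ z))) * (r₀ z * (r₁ z - r₀ z - q z)) with hf2
  set f3 := fun z => (α z / e₀ (ξ z) * (tailInd t (G (ξ z)) * (G (ξ z) * r₀ z)) -
      (α z / e₀ (ξ z) * (tailInd t (T z) * (T z * r₀ z)) +
        tailInd t (G (ξ z)) * (G (ξ z) * r₀ z))) * q z with hf3
  set f4 := fun z => α z / (e₁ (ξ z) * e₀ (ξ z)) * (truncAt t (T z) - truncAt t (G (ξ z))) *
    ((r₁ z - r₀ z) * ((e₀ (ξ z) - e₁ (ξ z)) * r₁ z + (e₀ (ξ z) - e₁ (ξ z)) * r₀ z)) with hf4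
  set f5 := fun z => α z / e₁ (ξ z) * (tailInd t (T z) * (r₁ z - r₀ z) *
    (T z * r₁ z + T z * r₀ z)) with hf5
  set f6 := fun z => α z / (e₁ (ξ z) * e₀ (ξ z)) * (tailInd t (G (ξ z)) * (G (ξ z) * r₀ z) *
    ((e₀ (ξ z) - e₁ (ξ z)) * r₀ z)) with hf6
  have hmain : ∫ z, α z * T z / e₁ (ξ z) * r₁ z ^ 2 ∂ν - ∫ z, α z * T z / e₀ (ξ z) * r₀ z ^ 2 ∂ν -
      ∫ z, 2 * ((α z * (T z - G (ξ z)) / e₀ (ξ z) + G (ξ z)) * r₀ z) * q z ∂ν =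
      ∫ z, f1 z ∂ν + 2 * ∫ z, f2 z ∂ν + 2 * ∫ z, f3 z ∂ν + ∫ z, f4 z ∂ν + ∫ z, f5 z ∂ν +
        ∫ z, f6 z ∂ν := by
    have hR : ∫ z, (f1 z + 2 * f2 z + 2 * f3 z + f4 z + f5 z + f6 z) ∂ν =
        ∫ z, f1 z ∂ν + 2 * ∫ z, f2 z ∂ν + 2 * ∫ z, f3 z ∂ν + ∫ z, f4 z ∂ν + ∫ z, f5 z ∂ν +
        ∫ z, f6 z ∂ν :=
      integral_add_six i1 i2 i3 i4 i5 i6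
    rw [← hR]
    have hL : ∫ z, (α z * T z / e₁ (ξ z) * r₁ z ^ 2 - α z * T z / e₀ (ξ z) * r₀ z ^ 2 -
        2 * ((α z * (T z - G (ξ z)) / e₀ (ξ z) + G (ξ z)) * r₀ z) * q z +
        (e₁ (ξ z) - α z) * (truncAt t (G (ξ z)) / e₁ (ξ z)) * r₁ z ^ 2 -
        (e₀ (ξ z) - α z) * (truncAt t (G (ξ z)) / e₀ (ξ z)) * r₀ z ^ 2 -
        α z * (T z - G (ξ z)) *
          ((e₀ (ξ z) - e₁ (ξ z)) / (e₁ (ξ z) * e₀ (ξ z))) * r₀ z ^ 2) ∂ν =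
        ∫ z, α z * T z / e₁ (ξ z) * r₁ z ^ 2 ∂ν - ∫ z, α z * T z / e₀ (ξ z) * r₀ z ^ 2 ∂ν -
        ∫ z, 2 * ((α z * (T z - G (ξ z)) / e₀ (ξ z) + G (ξ z)) * r₀ z) * q z ∂ν := by
      rw [integral_sub_six j1 j0 jF l1 l0 lT, k1, k0, kT]
      ring
    rw [← hL]
    refine integral_congr_ae (ae_of_all _ fun z => ?_)
    have h1 := (he₁0 (ξ z)).ne'
    have h0 := (he₀0 (ξ z)).ne'
    simp only [hf1, hf2, hf3, hf4, hf5, hf6, truncAt_eq]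
    field_simp
    ring
  have b1 := abs_integral_bdd_mul_mul_le hFm hFb hκ hκ
  have b2 := abs_integral_bdd_mul_mul_le hFm hFb hr₀ hρ
  have b3 := abs_integral_mul_le_lpNorm_two hE hq
  have b4 := abs_integral_bdd_mul_mul_le hm4 hb4 hκ hDs
  have b5 := abs_integral_bdd_mul_mul_le hm5 hαinv₁ hiκ hTs
  have b6 := abs_integral_bdd_mul_mul_le hm6 hαinv hiG hD₀
  rw [hmain]
  have hDsb := lpNorm_two_add_le (g := fun z => (e₀ (ξ z) - e₁ (ξ z)) * r₀ z) hD₁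
  have hTsb := lpNorm_two_add_le (g := fun z => T z * r₀ z) hTr₁
  -- `T r₁` is only bounded by `A`, not close to `T r₀`. The smallness of `f5` must come from the
  -- tail of `r₁ - r₀`, through its linear part `q`.
  have hiκb : lpNorm (fun z => tailInd t (T z) * (r₁ z - r₀ z)) 2 ν ≤
      lpNorm (fun z => r₁ z - r₀ z - q z) 2 ν + lpNorm (fun z => tailInd t (T z) * q z) 2 ν := by
    have h1 := lpNorm_two_add_le (g := fun z => tailInd t (T z) * q z) hiρ
    have h2 : (fun z => tailInd t (T z) * (r₁ z - r₀ z - q z) + tailInd t (T z) * q z) =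
        fun z => tailInd t (T z) * (r₁ z - r₀ z) := by ext z; ring
    rw [h2] at h1
    refine h1.trans (add_le_add (lpNorm_two_mono hρ (ae_of_all _ fun z => ?_)) le_rfl)
    rw [abs_mul]
    exact mul_le_of_le_one_left (abs_nonneg _) (abs_tailInd_le _ _)
  set κ := lpNorm (fun z => r₁ z - r₀ z) 2 ν
  have hκ0 : 0 ≤ κ := lpNorm_nonneg
  have c3 : |∫ z, f3 z ∂ν| ≤ (c⁻¹ * lpNorm (fun z => tailInd t (T z) * (T z * r₀ z)) 2 ν +
        2 * c⁻¹ * lpNorm (fun z => tailInd t (G (ξ z)) * (G (ξ z) * r₀ z)) 2 ν) * lpNorm q 2 ν :=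
    b3.trans (mul_le_mul_of_nonneg_right hEb lpNorm_nonneg)
  have c4 : |∫ z, f4 z ∂ν| ≤ 2 * t / c ^ 2 * κ * (7 * κ) :=
    b4.trans (mul_le_mul_of_nonneg_left (by linarith) (by positivity))
  have c5 : |∫ z, f5 z ∂ν| ≤ c⁻¹ * (lpNorm (fun z => r₁ z - r₀ z - q z) 2 ν +
      lpNorm (fun z => tailInd t (T z) * q z) 2 ν) * (2 * A) := by
    refine b5.trans (mul_le_mul (mul_le_mul_of_nonneg_left hiκb (inv_nonneg.2 hc.le))
      (by linarith) lpNorm_nonneg ?_)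
    exact mul_nonneg (inv_nonneg.2 hc.le) (add_nonneg lpNorm_nonneg lpNorm_nonneg)
  have c6 : |∫ z, f6 z ∂ν| ≤ (c ^ 2)⁻¹ *
      lpNorm (fun z => tailInd t (G (ξ z)) * (G (ξ z) * r₀ z)) 2 ν * (4 * κ) :=
    b6.trans (mul_le_mul_of_nonneg_left hd₀
      (mul_nonneg (inv_nonneg.2 (sq_nonneg c)) lpNorm_nonneg))
  have habs : |∫ z, f1 z ∂ν + 2 * ∫ z, f2 z ∂ν + 2 * ∫ z, f3 z ∂ν + ∫ z, f4 z ∂ν + ∫ z, f5 z ∂ν +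
        ∫ z, f6 z ∂ν| ≤ |∫ z, f1 z ∂ν| + 2 * |∫ z, f2 z ∂ν| + 2 * |∫ z, f3 z ∂ν| +
        |∫ z, f4 z ∂ν| + |∫ z, f5 z ∂ν| + |∫ z, f6 z ∂ν| := by
    have e2 : |2 * ∫ z, f2 z ∂ν| = 2 * |∫ z, f2 z ∂ν| := by rw [abs_mul, abs_two]
    have e3 : |2 * ∫ z, f3 z ∂ν| = 2 * |∫ z, f3 z ∂ν| := by rw [abs_mul, abs_two]
    rw [← e2, ← e3]
    refine (abs_add_le _ _).trans (add_le_add ((abs_add_le _ _).trans (add_le_add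
      ((abs_add_le _ _).trans (add_le_add ((abs_add_le _ _).trans (add_le_add
      (abs_add_le _ _) le_rfl)) le_rfl)) le_rfl)) le_rfl)
  refine habs.trans ?_
  refine (add_le_add (add_le_add (add_le_add (add_le_add (add_le_add b1
    (mul_le_mul_of_nonneg_left b2 zero_le_two)) (mul_le_mul_of_nonneg_left c3 zero_le_two)) c4)
    c5) c6).trans (le_of_eq ?_)
  field_simp
  ring

end

/-! ### Differentiability of the inverse probability weighted mean -/

section

variable {Z 𝒳 : Type*} [MeasurableSpace Z] [MeasurableSpace 𝒳] {ν : Measure Z}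

theorem lpNorm_two_mul_sum_smul_le {ι : Type*} (s : Finset ι) {f : Z → ℝ} {B : ℝ}
    (hf : Measurable f) (hB : ∀ z, |f z| ≤ B) (a : ι → ℝ) (v : ι → Lp ℝ 2 ν) :
    lpNorm (fun z => f z * (∑ i ∈ s, a i • v i : Lp ℝ 2 ν) z) 2 ν ≤
      ∑ i ∈ s, |a i| * lpNorm (fun z => f z * v i z) 2 ν := by
  have hadd : ∀ u w : Lp ℝ 2 ν, lpNorm (fun z => f z * (u + w : Lp ℝ 2 ν) z) 2 ν ≤
      lpNorm (fun z => f z * u z) 2 ν + lpNorm (fun z => f z * w z) 2 ν := by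
    intro u w
    refine le_trans (le_of_eq (lpNorm_two_congr ?_)) (lpNorm_two_add_le
      ((Lp.memLp u).bdd_mul_two hf.aestronglyMeasurable hB))
    filter_upwards [Lp.coeFn_add u w] with z hz
    rw [hz, Pi.add_apply, mul_add]
  have hsmul : ∀ (c : ℝ) (u : Lp ℝ 2 ν), lpNorm (fun z => f z * (c • u : Lp ℝ 2 ν) z) 2 ν =
      |c| * lpNorm (fun z => f z * u z) 2 ν := by
    intro c u
    rw [← lpNorm_two_const_mul]
    refine lpNorm_two_congr ?_
    filter_upwards [Lp.coeFn_smul c u] with z hz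
    rw [hz, Pi.smul_apply, smul_eq_mul]; ring
  have hzero : lpNorm (fun z => f z * (0 : Lp ℝ 2 ν) z) 2 ν = 0 := by
    have := hsmul 0 0
    simpa using this
  refine (Finset.le_sum_of_subadditive (fun u : Lp ℝ 2 ν => lpNorm (fun z => f z * u z) 2 ν)
    hzero.le hadd s fun i => a i • v i).trans (Finset.sum_le_sum fun i _ => (hsmul _ _).le)

/-- Finite dimension is used here: the tails of all derivatives `R u` are controlled uniformly in
the direction by those of finitely many coordinate derivatives. -/
theorem lpNorm_two_mul_clm_le {m : ℕ} (R : EuclideanSpace ℝ (Fin m) →L[ℝ] Lp ℝ 2 ν) {f : Z → ℝ}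
    {B : ℝ} (hf : Measurable f) (hB : ∀ z, |f z| ≤ B) (u : EuclideanSpace ℝ (Fin m)) :
    lpNorm (fun z => f z * R u z) 2 ν ≤
      (∑ j, lpNorm (fun z => f z * R (EuclideanSpace.single j 1) z) 2 ν) * ‖u‖ := by
  have hu : R u = ∑ j, u j • R (EuclideanSpace.single j 1) := by
    have h1 : u = ∑ j, u j • EuclideanSpace.single j (1 : ℝ) := by
      have := (EuclideanSpace.basisFun (Fin m) ℝ).sum_repr u
      simpa using this.symm
    conv_lhs => rw [h1]
    simp only [map_sum, map_smul]
  rw [hu, Finset.sum_mul]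
  refine (lpNorm_two_mul_sum_smul_le _ hf hB _ _).trans (Finset.sum_le_sum fun j _ => ?_)
  rw [mul_comm]
  exact mul_le_mul_of_nonneg_left (PiLp.norm_apply_le u j) lpNorm_nonneg

/-- Pathwise differentiability of the inverse probability weighted mean, with the weights of the
law of density `(r η)²`. -/
theorem hasFDerivAt_ipw {m : ℕ} {r : EuclideanSpace ℝ (Fin m) → Lp ℝ 2 ν}
    {R : EuclideanSpace ℝ (Fin m) →L[ℝ] Lp ℝ 2 ν} {η₀ : EuclideanSpace ℝ (Fin m)}
    (hr : HasFDerivAt r R η₀)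
    {α T : Z → ℝ} {ξ : Z → 𝒳} {e : EuclideanSpace ℝ (Fin m) → 𝒳 → ℝ} {G : 𝒳 → ℝ} {c A : ℝ}
    (hc : 0 < c) (hc1 : c ≤ 1)
    (hα : Measurable α) (hT : Measurable T) (hξ : Measurable ξ) (he : ∀ η, Measurable (e η))
    (hG : Measurable G) (hα01 : ∀ z, α z ∈ Set.Icc (0 : ℝ) 1)
    (hec : ∀ η x, e η x ∈ Set.Icc c 1)
    (hTr : ∀ᶠ η in 𝓝 η₀, MemLp (fun z => T z * r η z) 2 ν ∧ lpNorm (fun z => T z * r η z) 2 ν ≤ A)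
    (hGr₀ : MemLp (fun z => G (ξ z) * r η₀ z) 2 ν)
    (hbal : ∀ᶠ η in 𝓝 η₀, ∀ h : 𝒳 → ℝ, Measurable h → (∃ B, ∀ x, |h x| ≤ B) →
      ∫ z, (e η (ξ z) - α z) * h (ξ z) * r η z ^ 2 ∂ν = 0)
    (hTG : ∀ h : 𝒳 → ℝ, Measurable h → (∃ B, ∀ x, |h x| ≤ B) →
      ∫ z, α z * (T z - G (ξ z)) * h (ξ z) * r η₀ z ^ 2 ∂ν = 0)
    (hF : MemLp (fun z => 2 * ((α z * (T z - G (ξ z)) / e η₀ (ξ z) + G (ξ z)) * r η₀ z)) 2 ν) :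
    HasFDerivAt (fun η => ∫ z, α z * T z / e η (ξ z) * r η z ^ 2 ∂ν)
      ((innerSL ℝ (hF.toLp _)).comp R) η₀ := by
  obtain ⟨hTr₀, hA₀⟩ := hTr.self_of_nhds
  have hA : 0 ≤ A := lpNorm_nonneg.trans hA₀
  set a : ℕ → ℝ := fun t => lpNorm (fun z => tailInd t (T z) * (T z * r η₀ z)) 2 ν with ha
  set b : ℕ → ℝ := fun t => lpNorm (fun z => tailInd t (G (ξ z)) * (G (ξ z) * r η₀ z)) 2 ν with hb
  set s : ℕ → ℝ := fun t => ∑ j, lpNorm (fun z => tailInd t (T z) *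
    R (EuclideanSpace.single j 1) z) 2 ν with hs
  have hat : Filter.Tendsto a Filter.atTop (𝓝 0) := tendsto_lpNorm_tailInd_mul hT hTr₀
  have hbt : Filter.Tendsto b Filter.atTop (𝓝 0) :=
    tendsto_lpNorm_tailInd_mul (f := fun z => G (ξ z)) (hG.comp hξ) hGr₀
  have hst : Filter.Tendsto s Filter.atTop (𝓝 0) := by
    have := tendsto_finsetSum (Finset.univ : Finset (Fin m)) fun j _ =>
      tendsto_lpNorm_tailInd_mul hT (Lp.memLp (R (EuclideanSpace.single j 1)))
    simpa using this
  -- `K` is a Lipschitz constant of `r` at `η₀`: the extra 1 absorbs the linearisation error, as `δ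
  -- ≤ 1` below.
  set K := ‖R‖ + 1 with hK
  have hK0 : 0 < K := by positivity
  rw [hasFDerivAt_iff_isLittleO, Asymptotics.isLittleO_iff]
  intro ε hε
  -- These are the coefficients of the terms that are merely linear in `‖η - η₀‖`. The level `t` is
  -- fixed first, to bring them below `ε / 2`.
  have htail : Filter.Tendsto (fun t => (2 / c * a t + 4 / c * b t) * ‖R‖ + 2 * A / c * s t +
      4 / c ^ 2 * b t * K) Filter.atTop (𝓝 0) := by
    have := ((((hat.const_mul (2 / c)).add (hbt.const_mul (4 / c))).mul_const ‖R‖).add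
      (hst.const_mul (2 * A / c))).add ((hbt.const_mul (4 / c ^ 2)).mul_const K)
    simpa using this
  obtain ⟨t, ht⟩ := (htail.eventually (gt_mem_nhds (half_pos hε))).exists
  -- With `t` fixed, `C₁` collects the coefficients of `‖η - η₀‖²` and `C₂` those of the
  -- linearisation error of `r`. Each contributes at most `ε / 4`.
  set C₁ := (3 * t / c + 14 * t / c ^ 2) * K ^ 2 with hC₁
  set C₂ := 6 * t / c * ‖r η₀‖ + 2 * A / c with hC₂
  have hC₁0 : 0 ≤ C₁ := by positivity
  have hC₂0 : 0 ≤ C₂ := by positivity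
  set δ := min 1 (ε / 4 / (C₂ + 1)) with hδ
  have hδ0 : 0 < δ := by positivity
  have hlin := (Asymptotics.isLittleO_iff.1 (hasFDerivAt_iff_isLittleO.1 hr)) hδ0
  have hsmall : ∀ᶠ η in 𝓝 η₀, ‖η - η₀‖ < ε / 4 / (C₁ + 1) := by
    have : Filter.Tendsto (fun η => ‖η - η₀‖) (𝓝 η₀) (𝓝 ‖η₀ - η₀‖) :=
      (continuous_id.sub continuous_const).norm.tendsto η₀
    rw [sub_self, norm_zero] at this
    exact this.eventually (gt_mem_nhds (by positivity))
  filter_upwards [hlin, hsmall, hTr, hbal] with η hη1 hη2 ⟨hTr₁, hA₁⟩ hbal₁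
  have hκ : lpNorm (fun z => r η z - r η₀ z) 2 ν = ‖r η - r η₀‖ := by
    rw [norm_eq_lpNorm_two]; exact lpNorm_two_congr (Lp.coeFn_sub _ _).symm
  have hρ : lpNorm (fun z => r η z - r η₀ z - R (η - η₀) z) 2 ν = ‖r η - r η₀ - R (η - η₀)‖ := by
    rw [norm_eq_lpNorm_two]
    refine lpNorm_two_congr ?_
    filter_upwards [Lp.coeFn_sub (r η) (r η₀), Lp.coeFn_sub (r η - r η₀) (R (η - η₀))] with z h1 h2
    rw [h2, Pi.sub_apply, h1, Pi.sub_apply]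
  have hmain := abs_ipw_sub_le (ν := ν) (q := R (η - η₀)) (t := t) hc hc1 (Nat.cast_nonneg t) hα hT
    hξ (he η₀) (he η) hG hα01 (hec η₀) (hec η) (Lp.memLp _) (Lp.memLp _) (Lp.memLp _) hTr₀ hTr₁ hGr₀
    hA₀ hA₁ hbal.self_of_nhds hbal₁ hTG
  have hder : ((innerSL ℝ (hF.toLp _)).comp R) (η - η₀) = ∫ z, 2 *
      ((α z * (T z - G (ξ z)) / e η₀ (ξ z) + G (ξ z)) * r η₀ z) * R (η - η₀) z ∂ν := by
    simp only [ContinuousLinearMap.comp_apply, innerSL_apply_apply]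
    rw [L2.inner_def]
    refine integral_congr_ae ?_
    filter_upwards [hF.coeFn_toLp] with z hz
    simp only [RCLike.inner_apply, conj_trivial, hz]; ring
  rw [hder, Real.norm_eq_abs]
  refine hmain.trans ?_
  rw [hκ, hρ, ← norm_eq_lpNorm_two, ← norm_eq_lpNorm_two]
  have hq := lpNorm_two_mul_clm_le R ((measurable_tailInd t).comp hT)
    (fun z => abs_tailInd_le _ _) (η - η₀)
  simp only [Function.comp_apply] at hq
  set u := ‖η - η₀‖ with hu
  have hu0 : 0 ≤ u := norm_nonneg _
  have hRu : ‖R (η - η₀)‖ ≤ ‖R‖ * u := R.le_opNorm _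
  have hρ' : ‖r η - r η₀ - R (η - η₀)‖ ≤ δ * u := hη1
  have hκ' : ‖r η - r η₀‖ ≤ K * u := by
    have : ‖r η - r η₀‖ ≤ ‖r η - r η₀ - R (η - η₀)‖ + ‖R (η - η₀)‖ := by
      simpa using norm_add_le (r η - r η₀ - R (η - η₀)) (R (η - η₀))
    have : δ * u ≤ 1 * u := mul_le_mul_of_nonneg_right (min_le_left _ _) hu0
    rw [hK]; linarith
  have hκ2 : ‖r η - r η₀‖ ^ 2 ≤ K ^ 2 * u * u := by
    calc _ ≤ (K * u) ^ 2 := pow_le_pow_left₀ (norm_nonneg _) hκ' 2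
      _ = _ := by ring
  have ha0 : 0 ≤ a t := lpNorm_nonneg
  have hb0 : 0 ≤ b t := lpNorm_nonneg
  have hC₁u : C₁ * u ≤ ε / 4 := by
    have : C₁ * u ≤ (C₁ + 1) * (ε / 4 / (C₁ + 1)) :=
      mul_le_mul (by linarith) hη2.le hu0 (by linarith)
    rwa [mul_div_cancel₀ _ (by positivity)] at this
  have hC₂δ : C₂ * δ ≤ ε / 4 := by
    have : C₂ * δ ≤ (C₂ + 1) * (ε / 4 / (C₂ + 1)) :=
      mul_le_mul (by linarith) (min_le_right _ _) hδ0.le (by linarith)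
    rwa [mul_div_cancel₀ _ (by positivity)] at this
  calc _ ≤ 3 * t / c * (K ^ 2 * u * u) + 6 * t / c * ‖r η₀‖ * (δ * u) +
        (2 / c * a t + 4 / c * b t) * (‖R‖ * u) + 14 * t / c ^ 2 * (K ^ 2 * u * u) +
        2 * A / c * (δ * u + s t * u) + 4 / c ^ 2 * b t * (K * u) := by
          gcongr
    _ = (C₁ * u + C₂ * δ + ((2 / c * a t + 4 / c * b t) * ‖R‖ + 2 * A / c * s t +
      4 / c ^ 2 * b t * K)) * u := by rw [hC₁, hC₂]; ring
    _ ≤ ε * u := mul_le_mul_of_nonneg_right (by linarith) hu0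

/-- The derivative of `η ↦ ∫ (r η)²`. -/
theorem hasFDerivAt_integral_sq {E : Type*} [NormedAddCommGroup E] [NormedSpace ℝ E]
    {r : E → Lp ℝ 2 ν} {R : E →L[ℝ] Lp ℝ 2 ν} {η₀ : E} (hr : HasFDerivAt r R η₀) :
    HasFDerivAt (fun η => ∫ z, r η z ^ 2 ∂ν) (2 • (innerSL ℝ (r η₀)).comp R) η₀ := by
  have h1 := hr.norm_sq
  have h2 : (fun η => ∫ z, r η z ^ 2 ∂ν) = fun η => ‖r η‖ ^ 2 := by
    ext η
    rw [norm_eq_lpNorm_two, lpNorm_two_sq (Lp.memLp _)]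
  rw [h2]; exact h1

end

/-! ### Propensity and regression identities for a law of `(Y, A, X)` -/

section ObsLaw

variable {m d : ℕ} (ρ : Measure (Obs m d)) [IsFiniteMeasure ρ]

/-- The propensity score of a law of `O = (Y, A, X)`. -/
def propensityOf (a : Treatment m) (x : Covariate d) : ℝ :=
  (condDistrib (fun o : Obs m d => o.2.1) (fun o => o.2.2) ρ x).real {a}

/-- The outcome regression of a law of `O = (Y, A, X)`. -/
def regressionOf (a : Treatment m) (x : Covariate d) : Outcome m :=
  ∫ y, y ∂condDistrib (fun o : Obs m d => o.1) (fun o => o.2) ρ (a, x)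

/-- The indicator of `A = a`. -/
def treatedInd (a : Treatment m) (o : Obs m d) : ℝ := if o.2.1 = a then 1 else 0

theorem measurableSet_treated (a : Treatment m) : MeasurableSet {o : Obs m d | o.2.1 = a} :=
  (measurable_fst.comp measurable_snd) (measurableSet_singleton a)

theorem measurable_treatedInd (a : Treatment m) : Measurable (treatedInd (d := d) a) :=
  Measurable.ite (measurableSet_treated a) measurable_const measurable_const

theorem treatedInd_mem_Icc (a : Treatment m) (o : Obs m d) :
    treatedInd a o ∈ Set.Icc (0 : ℝ) 1 := by
  unfold treatedInd; split_ifs <;> simp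

theorem abs_treatedInd_le (a : Treatment m) (o : Obs m d) : |treatedInd a o| ≤ 1 := by
  unfold treatedInd; split_ifs <;> simp

theorem sum_treatedInd_mul (f : Treatment m → ℝ) (o : Obs m d) :
    ∑ a, treatedInd a o * f a = f o.2.1 := by
  simp [treatedInd]

theorem measurable_propensityOf (a : Treatment m) : Measurable (propensityOf ρ a) :=
  (Kernel.measurable_coe _ (measurableSet_singleton a)).ennreal_toReal

theorem propensityOf_nonneg (a : Treatment m) (x : Covariate d) : 0 ≤ propensityOf ρ a x :=
  measureReal_nonneg

theorem propensityOf_le_one (a : Treatment m) (x : Covariate d) : propensityOf ρ a x ≤ 1 :=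
  measureReal_le_one

theorem measurable_regressionOf (a : Treatment m) : Measurable (regressionOf ρ a) := by
  have h : StronglyMeasurable fun b : Treatment m × Covariate d =>
      ∫ y, y ∂condDistrib (fun o : Obs m d => o.1) (fun o => o.2) ρ b :=
    StronglyMeasurable.integral_condDistrib (f := Prod.snd) measurable_snd.stronglyMeasurable
  exact h.measurable.comp (measurable_const.prodMk measurable_id)

/-- The defining property of the conditional law of `A` given `X`, read as a density. -/
theorem map_restrict_treated (a : Treatment m) :
    (ρ.restrict {o | o.2.1 = a}).map (fun o => o.2.2) =
      (ρ.map (fun o => o.2.2)).withDensity fun x => ENNReal.ofReal (propensityOf ρ a x) := by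
  have hX : Measurable fun o : Obs m d => o.2.2 := by fun_prop
  ext B hB
  rw [Measure.map_apply hX hB, Measure.restrict_apply (hX hB), withDensity_apply _ hB,
    setLIntegral_map hB (measurable_propensityOf ρ a).ennreal_ofReal hX]
  have h := setLIntegral_preimage_condDistrib (μ := ρ) (Y := fun o : Obs m d => o.2.1) hX
    (by fun_prop) (measurableSet_singleton a) hB
  change _ = ρ (((fun o : Obs m d => o.2.2) ⁻¹' B) ∩ {o | o.2.1 = a}) at h
  rw [← h]
  refine lintegral_congr fun o => ?_
  rw [propensityOf, ofReal_measureReal]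

theorem integral_treatedInd_mul (a : Treatment m) {h : Covariate d → ℝ} (hh : Measurable h) :
    ∫ o, treatedInd a o * h o.2.2 ∂ρ = ∫ o, propensityOf ρ a o.2.2 * h o.2.2 ∂ρ := by
  have hX : Measurable fun o : Obs m d => o.2.2 := by fun_prop
  have hm := measurable_propensityOf ρ a
  have h1 : ∫ o, treatedInd a o * h o.2.2 ∂ρ = ∫ o in {o | o.2.1 = a}, h o.2.2 ∂ρ := by
    rw [← integral_indicator (measurableSet_treated a)]
    refine integral_congr_ae (ae_of_all _ fun o => ?_)
    by_cases ho : o.2.1 = a <;> simp [treatedInd, ho]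
  rw [h1, ← integral_map (φ := fun o : Obs m d => o.2.2) hX.aemeasurable hh.aestronglyMeasurable,
    map_restrict_treated, integral_withDensity_eq_integral_toReal_smul hm.ennreal_ofReal
      (ae_of_all _ fun _ => ENNReal.ofReal_lt_top), integral_map hX.aemeasurable (by fun_prop)]
  simp [ENNReal.toReal_ofReal (propensityOf_nonneg ρ a _)]

theorem integral_treatedInd_inner_regressionOf (a : Treatment m)
    (hY : Integrable (fun o : Obs m d => o.1) ρ)
    {w : Covariate d → Outcome m} (hw : Measurable w) {B : ℝ} (hB : ∀ x, ‖w x‖ ≤ B) :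
    ∫ o, treatedInd a o * inner ℝ (w o.2.2) o.1 ∂ρ =
      ∫ o, treatedInd a o * inner ℝ (w o.2.2) (regressionOf ρ a o.2.2) ∂ρ := by
  have hfst : Measurable fun o : Obs m d => o.1 := by fun_prop
  have hsnd : Measurable fun o : Obs m d => o.2 := by fun_prop
  set f : (Treatment m × Covariate d) × Outcome m → ℝ := fun p =>
    (if p.1.1 = a then 1 else 0) * inner ℝ (w p.1.2) p.2 with hf
  have hfm : Measurable f :=
    (Measurable.ite ((measurable_fst.comp measurable_fst) (measurableSet_singleton a))
      measurable_const measurable_const).mul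
      ((hw.comp (measurable_snd.comp measurable_fst)).inner measurable_snd)
  have hfi : Integrable f (ρ.map fun o => (o.2, o.1)) := by
    rw [integrable_map_measure hfm.aestronglyMeasurable (by fun_prop)]
    refine (hY.norm.const_mul B).mono' (hfm.comp (by fun_prop)).aestronglyMeasurable
      (ae_of_all _ fun o => ?_)
    simp only [hf, Function.comp_apply, norm_mul]
    have h1 : ‖(if o.2.1 = a then (1 : ℝ) else 0)‖ ≤ 1 := by split_ifs <;> simp
    calc _ ≤ 1 * (‖w o.2.2‖ * ‖o.1‖) :=
          mul_le_mul h1 (norm_inner_le_norm _ _) (norm_nonneg _) zero_le_one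
      _ ≤ B * ‖o.1‖ := by
          rw [one_mul]; exact mul_le_mul_of_nonneg_right (hB _) (norm_nonneg _)
  have hYi : Integrable (fun p : (Treatment m × Covariate d) × Outcome m => p.2)
      (ρ.map fun o => (o.2, o.1)) := by
    rw [integrable_map_measure measurable_snd.aestronglyMeasurable (by fun_prop)]
    exact hY
  have h1 : ∫ o, treatedInd a o * inner ℝ (w o.2.2) o.1 ∂ρ =
      ∫ p, f p ∂ρ.map (fun o => (o.2, o.1)) := by
    rw [integral_map (by fun_prop) hfm.aestronglyMeasurable]
    rfl
  have hcomp := compProd_map_condDistrib (μ := ρ) (mβ := inferInstance) (X := fun o : Obs m d => o.2)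
    (Y := fun o : Obs m d => o.1) hfst.aemeasurable
  have hker := Integrable.condDistrib_ae_map (X := fun o : Obs m d => o.2) hfst.aemeasurable hYi
  -- Disintegration over `(A, X)`; the indicator forces `A = a`, so the inner integral is the
  -- regression at the fixed treatment `a`.
  rw [h1, ← hcomp, Measure.integral_compProd (by rw [hcomp]; exact hfi)]
  have h2 : ∀ᵐ b ∂ρ.map (fun o => o.2),
      ∫ y, f (b, y) ∂condDistrib (fun o : Obs m d => o.1) (fun o => o.2) ρ b =
        (if b.1 = a then 1 else 0) * inner ℝ (w b.2) (regressionOf ρ a b.2) := by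
    filter_upwards [hker] with b hb
    by_cases hba : b.1 = a
    · simp only [hf, if_pos hba, one_mul]
      have : b = (a, b.2) := by ext1 <;> simp [hba]
      rw [integral_inner hb, regressionOf, ← this]
    · simp [hf, hba]
  rw [integral_congr_ae h2, integral_map (by fun_prop)]
  · rfl
  · refine Measurable.aestronglyMeasurable ?_
    exact (Measurable.ite (measurable_fst (measurableSet_singleton a))
      measurable_const measurable_const).mul ((hw.comp measurable_snd).inner
      ((measurable_regressionOf ρ a).comp measurable_snd))

/-- Overlap as an inequality between measures. -/
theorem ae_le_condDistrib_iff (S : Set (Treatment m)) {c : ℝ} :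
    (∀ᵐ x ∂ρ.map (fun o => o.2.2),
      c ≤ (condDistrib (fun o : Obs m d => o.2.1) (fun o => o.2.2) ρ x).real S) ↔
    ∀ B : Set (Covariate d), MeasurableSet B →
      ENNReal.ofReal c * ρ {o | o.2.2 ∈ B} ≤ ρ {o | o.2.2 ∈ B ∧ o.2.1 ∈ S} := by
  have hX : Measurable fun o : Obs m d => o.2.2 := by fun_prop
  have hS : MeasurableSet S := S.toFinite.measurableSet
  set κ := condDistrib (fun o : Obs m d => o.2.1) (fun o => o.2.2) ρ with hκ
  have hset : ∀ B : Set (Covariate d), MeasurableSet B →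
      ∫⁻ x in B, κ x S ∂ρ.map (fun o => o.2.2) = ρ {o | o.2.2 ∈ B ∧ o.2.1 ∈ S} := by
    intro B hB
    rw [setLIntegral_map hB (Kernel.measurable_coe _ hS) hX]
    exact setLIntegral_preimage_condDistrib (μ := ρ) (Y := fun o : Obs m d => o.2.1) hX
      (by fun_prop) hS hB
  have hset' : ∀ B : Set (Covariate d), MeasurableSet B →
      ∫⁻ _ in B, ENNReal.ofReal c ∂ρ.map (fun o => o.2.2) =
        ENNReal.ofReal c * ρ {o | o.2.2 ∈ B} := by
    intro B hB
    rw [setLIntegral_const, Measure.map_apply hX hB]; rfl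
  have hreal : ∀ x, c ≤ (κ x).real S ↔ ENNReal.ofReal c ≤ κ x S := fun x =>
    (ENNReal.ofReal_le_iff_le_toReal (measure_ne_top _ _)).symm
  simp_rw [hreal]
  constructor
  · intro h B hB
    rw [← hset B hB, ← hset' B hB]
    exact lintegral_mono_ae (ae_restrict_of_ae h)
  · intro h
    refine ae_le_of_forall_setLIntegral_le_of_sigmaFinite measurable_const fun B hB _ => ?_
    rw [hset B hB, hset' B hB]
    exact h B hB

end ObsLaw

section ObsLaw

variable {m d : ℕ} (ρ : Measure (Obs m d)) [IsFiniteMeasure ρ]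

/-- The propensity score, bounded below by `c`. -/
def clipPropensity (c : ℝ) (a : Treatment m) (x : Covariate d) : ℝ := max c (propensityOf ρ a x)

theorem measurable_clipPropensity (c : ℝ) (a : Treatment m) :
    Measurable (clipPropensity ρ c a) :=
  measurable_const.max (measurable_propensityOf ρ a)

theorem clipPropensity_mem_Icc {c : ℝ} (hc1 : c ≤ 1) (a : Treatment m) (x : Covariate d) :
    clipPropensity ρ c a x ∈ Set.Icc c 1 :=
  ⟨le_max_left _ _, max_le hc1 (propensityOf_le_one ρ a x)⟩

variable {ρ} {c : ℝ} {a : Treatment m}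

/-- Clipping alters the propensity on a null set only, and provides a lower bound at every point, as
required of the weights in `hasFDerivAt_ipw`. -/
theorem clipPropensity_ae_eq (h : ∀ᵐ x ∂ρ.map (fun o => o.2.2), c ≤ propensityOf ρ a x) :
    ∀ᵐ o ∂ρ, clipPropensity ρ c a o.2.2 = propensityOf ρ a o.2.2 := by
  have := ae_of_ae_map (f := fun o : Obs m d => o.2.2) (by fun_prop) h
  filter_upwards [this] with o ho
  exact max_eq_right ho

/-- The balance equation, the only information about the propensity that enters the differentiation.
-/
theorem integral_clipPropensity_sub_treatedInd_mul
    (h : ∀ᵐ x ∂ρ.map (fun o => o.2.2), c ≤ propensityOf ρ a x)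
    {f : Covariate d → ℝ} (hf : Measurable f) (hB : ∃ B, ∀ x, |f x| ≤ B) :
    ∫ o, (clipPropensity ρ c a o.2.2 - treatedInd a o) * f o.2.2 ∂ρ = 0 := by
  obtain ⟨B, hB⟩ := hB
  have hm := measurable_propensityOf ρ a
  have hi : Integrable (fun o : Obs m d => f o.2.2) ρ :=
    Integrable.of_bound (hf.comp (by fun_prop)).aestronglyMeasurable B (ae_of_all _ fun o => hB _)
  have i1 : Integrable (fun o : Obs m d => propensityOf ρ a o.2.2 * f o.2.2) ρ :=
    hi.bdd_mul (c := 1) (hm.comp (by fun_prop)).aestronglyMeasurable (ae_of_all _ fun o => by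
      rw [Real.norm_eq_abs, abs_of_nonneg (propensityOf_nonneg _ _ _)]
      exact propensityOf_le_one _ _ _)
  have i2 : Integrable (fun o : Obs m d => treatedInd a o * f o.2.2) ρ :=
    hi.bdd_mul (c := 1) (measurable_treatedInd a).aestronglyMeasurable
      (ae_of_all _ fun o => abs_treatedInd_le a o)
  have h1 : ∫ o, (clipPropensity ρ c a o.2.2 - treatedInd a o) * f o.2.2 ∂ρ =
      ∫ o, (propensityOf ρ a o.2.2 * f o.2.2 - treatedInd a o * f o.2.2) ∂ρ := by
    refine integral_congr_ae ?_
    filter_upwards [clipPropensity_ae_eq h] with o ho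
    rw [ho]; ring
  rw [h1, integral_sub i1 i2, integral_treatedInd_mul ρ a hf, sub_self]

theorem integral_treatedInd_div_clipPropensity (hc : 0 < c)
    (h : ∀ᵐ x ∂ρ.map (fun o => o.2.2), c ≤ propensityOf ρ a x)
    {f : Covariate d → ℝ} (hf : Measurable f) :
    ∫ o, treatedInd a o * (f o.2.2 / clipPropensity ρ c a o.2.2) ∂ρ = ∫ o, f o.2.2 ∂ρ := by
  rw [integral_treatedInd_mul ρ a (h := fun x => f x / clipPropensity ρ c a x)
    (hf.div (measurable_clipPropensity ρ c a))]
  refine integral_congr_ae ?_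
  filter_upwards [clipPropensity_ae_eq h] with o ho
  rw [← ho]
  have : clipPropensity ρ c a o.2.2 ≠ 0 := (hc.trans_le (le_max_left _ _)).ne'
  field_simp

/-- On the event `A = a` the outcome may be replaced by its regression, and the inverse weight then
removes the indicator. -/
theorem integral_ipw_eq (hc : 0 < c)
    (h : ∀ᵐ x ∂ρ.map (fun o => o.2.2), c ≤ propensityOf ρ a x)
    (hY : Integrable (fun o : Obs m d => o.1) ρ)
    {w : Covariate d → Outcome m} (hw : Measurable w) {B : ℝ} (hB : ∀ x, ‖w x‖ ≤ B) :
    ∫ o, treatedInd a o * inner ℝ (w o.2.2) o.1 / clipPropensity ρ c a o.2.2 ∂ρ =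
      ∫ o, inner ℝ (w o.2.2) (regressionOf ρ a o.2.2) ∂ρ := by
  have hcl := measurable_clipPropensity ρ c a
  have hpos : ∀ x, 0 < clipPropensity ρ c a x := fun x => hc.trans_le (le_max_left _ _)
  have h1 := integral_treatedInd_inner_regressionOf ρ a hY
    (w := fun x => (clipPropensity ρ c a x)⁻¹ • w x) (by fun_prop) (B := c⁻¹ * B) (fun x => by
      rw [norm_smul, norm_inv, Real.norm_of_nonneg (hpos x).le]
      exact mul_le_mul (inv_anti₀ hc (le_max_left _ _)) (hB x) (norm_nonneg _)
        (inv_nonneg.2 hc.le))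
  have hr := measurable_regressionOf ρ a
  rw [← integral_treatedInd_div_clipPropensity hc h
    (f := fun x => inner ℝ (w x) (regressionOf ρ a x)) (by fun_prop)]
  simp only [inner_smul_left, conj_trivial] at h1
  convert h1 using 3 <;> ring

/-- The orthogonality of residuals to functions of the covariate that cancels the first-order effect
of the weights; it is also why the residual part of the influence function has mean zero. -/
theorem integral_treatedInd_mul_sub_regressionOf (hY : Integrable (fun o : Obs m d => o.1) ρ)
    (hg : Integrable (fun o : Obs m d => regressionOf ρ a o.2.2) ρ)
    {w : Covariate d → Outcome m} (hw : Measurable w) {B : ℝ} (hB : ∀ x, ‖w x‖ ≤ B)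
    {f : Covariate d → ℝ} (hf : Measurable f) (hf' : ∃ B, ∀ x, |f x| ≤ B) :
    ∫ o, treatedInd a o * (inner ℝ (w o.2.2) o.1 -
      inner ℝ (w o.2.2) (regressionOf ρ a o.2.2)) * f o.2.2 ∂ρ = 0 := by
  obtain ⟨B', hB'⟩ := hf'
  have hr := measurable_regressionOf ρ a
  have ht := measurable_treatedInd (d := d) a
  have hfw : ∀ x, ‖f x • w x‖ ≤ B' * B := fun x => by
    rw [norm_smul]
    exact mul_le_mul (hB' x) (hB x) (norm_nonneg _) ((abs_nonneg _).trans (hB' x))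
  have h1 := integral_treatedInd_inner_regressionOf ρ a hY
    (w := fun x => f x • w x) (by fun_prop) hfw
  have hint : ∀ g : Obs m d → Outcome m, Measurable g → Integrable g ρ →
      Integrable (fun o => treatedInd a o * inner ℝ (f o.2.2 • w o.2.2) (g o)) ρ := by
    intro g hgm hg
    refine (hg.norm.const_mul (B' * B)).mono' (by fun_prop) (ae_of_all _ fun o => ?_)
    rw [norm_mul]
    calc _ ≤ 1 * (‖f o.2.2 • w o.2.2‖ * ‖g o‖) :=
          mul_le_mul (abs_treatedInd_le a o) (norm_inner_le_norm _ _) (norm_nonneg _) zero_le_one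
      _ ≤ _ := by rw [one_mul]; exact mul_le_mul_of_nonneg_right (hfw _) (norm_nonneg _)
  have h2 := integral_sub (hint _ (by fun_prop) hY) (hint _ (by fun_prop) hg)
  rw [h1, sub_self] at h2
  rw [← h2]
  refine integral_congr_ae (ae_of_all _ fun o => ?_)
  simp only [inner_smul_left, conj_trivial]; ring

variable (ρ)

theorem lintegral_enorm_outcome_sq_lt_top
    (h₁ : ∀ a, ∀ᵐ x ∂ρ.map (fun o => o.2.2), MemLp (fun y => y) 2
      (condDistrib (fun o : Obs m d => o.1) (fun o => o.2) ρ (a, x)))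
    (h₂ : ∀ a, MemLp (regressionOf ρ a) 2 (ρ.map (fun o => o.2.2)))
    (h₃ : ∀ a i, Integrable (fun x => ∫ y, (y i - regressionOf ρ a x i) *
      (y i - regressionOf ρ a x i) ∂condDistrib (fun o : Obs m d => o.1) (fun o => o.2) ρ (a, x))
      (ρ.map (fun o => o.2.2))) :
    ∫⁻ o, ‖o.1‖ₑ ^ 2 ∂ρ < ∞ := by
  have hfst : Measurable fun o : Obs m d => o.1 := by fun_prop
  set κ := condDistrib (fun o : Obs m d => o.1) (fun o => o.2) ρ with hκ
  have hcomp := compProd_map_condDistrib (μ := ρ) (mβ := inferInstance)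
    (X := fun o : Obs m d => o.2) (Y := fun o : Obs m d => o.1) hfst.aemeasurable
  have hΦ : Measurable fun b => ∫⁻ y, ‖y‖ₑ ^ 2 ∂κ b :=
    Measurable.lintegral_kernel (f := fun y : Outcome m => ‖y‖ₑ ^ 2) (by fun_prop)
  have h4 : ∫⁻ o, ‖o.1‖ₑ ^ 2 ∂ρ = ∫⁻ o, ∫⁻ y, ‖y‖ₑ ^ 2 ∂κ o.2 ∂ρ := by
    have e1 : ∫⁻ o, ‖o.1‖ₑ ^ 2 ∂ρ = ∫⁻ p, ‖p.2‖ₑ ^ 2 ∂ρ.map (fun o => (o.2, o.1)) := by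
      rw [lintegral_map (by fun_prop) (by fun_prop)]
    rw [e1, ← hcomp, Measure.lintegral_compProd (by fun_prop), lintegral_map hΦ (by fun_prop)]
  -- The moment conditions hold under the law of `X` for each fixed treatment, so the received
  -- treatment is dominated by the sum over all treatments.
  have h5 : ∫⁻ o, ∫⁻ y, ‖y‖ₑ ^ 2 ∂κ o.2 ∂ρ ≤ ∑ a, ∫⁻ o, ∫⁻ y, ‖y‖ₑ ^ 2 ∂κ (a, o.2.2) ∂ρ := by
    have hΦ' : ∀ a, Measurable fun o : Obs m d => ∫⁻ y, ‖y‖ₑ ^ 2 ∂κ (a, o.2.2) := fun a =>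
      hΦ.comp (by fun_prop)
    rw [← lintegral_finsetSum _ fun a _ => hΦ' a]
    refine lintegral_mono fun o => ?_
    exact Finset.single_le_sum (f := fun a => ∫⁻ y, ‖y‖ₑ ^ 2 ∂κ (a, o.2.2))
      (fun _ _ => zero_le) (Finset.mem_univ o.2.1)
  rw [h4]
  refine h5.trans_lt (ENNReal.sum_lt_top.2 fun a _ => ?_)
  rw [← lintegral_map (f := fun x => ∫⁻ y, ‖y‖ₑ ^ 2 ∂κ (a, x)) (hΦ.comp (by fun_prop))
    (by fun_prop)]
  have hint : Integrable (fun x => 2 * (∑ i, ∫ y, (y i - regressionOf ρ a x i) *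
      (y i - regressionOf ρ a x i) ∂κ (a, x)) + 2 * ‖regressionOf ρ a x‖ ^ 2)
      (ρ.map (fun o => o.2.2)) :=
    ((integrable_finsetSum _ fun i _ => h₃ a i).const_mul 2).add
      ((h₂ a).integrable_norm_pow (by norm_num) |>.const_mul 2)
  refine lt_of_le_of_lt ?_ hint.lintegral_lt_top
  refine lintegral_mono_ae ?_
  filter_upwards [h₁ a] with x hx
  have hxn : Integrable (fun y : Outcome m => ‖y‖ ^ 2) (κ (a, x)) :=
    hx.integrable_norm_pow (by norm_num)
  have e1 : ∫⁻ y, ‖y‖ₑ ^ 2 ∂κ (a, x) = ENNReal.ofReal (∫ y, ‖y‖ ^ 2 ∂κ (a, x)) := by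
    rw [ofReal_integral_eq_lintegral_ofReal hxn (ae_of_all _ fun y => sq_nonneg _)]
    refine lintegral_congr fun y => ?_
    rw [ENNReal.ofReal_pow (norm_nonneg _), ofReal_norm]
  rw [e1]
  refine ENNReal.ofReal_le_ofReal ?_
  have hyi : ∀ i, Integrable (fun y : Outcome m => (y i - regressionOf ρ a x i) *
      (y i - regressionOf ρ a x i)) (κ (a, x)) := by
    intro i
    have : MemLp (fun y : Outcome m => y i - regressionOf ρ a x i) 2 (κ (a, x)) := by
      refine MemLp.sub ?_ (memLp_const _)
      refine hx.of_le (by fun_prop) (ae_of_all _ fun y => PiLp.norm_apply_le y i)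
    exact this.integrable_mul_two this
  calc ∫ y, ‖y‖ ^ 2 ∂κ (a, x) ≤ ∫ y, (2 * (∑ i, (y i - regressionOf ρ a x i) *
      (y i - regressionOf ρ a x i)) + 2 * ‖regressionOf ρ a x‖ ^ 2) ∂κ (a, x) := by
        refine integral_mono hxn (((integrable_finsetSum _ fun i _ => hyi i).const_mul 2).add
          (integrable_const _)) fun y => ?_
        simp only [EuclideanSpace.norm_sq_eq, Real.norm_eq_abs, sq_abs, Finset.mul_sum]
        rw [← Finset.sum_add_distrib]
        refine Finset.sum_le_sum fun i _ => ?_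
        -- `y² ≤ 2 (y - g)² + 2 g²` amounts to `(y - 2 g)² ≥ 0`.
        nlinarith [sq_nonneg (y i - 2 * regressionOf ρ a x i)]
    _ = _ := by
        rw [integral_add ((integrable_finsetSum _ fun i _ => hyi i).const_mul 2)
          (integrable_const _), integral_const_mul, integral_finsetSum _ fun i _ => hyi i]
        simp

end ObsLaw

/-! ### Reduction to the clusters of one type -/

section TypeLaw

variable {K : ℕ} {M d : Fin K → ℕ}

theorem injective_ofType (k : Fin K) :
    Function.Injective (ofType k : Obs (M k) (d k) → ClusterObs M d) :=
  fun _ _ h => eq_of_heq (Sigma.mk.inj h).2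

/-- Measurability in the disjoint union is tested on each summand; an image under `ofType k` has
empty trace on the others. -/
theorem measurableEmbedding_ofType (k : Fin K) :
    MeasurableEmbedding (ofType k : Obs (M k) (d k) → ClusterObs M d) where
  injective := injective_ofType k
  measurable := by
    intro s hs
    exact MeasurableSpace.measurableSet_iInf.1 hs k
  measurableSet_image' := by
    intro s hs
    refine MeasurableSpace.measurableSet_iInf.2 fun j => ?_
    change MeasurableSet (ofType (M := M) (d := d) j ⁻¹' (ofType k '' s))
    by_cases hjk : j = k
    · subst hjk
      rwa [Set.preimage_image_eq _ (injective_ofType j)]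
    · convert MeasurableSet.empty
      ext o
      simp only [Set.mem_preimage, Set.mem_image, Set.mem_empty_iff_false, iff_false, not_exists,
        not_and]
      exact fun o' _ h => hjk (congrArg Sigma.fst h).symm

theorem range_ofType (k : Fin K) :
    Set.range (ofType k : Obs (M k) (d k) → ClusterObs M d) = {z | z.1 = k} := by
  ext ⟨j, o⟩
  constructor
  · rintro ⟨o', h⟩; exact (congrArg Sigma.fst h).symm
  · rintro rfl; exact ⟨o, rfl⟩

theorem measurableSet_type (k : Fin K) : MeasurableSet {z : ClusterObs M d | z.1 = k} := by
  rw [← range_ofType]; exact (measurableEmbedding_ofType k).measurableSet_range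

/-- Separates the normalisation, which varies along a submodel, from the unnormalised law, whose
density is simply the squared root restricted to type `k`. -/
theorem typeLaw_eq_smul_comap (P : Measure (ClusterObs M d)) (k : Fin K) :
    typeLaw P k = (P {z | z.1 = k})⁻¹ • P.comap (ofType k) := by
  have h : (ofType k : Obs (M k) (d k) → ClusterObs M d) ⁻¹' {z | z.1 = k} = Set.univ := by
    ext o; simp [ofType]
  rw [typeLaw, ProbabilityTheory.cond, Measure.comap_smul,
    (measurableEmbedding_ofType k).comap_restrict, h, Measure.restrict_univ]

theorem onType_ofType (k : Fin K) (f : Obs (M k) (d k) → ℝ) (o : Obs (M k) (d k)) :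
    onType (M := M) (d := d) k f (ofType k o) = f o :=
  (measurableEmbedding_ofType k).injective.extend_apply _ _ _

theorem onType_of_ne {k : Fin K} (f : Obs (M k) (d k) → ℝ) {z : ClusterObs M d} (h : z.1 ≠ k) :
    onType k f z = 0 := by
  rw [onType, Function.extend_apply']
  · rfl
  · rintro ⟨o, rfl⟩; exact h rfl

theorem measurable_onType (k : Fin K) {f : Obs (M k) (d k) → ℝ} (hf : Measurable f) :
    Measurable (onType (M := M) (d := d) k f) :=
  (measurableEmbedding_ofType k).measurable_extend hf measurable_zero

theorem integral_onType (Q : Measure (ClusterObs M d)) (k : Fin K) (f : Obs (M k) (d k) → ℝ) :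
    ∫ z, onType k f z ∂Q = ∫ o, f o ∂Q.comap (ofType k) := by
  have h1 : ∫ o, f o ∂Q.comap (ofType k) =
      ∫ o, onType (M := M) (d := d) k f (ofType k o) ∂Q.comap (ofType k) := by
    simp_rw [onType_ofType]
  rw [h1, ← (measurableEmbedding_ofType k).integral_map, (measurableEmbedding_ofType k).map_comap,
    range_ofType, setIntegral_eq_integral_of_forall_compl_eq_zero]
  intro z hz
  exact onType_of_ne f hz

theorem setIntegral_type (Q : Measure (ClusterObs M d)) (k : Fin K) (f : ClusterObs M d → ℝ) :
    ∫ z in {z | z.1 = k}, f z ∂Q = ∫ o, f (ofType k o) ∂Q.comap (ofType k) := by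
  rw [← (measurableEmbedding_ofType k).integral_map, (measurableEmbedding_ofType k).map_comap,
    range_ofType]

theorem comap_ofType_withDensity (ν : Measure (ClusterObs M d)) (k : Fin K)
    (f : ClusterObs M d → ℝ≥0∞) :
    (ν.withDensity f).comap (ofType k) = (ν.comap (ofType k)).withDensity (f ∘ ofType k) := by
  have he := measurableEmbedding_ofType (M := M) (d := d) k
  ext s hs
  have hs' := he.measurableSet_image.2 hs
  rw [he.comap_apply, withDensity_apply _ hs', withDensity_apply _ hs,
    he.restrict_comap]
  change _ = ∫⁻ o, f (ofType k o) ∂_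
  rw [← he.lintegral_map, he.map_comap, Measure.restrict_restrict
      he.measurableSet_range, Set.inter_eq_right.2 (Set.image_subset_range _ _)]

theorem typeProb_eq_comap (Q : Measure (ClusterObs M d)) (k : Fin K) :
    typeProb Q k = (Q.comap (ofType k)).real Set.univ := by
  rw [typeProb, measureReal_def, measureReal_def, (measurableEmbedding_ofType k).comap_apply,
    Set.image_univ, range_ofType]

theorem integral_typeLaw (Q : Measure (ClusterObs M d)) (k : Fin K) (f : Obs (M k) (d k) → ℝ) :
    ∫ o, f o ∂typeLaw Q k = (typeProb Q k)⁻¹ * ∫ o, f o ∂Q.comap (ofType k) := by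
  rw [typeLaw_eq_smul_comap, integral_smul_measure, ENNReal.toReal_inv, smul_eq_mul]
  rfl

theorem integral_comap_ofType (Q : Measure (ClusterObs M d)) {k : Fin K} (hp : 0 < typeProb Q k)
    (f : Obs (M k) (d k) → ℝ) :
    ∫ o, f o ∂Q.comap (ofType k) = typeProb Q k * ∫ o, f o ∂typeLaw Q k := by
  rw [integral_typeLaw, mul_inv_cancel_left₀ hp.ne']

theorem isProbabilityMeasure_typeLaw (Q : Measure (ClusterObs M d)) [IsFiniteMeasure Q] {k : Fin K}
    (hp : 0 < typeProb Q k) : IsProbabilityMeasure (typeLaw Q k) := by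
  have hne : Q {z | z.1 = k} ≠ 0 := by
    intro h; simp [typeProb, measureReal_def, h] at hp
  constructor
  rw [typeLaw_eq_smul_comap, Measure.smul_apply, (measurableEmbedding_ofType k).comap_apply,
    Set.image_univ, range_ofType, smul_eq_mul, ENNReal.inv_mul_cancel hne (measure_ne_top _ _)]

theorem ae_typeLaw_iff (Q : Measure (ClusterObs M d)) [IsFiniteMeasure Q] (k : Fin K)
    {p : Obs (M k) (d k) → Prop} :
    (∀ᵐ o ∂typeLaw Q k, p o) ↔ ∀ᵐ o ∂Q.comap (ofType k), p o := by
  rw [typeLaw_eq_smul_comap, Measure.ae_ennreal_smul_measure_iff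
    (ENNReal.inv_ne_zero.2 (measure_ne_top _ _))]

theorem integrable_typeLaw_iff (Q : Measure (ClusterObs M d)) [IsFiniteMeasure Q] {k : Fin K}
    (hp : 0 < typeProb Q k) {F : Type*} [NormedAddCommGroup F] {f : Obs (M k) (d k) → F} :
    Integrable f (typeLaw Q k) ↔ Integrable f (Q.comap (ofType k)) := by
  have hne : Q {z | z.1 = k} ≠ 0 := by
    intro h; simp [typeProb, measureReal_def, h] at hp
  rw [typeLaw_eq_smul_comap, integrable_smul_measure (ENNReal.inv_ne_zero.2 (measure_ne_top _ _))
    (ENNReal.inv_ne_top.2 hne)]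

end TypeLaw

section TypeLaw

variable {K : ℕ} {M d : Fin K → ℕ}

theorem ae_comap_ofType_iff (Q : Measure (ClusterObs M d)) (k : Fin K)
    {p : ClusterObs M d → Prop} :
    (∀ᵐ o ∂Q.comap (ofType k), p (ofType k o)) ↔ ∀ᵐ z ∂Q, z.1 = k → p z := by
  have he := measurableEmbedding_ofType (M := M) (d := d) k
  rw [← he.ae_map_iff, he.map_comap, ae_restrict_iff' he.measurableSet_range, range_ofType]
  rfl

theorem integrable_onType_iff (Q : Measure (ClusterObs M d)) (k : Fin K)
    {f : Obs (M k) (d k) → ℝ} :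
    Integrable (onType (M := M) (d := d) k f) Q ↔ Integrable f (Q.comap (ofType k)) := by
  have he := measurableEmbedding_ofType (M := M) (d := d) k
  have h1 : (onType (M := M) (d := d) k f) ∘ ofType k = f := by
    ext o; exact onType_ofType k f o
  rw [← integrableOn_iff_integrable_of_support_subset (s := {z | z.1 = k}) (fun z hz => by
    by_contra h; exact hz (onType_of_ne f h)), IntegrableOn, ← range_ofType, ← he.map_comap,
    he.integrable_map_iff, h1]

theorem onType_sq (k : Fin K) (f : Obs (M k) (d k) → ℝ) (z : ClusterObs M d) :
    onType k f z ^ 2 = onType k (fun o => f o ^ 2) z := by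
  by_cases h : z.1 = k
  · obtain ⟨o, rfl⟩ : z ∈ Set.range (ofType (M := M) (d := d) k) := by rwa [range_ofType]
    rw [onType_ofType, onType_ofType]
  · rw [onType_of_ne _ h, onType_of_ne _ h]; simp

theorem memLp_onType_iff (Q : Measure (ClusterObs M d)) (k : Fin K)
    {f : Obs (M k) (d k) → ℝ} (hf : Measurable f) :
    MemLp (onType (M := M) (d := d) k f) 2 Q ↔ MemLp f 2 (Q.comap (ofType k)) := by
  rw [memLp_two_iff_integrable_sq (measurable_onType k hf).aestronglyMeasurable,
    memLp_two_iff_integrable_sq hf.aestronglyMeasurable, ← integrable_onType_iff]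
  simp_rw [onType_sq]

theorem onType_one (k : Fin K) (z : ClusterObs M d) :
    onType k (fun _ => 1) z = if z.1 = k then 1 else 0 := by
  split_ifs with h
  · obtain ⟨o, rfl⟩ : z ∈ Set.range (ofType (M := M) (d := d) k) := by rwa [range_ofType]
    rw [onType_ofType]
  · rw [onType_of_ne _ h]

theorem measurePreserving_ofType (ν : Measure (ClusterObs M d)) (k : Fin K) :
    MeasurePreserving (ofType k) (ν.comap (ofType k))
      (ν.restrict (Set.range (ofType (M := M) (d := d) k))) :=
  ⟨(measurableEmbedding_ofType k).measurable, (measurableEmbedding_ofType k).map_comap ν⟩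

/-- The restriction of square integrable functions of `(L, O)` to the clusters of type `k`. -/
def restrictType (ν : Measure (ClusterObs M d)) (k : Fin K) :
    Lp ℝ 2 ν →L[ℝ] Lp ℝ 2 (ν.comap (ofType k)) :=
  (Lp.compMeasurePreservingₗᵢ ℝ _
      (measurePreserving_ofType ν k)).toContinuousLinearMap.comp
    (LpToLpRestrictCLM _ ℝ ℝ ν 2 (Set.range (ofType k)))

theorem coeFn_restrictType (ν : Measure (ClusterObs M d)) (k : Fin K) (r : Lp ℝ 2 ν) :
    restrictType ν k r =ᵐ[ν.comap (ofType k)] fun o => r (ofType k o) := by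
  have h1 : restrictType ν k r =ᵐ[ν.comap (ofType k)]
      (LpToLpRestrictCLM _ ℝ ℝ ν 2 (Set.range (ofType (M := M) (d := d) k)) r) ∘ ofType k :=
    Lp.coeFn_compMeasurePreserving _ (measurePreserving_ofType ν k)
  have h2 := (measurePreserving_ofType ν k).quasiMeasurePreserving.ae
    (LpToLpRestrictCLM_coeFn ℝ (Set.range (ofType (M := M) (d := d) k)) r)
  filter_upwards [h1, h2] with o ho ho'
  rw [ho, Function.comp_apply, ho']

end TypeLaw

theorem EuclideanSpace.clm_ext {m : ℕ} {L L' : EuclideanSpace ℝ (Fin m) →L[ℝ] ℝ}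
    (h : ∀ j, L (EuclideanSpace.single j 1) = L' (EuclideanSpace.single j 1)) : L = L' := by
  have : (L : EuclideanSpace ℝ (Fin m) →ₗ[ℝ] ℝ) = L' := by
    refine (EuclideanSpace.basisFun (Fin m) ℝ).toBasis.ext fun j => ?_
    simpa using h j
  exact ContinuousLinearMap.coe_injective this

/-! ### Derivatives expressed through scores, and the type probabilities -/

namespace RegularSubmodel

section

variable {Z : Type*} [MeasurableSpace Z] {P : Measure Z} {m : ℕ} (S : RegularSubmodel P m)

/-- The linear form with gradient `E_P(f s)`, where `s` is the score. -/
def scoreDual (f : Z → ℝ) : EuclideanSpace ℝ (Fin m) →L[ℝ] ℝ :=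
  InnerProductSpace.toDual ℝ _ (WithLp.toLp 2 fun j => ∫ z, f z * S.score j z ∂P)

theorem scoreDual_single (f : Z → ℝ) (j : Fin m) :
    S.scoreDual f (EuclideanSpace.single j 1) = ∫ z, f z * S.score j z ∂P := by
  simp [scoreDual, EuclideanSpace.inner_single_right]

theorem scoreDual_congr {f g : Z → ℝ} (h : f =ᵐ[P] g) : S.scoreDual f = S.scoreDual g := by
  refine EuclideanSpace.clm_ext fun j => ?_
  rw [scoreDual_single, scoreDual_single]
  refine integral_congr_ae ?_
  filter_upwards [h] with z hz
  rw [hz]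

theorem scoreDual_add {f g : Z → ℝ} (hf : MemLp f 2 P) (hg : MemLp g 2 P) :
    S.scoreDual (fun z => f z + g z) = S.scoreDual f + S.scoreDual g := by
  refine EuclideanSpace.clm_ext fun j => ?_
  rw [add_apply, scoreDual_single, scoreDual_single, scoreDual_single,
    ← integral_add (hf.integrable_mul_two (S.memLp_score j))
      (hg.integrable_mul_two (S.memLp_score j))]
  simp_rw [add_mul]

theorem scoreDual_const_mul (c : ℝ) (f : Z → ℝ) :
    S.scoreDual (fun z => c * f z) = c • S.scoreDual f := by
  refine EuclideanSpace.clm_ext fun j => ?_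
  rw [smul_apply, scoreDual_single, scoreDual_single, smul_eq_mul,
    ← integral_const_mul]
  simp_rw [mul_assoc]

/-- Scores have mean zero, so centring constants do not affect gradients. -/
theorem scoreDual_const (c : ℝ) : S.scoreDual (fun _ => c) = 0 := by
  refine EuclideanSpace.clm_ext fun j => ?_
  rw [scoreDual_single, integral_const_mul, S.integral_score, mul_zero,
    zero_apply]

theorem scoreDual_sum {ι : Type*} (s : Finset ι) {f : ι → Z → ℝ}
    (hf : ∀ i ∈ s, MemLp (f i) 2 P) :
    S.scoreDual (fun z => ∑ i ∈ s, f i z) = ∑ i ∈ s, S.scoreDual (f i) := by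
  refine EuclideanSpace.clm_ext fun j => ?_
  rw [sum_apply, scoreDual_single]
  simp_rw [scoreDual_single, Finset.sum_mul]
  exact integral_finsetSum _ fun i hi => (hf i hi).integrable_mul_two (S.memLp_score j)

end

section

variable {K : ℕ} {M d : Fin K → ℕ} {P : Measure (ClusterObs M d)} {m : ℕ}
  (S : RegularSubmodel P m) (k : Fin K)

/-- The square root of the density, on the clusters of type `k`. -/
def rootOn (η : EuclideanSpace ℝ (Fin m)) : Lp ℝ 2 (S.dominating.comap (ofType k)) :=
  restrictType S.dominating k (S.root η)

theorem measurable_rootOn (η : EuclideanSpace ℝ (Fin m)) : Measurable (S.rootOn k η) :=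
  (Lp.stronglyMeasurable _).measurable

theorem hasFDerivAt_rootOn : HasFDerivAt (S.rootOn k)
    ((restrictType S.dominating k).comp (fderiv ℝ S.root S.truth)) S.truth :=
  (restrictType S.dominating k).hasFDerivAt.comp _ S.hasFDerivAt_root

theorem law_comap (η : EuclideanSpace ℝ (Fin m)) :
    (S.law η).comap (ofType k) = (S.dominating.comap (ofType k)).withDensity
      (fun o => ENNReal.ofReal (S.rootOn k η o ^ 2)) := by
  rw [law, comap_ofType_withDensity]
  refine withDensity_congr_ae ?_
  filter_upwards [coeFn_restrictType S.dominating k (S.root η)] with o ho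
  rw [rootOn, ho]; rfl

theorem integral_law_comap (η : EuclideanSpace ℝ (Fin m)) (f : Obs (M k) (d k) → ℝ) :
    ∫ o, f o ∂(S.law η).comap (ofType k) =
      ∫ o, f o * S.rootOn k η o ^ 2 ∂S.dominating.comap (ofType k) := by
  rw [law_comap, integral_withDensity_sq (S.measurable_rootOn k η)]
  simp_rw [mul_comm]

theorem memLp_law_comap_iff (η : EuclideanSpace ℝ (Fin m)) {f : Obs (M k) (d k) → ℝ}
    (hf : Measurable f) : MemLp f 2 ((S.law η).comap (ofType k)) ↔
      MemLp (fun o => f o * S.rootOn k η o) 2 (S.dominating.comap (ofType k)) := by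
  rw [law_comap, memLp_two_withDensity_sq_iff (S.measurable_rootOn k η) hf]

theorem typeProb_law (η : EuclideanSpace ℝ (Fin m)) :
    typeProb (S.law η) k = ∫ o, S.rootOn k η o ^ 2 ∂S.dominating.comap (ofType k) := by
  have := S.integral_law_comap k η fun _ => 1
  rw [typeProb_eq_comap]
  simpa using this

theorem integral_onType_mul_score (f : Obs (M k) (d k) → ℝ) (j : Fin m) :
    ∫ z, onType k f z * S.score j z ∂P =
      ∫ o, 2 * (f o * S.rootOn k S.truth o) *
        (restrictType S.dominating k (fderiv ℝ S.root S.truth (EuclideanSpace.single j 1))) o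
        ∂S.dominating.comap (ofType k) := by
  rw [S.integral_mul_score]
  have h1 : ∫ z, 2 * (onType k f z * S.root S.truth z) * S.rootDeriv j z ∂S.dominating =
      ∫ z in {z | z.1 = k}, 2 * (onType k f z * S.root S.truth z) * S.rootDeriv j z
        ∂S.dominating := by
    rw [setIntegral_eq_integral_of_forall_compl_eq_zero]
    intro z hz
    rw [onType_of_ne f hz]; simp
  rw [h1, setIntegral_type]
  refine integral_congr_ae ?_
  filter_upwards [coeFn_restrictType S.dominating k (S.root S.truth),
    coeFn_restrictType S.dominating k (S.rootDeriv j)] with o h1 h2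
  rw [onType_ofType, rootOn, h1, ← h2]
  rfl

/-- Translates the derivative found in `hasFDerivAt_ipw`, an inner product with the derivative of
the root, into a pairing with the score. -/
theorem innerSL_comp_eq_scoreDual {f : Obs (M k) (d k) → ℝ}
    (hf : MemLp (fun o => 2 * (f o * S.rootOn k S.truth o)) 2 (S.dominating.comap (ofType k))) :
    (innerSL ℝ (hf.toLp _)).comp
      ((restrictType S.dominating k).comp (fderiv ℝ S.root S.truth)) =
      S.scoreDual (onType k f) := by
  refine EuclideanSpace.clm_ext fun j => ?_
  rw [scoreDual_single, S.integral_onType_mul_score]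
  simp only [ContinuousLinearMap.comp_apply, innerSL_apply_apply]
  rw [L2.inner_def]
  refine integral_congr_ae ?_
  filter_upwards [hf.coeFn_toLp] with o ho
  simp only [RCLike.inner_apply, conj_trivial, ho]; ring

/-- `p_k` is the squared L² norm of the root on type `k`. -/
theorem hasFDerivAt_typeProb : HasFDerivAt (fun η => typeProb (S.law η) k)
    (S.scoreDual (onType k fun _ => 1)) S.truth := by
  have h1 := hasFDerivAt_integral_sq (S.hasFDerivAt_rootOn k)
  simp_rw [← S.typeProb_law k] at h1
  refine h1.congr_fderiv ?_
  symm
  refine EuclideanSpace.clm_ext fun j => ?_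
  rw [scoreDual_single, S.integral_onType_mul_score]
  simp only [smul_apply, ContinuousLinearMap.comp_apply, innerSL_apply_apply]
  rw [L2.inner_def, nsmul_eq_mul, ← integral_const_mul]
  refine integral_congr_ae (ae_of_all _ fun o => ?_)
  simp only [RCLike.inner_apply, conj_trivial]
  push_cast; ring

end

end RegularSubmodel

/-! ### Moment bounds in the model and the terms of the influence function -/

section Model

variable {K : ℕ} {M d : Fin K → ℕ} {c : ℝ} {C : ℝ≥0} {Q : Measure (ClusterObs M d)}

theorem ae_le_propensityOf_of_overlap (h : Overlap Q c) (k : Fin K) (a : Treatment (M k)) :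
    ∀ᵐ x ∂(typeLaw Q k).map (fun o => o.2.2), c ≤ propensityOf (typeLaw Q k) a x :=
  (h k a).mono fun _ hx => hx.1.le

theorem le_one_of_overlap [IsFiniteMeasure Q] (h : Overlap Q c) {k : Fin K}
    (hp : 0 < typeProb Q k) : c ≤ 1 := by
  have := isProbabilityMeasure_typeLaw Q hp
  have : IsProbabilityMeasure ((typeLaw Q k).map (fun o => o.2.2)) :=
    Measure.isProbabilityMeasure_map (by fun_prop)
  obtain ⟨x, hx⟩ := (ae_le_propensityOf_of_overlap h k fun _ => false).exists
  exact hx.trans (propensityOf_le_one _ _ _)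

theorem memLp_fst_typeLaw {k : Fin K} (h : ∫⁻ o, ‖o.1‖ₑ ^ 2 ∂typeLaw Q k < ∞) :
    MemLp (fun o : Obs (M k) (d k) => o.1) 2 (typeLaw Q k) := by
  refine ⟨by fun_prop, ?_⟩
  rw [eLpNorm_lt_top_iff_lintegral_rpow_enorm_lt_top (by norm_num) (by norm_num)]
  simpa using h

theorem integrable_fst_typeLaw {k : Fin K} (h : ∫⁻ o, ‖o.1‖ₑ ^ 2 ∂typeLaw Q k < ∞) :
    Integrable (fun o : Obs (M k) (d k) => o.1) (typeLaw Q k) :=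
  (memLp_fst_typeLaw h).integrable (by norm_num)

theorem memLp_typeLaw_iff [IsFiniteMeasure Q] {k : Fin K} (hp : 0 < typeProb Q k)
    {f : Obs (M k) (d k) → ℝ} (hf : Measurable f) :
    MemLp f 2 (typeLaw Q k) ↔ MemLp f 2 (Q.comap (ofType k)) := by
  rw [memLp_two_iff_integrable_sq hf.aestronglyMeasurable,
    memLp_two_iff_integrable_sq hf.aestronglyMeasurable, integrable_typeLaw_iff Q hp]

theorem typeProb_le_one [IsProbabilityMeasure Q] (k : Fin K) : typeProb Q k ≤ 1 :=
  measureReal_le_one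

theorem memLp_inner_outcome {k : Fin K} (h : ∫⁻ o, ‖o.1‖ₑ ^ 2 ∂typeLaw Q k < ∞)
    {w : Covariate (d k) → Outcome (M k)} (hw : Measurable w) {B : ℝ} (hB : ∀ x, ‖w x‖ ≤ B) :
    MemLp (fun o : Obs (M k) (d k) => inner ℝ (w o.2.2) o.1) 2 (typeLaw Q k) :=
  (memLp_fst_typeLaw h).of_le_mul (c := B) (by fun_prop) (ae_of_all _ fun o =>
    (norm_inner_le_norm _ _).trans (mul_le_mul_of_nonneg_right (hB _) (norm_nonneg _)))

/-- Supplies the bound on `T r_η` that is uniform along a submodel. -/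
theorem integral_inner_outcome_sq_le {k : Fin K} (h : ∫⁻ o, ‖o.1‖ₑ ^ 2 ∂typeLaw Q k ≤ C)
    {w : Covariate (d k) → Outcome (M k)} (hw : Measurable w) {B : ℝ} (hB : ∀ x, ‖w x‖ ≤ B) :
    ∫ o, inner ℝ (w o.2.2) o.1 ^ 2 ∂typeLaw Q k ≤ B ^ 2 * C := by
  have h' := h.trans_lt ENNReal.coe_lt_top
  have h1 : ∫ o, ‖o.1‖ ^ 2 ∂typeLaw Q k ≤ C := by
    rw [integral_eq_lintegral_of_nonneg_ae (ae_of_all _ fun _ => sq_nonneg _) (by fun_prop)]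
    refine ENNReal.toReal_le_coe_of_le_coe (le_trans (le_of_eq (lintegral_congr fun o => ?_)) h)
    rw [ENNReal.ofReal_pow (norm_nonneg _), ofReal_norm]
  have h2 : Integrable (fun o : Obs (M k) (d k) => ‖o.1‖ ^ 2) (typeLaw Q k) :=
    (memLp_fst_typeLaw h').integrable_norm_pow (by norm_num)
  calc _ ≤ ∫ o, B ^ 2 * ‖o.1‖ ^ 2 ∂typeLaw Q k := by
        refine integral_mono (memLp_inner_outcome h' hw hB).integrable_sq (h2.const_mul _)
          fun o => ?_
        simp only
        rw [← mul_pow, ← sq_abs]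
        exact pow_le_pow_left₀ (abs_nonneg _) ((abs_real_inner_le_norm _ _).trans
          (mul_le_mul_of_nonneg_right (hB _) (norm_nonneg _))) 2
    _ ≤ B ^ 2 * C := by
        rw [integral_const_mul]; exact mul_le_mul_of_nonneg_left h1 (sq_nonneg B)

theorem memLp_regression {P : Measure (ClusterObs M d)} {k : Fin K} {a : Treatment (M k)}
    (h : MemLp (outcomeReg P k a) 2 (covLaw P k)) :
    MemLp (fun o : Obs (M k) (d k) => outcomeReg P k a o.2.2) 2 (typeLaw P k) :=
  h.comp_measurePreserving (f := fun o : Obs (M k) (d k) => o.2.2) ⟨by fun_prop, rfl⟩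

theorem measurable_outcomeReg (P : Measure (ClusterObs M d)) (k : Fin K) (a : Treatment (M k)) :
    Measurable (outcomeReg P k a) := measurable_regressionOf (typeLaw P k) a

theorem memLp_inner_regression {P : Measure (ClusterObs M d)} {k : Fin K} {a : Treatment (M k)}
    (h : MemLp (outcomeReg P k a) 2 (covLaw P k))
    {w : Covariate (d k) → Outcome (M k)} (hw : Measurable w) {B : ℝ} (hB : ∀ x, ‖w x‖ ≤ B) :
    MemLp (fun o : Obs (M k) (d k) => inner ℝ (w o.2.2) (outcomeReg P k a o.2.2)) 2
      (typeLaw P k) := by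
  have hr := measurable_outcomeReg P k a
  exact (memLp_regression h).of_le_mul (c := B) (by fun_prop) (ae_of_all _ fun o =>
    (norm_inner_le_norm _ _).trans (mul_le_mul_of_nonneg_right (hB _) (norm_nonneg _)))

/-- The summand of treatment `a` in the augmented inverse probability weighted estimating function,
with propensities bounded below by `c`. -/
def aipwTerm (P : Measure (ClusterObs M d)) (w : Weights M d) (k : Fin K) (c : ℝ)
    (a : Treatment (M k)) (o : Obs (M k) (d k)) : ℝ :=
  treatedInd a o * (inner ℝ (w k a o.2.2) o.1 - inner ℝ (w k a o.2.2) (outcomeReg P k a o.2.2)) /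
      clipPropensity (typeLaw P k) c a o.2.2 +
    inner ℝ (w k a o.2.2) (outcomeReg P k a o.2.2)

variable {P : Measure (ClusterObs M d)} {w : Weights M d}

theorem measurable_aipwTerm (hw : ∀ k a, Measurable (w k a)) (k : Fin K) (a : Treatment (M k)) :
    Measurable (aipwTerm P w k c a) := by
  have h1 := measurable_treatedInd (d := d k) a
  have h2 := measurable_clipPropensity (typeLaw P k) c a
  have h3 := measurable_outcomeReg P k a
  have h4 := hw k a
  unfold aipwTerm
  fun_prop

theorem memLp_aipwTerm (hc : 0 < c) (hw : ∀ k a, Measurable (w k a)) {B : ℝ}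
    (hB : ∀ k a x, ‖w k a x‖ ≤ B) {k : Fin K} (h : ∫⁻ o, ‖o.1‖ₑ ^ 2 ∂typeLaw P k < ∞)
    {a : Treatment (M k)} (hg : MemLp (outcomeReg P k a) 2 (covLaw P k)) :
    MemLp (aipwTerm P w k c a) 2 (typeLaw P k) := by
  have h1 := measurable_treatedInd (d := d k) a
  have h2 := measurable_clipPropensity (typeLaw P k) c a
  have hm : Measurable fun o : Obs (M k) (d k) =>
      treatedInd a o / clipPropensity (typeLaw P k) c a o.2.2 := by fun_prop
  have hT := memLp_inner_outcome h (hw k a) (hB k a)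
  have hG := memLp_inner_regression hg (hw k a) (hB k a)
  refine (((hT.sub hG).bdd_mul_two (B := c⁻¹) hm.aestronglyMeasurable fun o => ?_).add hG).ae_eq
    (ae_of_all _ fun o => ?_)
  · have hpos : 0 < clipPropensity (typeLaw P k) c a o.2.2 := hc.trans_le (le_max_left _ _)
    rw [abs_div, abs_of_pos hpos, div_eq_mul_inv]
    calc _ ≤ 1 * c⁻¹ := mul_le_mul (abs_treatedInd_le a o) (inv_anti₀ hc (le_max_left _ _))
          (inv_nonneg.2 hpos.le) zero_le_one
      _ = _ := one_mul _
  · simp only [aipwTerm, Pi.add_apply, Pi.sub_apply]; ring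

theorem integral_aipwTerm (hc : 0 < c) (hw : ∀ k a, Measurable (w k a)) {B : ℝ}
    (hB : ∀ k a x, ‖w k a x‖ ≤ B) {k : Fin K} (h : ∫⁻ o, ‖o.1‖ₑ ^ 2 ∂typeLaw P k < ∞)
    {a : Treatment (M k)} (hg : MemLp (outcomeReg P k a) 2 (covLaw P k)) :
    ∫ o, aipwTerm P w k c a o ∂typeLaw P k =
      ∫ x, inner ℝ (w k a x) (outcomeReg P k a x) ∂covLaw P k := by
  have h2 := measurable_clipPropensity (typeLaw P k) c a
  have h3 := measurable_outcomeReg P k a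
  have h4 := hw k a
  have hG := memLp_inner_regression hg (hw k a) (hB k a)
  have hpos : ∀ x, 0 < clipPropensity (typeLaw P k) c a x := fun x => hc.trans_le (le_max_left _ _)
  have h5 := integral_treatedInd_mul_sub_regressionOf (integrable_fst_typeLaw h)
    ((memLp_regression hg).integrable (by norm_num)) (hw k a) (hB k a)
    (f := fun x => (clipPropensity (typeLaw P k) c a x)⁻¹) (by fun_prop) ⟨c⁻¹, fun x => by
      rw [abs_inv, abs_of_pos (hpos x)]; exact inv_anti₀ hc (le_max_left _ _)⟩
  have i2 : Integrable (fun o : Obs (M k) (d k) =>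
      inner ℝ (w k a o.2.2) (outcomeReg P k a o.2.2)) (typeLaw P k) :=
    hG.integrable (by norm_num)
  have i1 : Integrable (fun o : Obs (M k) (d k) => treatedInd a o * (inner ℝ (w k a o.2.2) o.1 -
      inner ℝ (w k a o.2.2) (outcomeReg P k a o.2.2)) /
      clipPropensity (typeLaw P k) c a o.2.2) (typeLaw P k) := by
    refine (((memLp_aipwTerm hc hw hB h hg).integrable (by norm_num)).sub i2).congr
      (ae_of_all _ fun o => ?_)
    simp [aipwTerm]
  unfold aipwTerm
  rw [integral_add i1 i2]
  simp only [div_eq_mul_inv]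
  change ∫ o, treatedInd a o * (inner ℝ (w k a o.2.2) o.1 -
    inner ℝ (w k a o.2.2) (regressionOf (typeLaw P k) a o.2.2)) *
    (clipPropensity (typeLaw P k) c a o.2.2)⁻¹ ∂typeLaw P k + _ = _
  rw [h5, zero_add, covLaw, integral_map (by fun_prop) (by fun_prop)]

end Model

/-! ### Differentiation of the weighted regression means -/

namespace RegularSubmodel

variable {K : ℕ} {M d : Fin K → ℕ} {P : Measure (ClusterObs M d)} {m : ℕ}
  (S : RegularSubmodel P m)

/-- The factor `p_k` undoes the conditioning on `L = k`. By `integral_ipw_eq` the product is an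
inverse probability weighted integral against the squared root on type `k`, and `hasFDerivAt_ipw`
applies with the clipped propensities of the submodel laws as weights. -/
theorem hasFDerivAt_typeProb_mul_integral {c : ℝ} {C : ℝ≥0} (hc : 0 < c)
    (hS : ∀ᶠ η in 𝓝 S.truth, S.law η ∈ npModel M d c C)
    (k : Fin K) (a : Treatment (M k)) (hg : MemLp (outcomeReg P k a) 2 (covLaw P k))
    {w : Weights M d} (hw : ∀ k a, Measurable (w k a)) {B : ℝ} (hB : ∀ k a x, ‖w k a x‖ ≤ B) :
    HasFDerivAt (fun η => typeProb (S.law η) k *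
      ∫ x, inner ℝ (w k a x) (outcomeReg (S.law η) k a x) ∂covLaw (S.law η) k)
      (S.scoreDual (onType k (aipwTerm P w k c a))) S.truth := by
  have hP := hS.self_of_nhds
  rw [S.law_eq_truth] at hP
  obtain ⟨hPprob, hPp, hPo, hPm⟩ := hP
  have hB0 : 0 ≤ B := (norm_nonneg _).trans (hB k a 0)
  have hc1 : c ≤ 1 := le_one_of_overlap hPo (hPp k)
  have hT : Measurable fun o : Obs (M k) (d k) => inner ℝ (w k a o.2.2) o.1 := by
    have := hw k a; fun_prop
  have hG : Measurable fun x => inner ℝ (w k a x) (outcomeReg P k a x) :=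
    (hw k a).inner (measurable_outcomeReg P k a)
  have hPY : ∫⁻ o, ‖o.1‖ₑ ^ 2 ∂typeLaw P k < ∞ := (hPm k).trans_lt ENNReal.coe_lt_top
  have hF : MemLp (fun o => 2 * (aipwTerm P w k c a o * S.rootOn k S.truth o)) 2
      (S.dominating.comap (ofType k)) := by
    refine MemLp.const_mul ?_ 2
    rw [← S.memLp_law_comap_iff k _ (measurable_aipwTerm hw k a), S.law_eq_truth,
      ← memLp_typeLaw_iff (hPp k) (measurable_aipwTerm hw k a)]
    exact memLp_aipwTerm hc hw hB hPY hg
  have hterm : (fun o : Obs (M k) (d k) => treatedInd a o * (inner ℝ (w k a o.2.2) o.1 -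
      inner ℝ (w k a o.2.2) (outcomeReg P k a o.2.2)) /
      clipPropensity (typeLaw (S.law S.truth) k) c a o.2.2 +
      inner ℝ (w k a o.2.2) (outcomeReg P k a o.2.2)) = aipwTerm P w k c a := by
    rw [S.law_eq_truth]; rfl
  have hF' : MemLp (fun o : Obs (M k) (d k) => 2 * ((treatedInd a o * (inner ℝ (w k a o.2.2) o.1 -
      inner ℝ (w k a o.2.2) (outcomeReg P k a o.2.2)) /
      clipPropensity (typeLaw (S.law S.truth) k) c a o.2.2 +
      inner ℝ (w k a o.2.2) (outcomeReg P k a o.2.2)) * S.rootOn k S.truth o)) 2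
      (S.dominating.comap (ofType k)) := by
    exact hF.ae_eq (ae_of_all _ fun o => by rw [← hterm])
  have hder := S.innerSL_comp_eq_scoreDual k hF'
  rw [hterm] at hder
  -- The value of `A` comes from `‖T r_η‖² = p_k E(T² | L = k) ≤ B² C`, using `p_k ≤ 1`.
  have hmain := hasFDerivAt_ipw (S.hasFDerivAt_rootOn k) (α := treatedInd a)
    (T := fun o => inner ℝ (w k a o.2.2) o.1) (ξ := fun o => o.2.2)
    (e := fun η => clipPropensity (typeLaw (S.law η) k) c a)
    (G := fun x => inner ℝ (w k a x) (outcomeReg P k a x)) (A := Real.sqrt (B ^ 2 * C))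
    hc hc1 (measurable_treatedInd a) hT (by fun_prop)
    (fun η => measurable_clipPropensity _ c a) hG (treatedInd_mem_Icc a)
    (fun η => clipPropensity_mem_Icc _ hc1 a) ?_ ?_ ?_ ?_ hF'
  · refine (hmain.congr_of_eventuallyEq ?_).congr_fderiv hder
    filter_upwards [hS] with η ⟨hprob, hp, ho, hm⟩
    rw [covLaw, integral_map (by fun_prop)
      (((hw k a).inner (measurable_outcomeReg _ k a))).aestronglyMeasurable]
    have h1 := integral_ipw_eq hc (ae_le_propensityOf_of_overlap ho k a)
      (integrable_fst_typeLaw ((hm k).trans_lt ENNReal.coe_lt_top)) (hw k a) (hB k a)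
    change typeProb (S.law η) k * ∫ o, inner ℝ (w k a o.2.2)
      (regressionOf (typeLaw (S.law η) k) a o.2.2) ∂typeLaw (S.law η) k = _
    rw [← h1, ← integral_comap_ofType _ (hp k), S.integral_law_comap]
  · filter_upwards [hS] with η ⟨hprob, hp, ho, hm⟩
    have hY := (hm k).trans_lt ENNReal.coe_lt_top
    have h1 : MemLp (fun o : Obs (M k) (d k) => inner ℝ (w k a o.2.2) o.1 * S.rootOn k η o) 2
        (S.dominating.comap (ofType k)) := by
      rw [← S.memLp_law_comap_iff k η hT, ← memLp_typeLaw_iff (hp k) hT]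
      exact memLp_inner_outcome hY (hw k a) (hB k a)
    refine ⟨h1, Real.le_sqrt_of_sq_le ?_⟩
    rw [lpNorm_two_sq h1]
    simp only [mul_pow]
    rw [← S.integral_law_comap k η fun o => inner ℝ (w k a o.2.2) o.1 ^ 2,
      integral_comap_ofType _ (hp k)]
    refine (mul_le_of_le_one_left (integral_nonneg fun o => sq_nonneg _) (typeProb_le_one k)).trans
      (integral_inner_outcome_sq_le (hm k) (hw k a) (hB k a))
  · have hGm : Measurable fun o : Obs (M k) (d k) =>
        inner ℝ (w k a o.2.2) (outcomeReg P k a o.2.2) := hG.comp (by fun_prop)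
    rw [← S.memLp_law_comap_iff k _ hGm, S.law_eq_truth, ← memLp_typeLaw_iff (hPp k) hGm]
    exact memLp_inner_regression hg (hw k a) (hB k a)
  · filter_upwards [hS] with η ⟨hprob, hp, ho, hm⟩ h hh hhB
    rw [← S.integral_law_comap k η fun o =>
      (clipPropensity (typeLaw (S.law η) k) c a o.2.2 - treatedInd a o) * h o.2.2,
      integral_comap_ofType _ (hp k), integral_clipPropensity_sub_treatedInd_mul
        (ae_le_propensityOf_of_overlap ho k a) hh hhB, mul_zero]
  · intro h hh hhB
    rw [← S.integral_law_comap k S.truth fun o => treatedInd a o * (inner ℝ (w k a o.2.2) o.1 -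
      inner ℝ (w k a o.2.2) (outcomeReg P k a o.2.2)) * h o.2.2, S.law_eq_truth,
      integral_comap_ofType _ (hPp k)]
    have := integral_treatedInd_mul_sub_regressionOf (integrable_fst_typeLaw hPY)
      ((memLp_regression hg).integrable (by norm_num)) (hw k a) (hB k a) hh hhB
    exact mul_eq_zero_of_right _ this

end RegularSubmodel

/-! ### Decomposition, integrability and mean of the influence function -/

section Phi

variable {K : ℕ} {M d : Fin K → ℕ} {c : ℝ} {P : Measure (ClusterObs M d)} {w : Weights M d}

/-- Writing the residual term as a sum over `a` with indicators of `A = a` allows each treatment to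
be differentiated by itself. -/
theorem aipw_ae_eq [IsFiniteMeasure P] (ho : Overlap P c) (k : Fin K) :
    aipw P w k =ᵐ[P] fun z => ∑ a, onType k (aipwTerm P w k c a) z := by
  have h1 : ∀ᵐ o ∂P.comap (ofType k), aipw P w k (ofType k o) =
      ∑ a, onType (M := M) (d := d) k (aipwTerm P w k c a) (ofType k o) := by
    rw [← ae_typeLaw_iff]
    have : ∀ᵐ o ∂typeLaw P k, ∀ a : Treatment (M k),
        clipPropensity (typeLaw P k) c a o.2.2 = propensityOf (typeLaw P k) a o.2.2 :=
      ae_all_iff.2 fun a => clipPropensity_ae_eq (ae_le_propensityOf_of_overlap ho k a)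
    filter_upwards [this] with o hoc
    simp_rw [aipw, onType_ofType, aipwTerm]
    rw [Finset.sum_add_distrib]
    congr 1
    simp_rw [mul_div_assoc]
    rw [sum_treatedInd_mul (fun a => (inner ℝ (w k a o.2.2) o.1 -
      inner ℝ (w k a o.2.2) (outcomeReg P k a o.2.2)) / clipPropensity (typeLaw P k) c a o.2.2) o,
      hoc, inner_sub_right]
    rfl
  filter_upwards [(ae_comap_ofType_iff (p := fun z => aipw P w k z =
    ∑ a, onType (M := M) (d := d) k (aipwTerm P w k c a) z) P k).1 h1] with z hz
  by_cases h : z.1 = k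
  · exact hz h
  · simp [aipw, onType_of_ne _ h]

variable (P w) in
/-- The efficient influence function as a linear combination of elementary terms. -/
def phiExpansion (v : Fin K → ℝ → ℝ) (θ : Fin K → ℝ) (c : ℝ) (z : ClusterObs M d) : ℝ :=
  ∑ k, (v k (typeProb P k) * ((typeProb P k)⁻¹ * (∑ a, onType k (aipwTerm P w k c a) z) +
    -(θ k / typeProb P k) * onType k (fun _ => 1) z) +
    deriv (v k) (typeProb P k) * θ k * (onType k (fun _ => 1) z + -typeProb P k))

theorem phi_ae_eq [IsFiniteMeasure P] (ho : Overlap P c) (v : Fin K → ℝ → ℝ) (θ : Fin K → ℝ) :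
    phi P v w θ =ᵐ[P] phiExpansion P w v θ c := by
  filter_upwards [ae_all_iff.2 fun k => aipw_ae_eq (w := w) ho k] with z hz
  rw [phi, phiExpansion, ← Finset.sum_add_distrib]
  refine Finset.sum_congr rfl fun k _ => ?_
  rw [phiType, ← hz k, onType_one]
  by_cases h : z.1 = k
  · simp only [h, if_true]; ring
  · have : aipw P w k z = 0 := onType_of_ne _ h
    simp only [h, if_false, this]; ring

theorem memLp_onType_aipwTerm [IsFiniteMeasure P] (hc : 0 < c) (hp : ∀ k, 0 < typeProb P k)
    (hw : ∀ k a, Measurable (w k a)) {B : ℝ}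
    (hB : ∀ k a x, ‖w k a x‖ ≤ B) (hY : ∀ k, ∫⁻ o, ‖o.1‖ₑ ^ 2 ∂typeLaw P k < ∞)
    (hg : ∀ k a, MemLp (outcomeReg P k a) 2 (covLaw P k)) (k : Fin K) (a : Treatment (M k)) :
    MemLp (onType k (aipwTerm P w k c a)) 2 P := by
  rw [memLp_onType_iff _ _ (measurable_aipwTerm hw k a),
    ← memLp_typeLaw_iff (hp k) (measurable_aipwTerm hw k a)]
  exact memLp_aipwTerm hc hw hB (hY k) (hg k a)

theorem memLp_onType_one [IsFiniteMeasure P] (k : Fin K) :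
    MemLp (onType (M := M) (d := d) k fun _ => 1) 2 P := by
  refine MemLp.of_bound (measurable_onType k measurable_const).aestronglyMeasurable 1
    (ae_of_all _ fun z => ?_)
  rw [onType_one]; split_ifs <;> simp

theorem memLp_phiExpansion_summand [IsFiniteMeasure P] (hc : 0 < c)
    (hp : ∀ k, 0 < typeProb P k) (hw : ∀ k a, Measurable (w k a)) {B : ℝ}
    (hB : ∀ k a x, ‖w k a x‖ ≤ B) (hY : ∀ k, ∫⁻ o, ‖o.1‖ₑ ^ 2 ∂typeLaw P k < ∞)
    (hg : ∀ k a, MemLp (outcomeReg P k a) 2 (covLaw P k)) (v : Fin K → ℝ → ℝ) (θ : Fin K → ℝ)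
    (k : Fin K) :
    MemLp (fun z => v k (typeProb P k) *
      ((typeProb P k)⁻¹ * (∑ a, onType k (aipwTerm P w k c a) z) +
        -(θ k / typeProb P k) * onType k (fun _ => 1) z) +
      deriv (v k) (typeProb P k) * θ k * (onType k (fun _ => 1) z + -typeProb P k)) 2 P :=
  ((((memLp_finsetSum _ fun a _ => memLp_onType_aipwTerm hc hp hw hB hY hg k a).const_mul _).add
    ((memLp_onType_one k).const_mul _)).const_mul _).add
    (((memLp_onType_one k).add (memLp_const _)).const_mul _)

theorem memLp_phiExpansion [IsFiniteMeasure P] (hc : 0 < c)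
    (hp : ∀ k, 0 < typeProb P k) (hw : ∀ k a, Measurable (w k a)) {B : ℝ}
    (hB : ∀ k a x, ‖w k a x‖ ≤ B) (hY : ∀ k, ∫⁻ o, ‖o.1‖ₑ ^ 2 ∂typeLaw P k < ∞)
    (hg : ∀ k a, MemLp (outcomeReg P k a) 2 (covLaw P k)) (v : Fin K → ℝ → ℝ) (θ : Fin K → ℝ) :
    MemLp (phiExpansion P w v θ c) 2 P :=
  memLp_finsetSum _ fun k _ => memLp_phiExpansion_summand hc hp hw hB hY hg v θ k

theorem integral_onType_one (Q : Measure (ClusterObs M d)) (k : Fin K) :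
    ∫ z, onType k (fun _ => 1) z ∂Q = typeProb Q k := by
  rw [integral_onType, typeProb_eq_comap]; simp

/-- The residuals have mean zero, so the estimating function has mean `p_k θ_k` on type `k`, which
cancels against the centring by `θ_k`; the indicator of type `k` is centred by `p_k`. -/
theorem integral_phiExpansion [IsProbabilityMeasure P] (hc : 0 < c)
    (hp : ∀ k, 0 < typeProb P k) (hw : ∀ k a, Measurable (w k a)) {B : ℝ}
    (hB : ∀ k a x, ‖w k a x‖ ≤ B) (hY : ∀ k, ∫⁻ o, ‖o.1‖ₑ ^ 2 ∂typeLaw P k < ∞)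
    (hg : ∀ k a, MemLp (outcomeReg P k a) 2 (covLaw P k)) (v : Fin K → ℝ → ℝ) :
    ∫ z, phiExpansion P w v (fun k => thetaFunctional w k P) c z ∂P = 0 := by
  have hF : ∀ k a, Integrable (onType k (aipwTerm P w k c a)) P := fun k a =>
    (memLp_onType_aipwTerm hc hp hw hB hY hg k a).integrable (by norm_num)
  have h1 : ∀ k, Integrable (onType (M := M) (d := d) k fun _ => 1) P := fun k =>
    (memLp_onType_one k).integrable (by norm_num)
  simp only [phiExpansion]
  rw [integral_finsetSum _ fun k _ =>
    (memLp_phiExpansion_summand hc hp hw hB hY hg v (fun k => thetaFunctional w k P)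
      k).integrable (by norm_num)]
  refine Finset.sum_eq_zero fun k _ => ?_
  have hs : Integrable (fun z => ∑ a, onType k (aipwTerm P w k c a) z) P :=
    integrable_finsetSum _ fun a _ => hF k a
  have i1 : Integrable (fun z => (typeProb P k)⁻¹ * (∑ a, onType k (aipwTerm P w k c a) z) +
      -(thetaFunctional w k P / typeProb P k) * onType k (fun _ => 1) z) P :=
    (hs.const_mul _).add ((h1 k).const_mul _)
  have i2 : Integrable (fun z => onType k (fun _ => 1) z + -typeProb P k) P :=
    (h1 k).add (integrable_const _)
  rw [integral_add (i1.const_mul _) (i2.const_mul _),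
    integral_const_mul, integral_const_mul, integral_add (hs.const_mul _) ((h1 k).const_mul _),
    integral_const_mul, integral_const_mul, integral_add (h1 k) (integrable_const _),
    integral_finsetSum _ fun a _ => hF k a, integral_onType_one, integral_const]
  have hsum : ∑ a, ∫ z, onType k (aipwTerm P w k c a) z ∂P =
      typeProb P k * thetaFunctional w k P := by
    rw [thetaFunctional, Finset.mul_sum]
    refine Finset.sum_congr rfl fun a _ => ?_
    rw [integral_onType, integral_comap_ofType _ (hp k), integral_aipwTerm hc hw hB (hY k) (hg k a)]
  rw [hsum]
  have := (hp k).ne'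
  simp only [probReal_univ, one_smul, add_neg_cancel, mul_zero, add_zero]
  field_simp
  ring

end Phi

/-! ### The gradient of `τ` along a submodel -/

namespace RegularSubmodel

variable {K : ℕ} {M d : Fin K → ℕ} {P : Measure (ClusterObs M d)} {m : ℕ}
  (S : RegularSubmodel P m)

/-- As every type has positive probability, `p_k = 1` excludes a second type, so the event `L = k`
is the whole space under every law. -/
theorem _root_.typeProb_eq_one_of_eq_one {P Q : Measure (ClusterObs M d)} [IsProbabilityMeasure P]
    [IsProbabilityMeasure Q] (hp : ∀ k, 0 < typeProb P k) {k : Fin K} (h : typeProb P k = 1) :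
    typeProb Q k = 1 := by
  have huniv : {z : ClusterObs M d | z.1 = k} = Set.univ := by
    refine Set.eq_univ_of_forall fun z => ?_
    by_contra hz
    have hd : Disjoint {y : ClusterObs M d | y.1 = k} {y | y.1 = z.1} := by
      rw [Set.disjoint_left]
      intro y hy hy'
      exact hz (hy'.symm.trans hy)
    have h1 := measureReal_union (μ := P) hd (measurableSet_type z.1)
    have h2 : P.real ({y : ClusterObs M d | y.1 = k} ∪ {y | y.1 = z.1}) ≤ 1 := measureReal_le_one
    have h3 := hp z.1
    simp only [typeProb] at h h3
    linarith
  rw [typeProb, huniv, probReal_univ]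

theorem hasFDerivAt_comp_typeProb {c : ℝ} {C : ℝ≥0}
    (hS : ∀ᶠ η in 𝓝 S.truth, S.law η ∈ npModel M d c C) (k : Fin K) {f : ℝ → ℝ}
    (hf : ContDiffOn ℝ 1 f (Set.Ioo 0 1)) :
    HasFDerivAt (fun η => f (typeProb (S.law η) k))
      (deriv f (typeProb P k) •
        S.scoreDual (fun z => onType k (fun _ => 1) z + -typeProb P k)) S.truth := by
  have hP := hS.self_of_nhds
  rw [S.law_eq_truth] at hP
  obtain ⟨hPprob, hPp, -, -⟩ := hP
  rw [S.scoreDual_add (memLp_onType_one k) (memLp_const _), S.scoreDual_const, add_zero]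
  rcases (typeProb_le_one (Q := P) k).lt_or_eq with h | h
  · have h1 : HasDerivAt f (deriv f (typeProb P k)) (typeProb (S.law S.truth) k) := by
      rw [S.law_eq_truth]
      exact ((hf.contDiffAt (Ioo_mem_nhds (hPp k) h)).differentiableAt (by norm_num)).hasDerivAt
    exact h1.comp_hasFDerivAt S.truth (S.hasFDerivAt_typeProb k)
  -- At `p_k = 1` nothing is known about differentiability of `f`. But `p_k` is constant along the
  -- submodel, so the pairing with the score vanishes whatever value `deriv f 1` takes.
  · have h1 : S.scoreDual (onType k fun _ => 1) = 0 := by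
      refine (S.hasFDerivAt_typeProb k).unique ((hasFDerivAt_const (1 : ℝ) _).congr_of_eventuallyEq
        ?_)
      filter_upwards [hS] with η ⟨hprob, _⟩
      exact typeProb_eq_one_of_eq_one hPp h
    rw [h1, smul_zero]
    refine (hasFDerivAt_const (f 1) _).congr_of_eventuallyEq ?_
    filter_upwards [hS] with η ⟨hprob, _⟩
    rw [typeProb_eq_one_of_eq_one hPp h]

/-- The product rule for `θ_k = p_k⁻¹ · (p_k θ_k)`; the derivative of `p_k⁻¹` produces the centring
by `θ_k`. -/
theorem hasFDerivAt_thetaFunctional {c : ℝ} {C : ℝ≥0} (hc : 0 < c)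
    (hS : ∀ᶠ η in 𝓝 S.truth, S.law η ∈ npModel M d c C)
    (hg : ∀ k a, MemLp (outcomeReg P k a) 2 (covLaw P k))
    {w : Weights M d} (hw : ∀ k a, Measurable (w k a)) {B : ℝ} (hB : ∀ k a x, ‖w k a x‖ ≤ B)
    (k : Fin K) :
    HasFDerivAt (fun η => thetaFunctional w k (S.law η))
      ((typeProb P k)⁻¹ • (∑ a, S.scoreDual (onType k (aipwTerm P w k c a))) +
        -(thetaFunctional w k P / typeProb P k) • S.scoreDual (onType k fun _ => 1)) S.truth := by
  have hP := hS.self_of_nhds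
  rw [S.law_eq_truth] at hP
  obtain ⟨hPprob, hPp, -, -⟩ := hP
  have h1 : HasFDerivAt (fun η => typeProb (S.law η) k * thetaFunctional w k (S.law η))
      (∑ a, S.scoreDual (onType k (aipwTerm P w k c a))) S.truth := by
    have := HasFDerivAt.fun_sum (u := Finset.univ) fun a _ =>
      S.hasFDerivAt_typeProb_mul_integral hc hS k a (hg k a) hw hB
    simpa only [thetaFunctional, Finset.mul_sum] using this
  have hne : typeProb (S.law S.truth) k ≠ 0 := by rw [S.law_eq_truth]; exact (hPp k).ne'
  have h2 := (hasDerivAt_inv hne).comp_hasFDerivAt S.truth (S.hasFDerivAt_typeProb k)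
  refine ((h2.mul h1).congr_of_eventuallyEq ?_).congr_fderiv ?_
  · filter_upwards [hS] with η ⟨_, hp, _⟩
    simp only [Pi.mul_apply, Function.comp_apply]
    rw [inv_mul_cancel_left₀ (hp k).ne']
  · ext u
    simp only [Function.comp_apply, add_apply, smul_apply, smul_eq_mul, S.law_eq_truth]
    have := (hPp k).ne'
    field_simp

theorem scoreDual_phiExpansion [IsFiniteMeasure P] {c : ℝ} (hc : 0 < c)
    (hp : ∀ k, 0 < typeProb P k) {w : Weights M d} (hw : ∀ k a, Measurable (w k a)) {B : ℝ}
    (hB : ∀ k a x, ‖w k a x‖ ≤ B) (hY : ∀ k, ∫⁻ o, ‖o.1‖ₑ ^ 2 ∂typeLaw P k < ∞)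
    (hg : ∀ k a, MemLp (outcomeReg P k a) 2 (covLaw P k)) (v : Fin K → ℝ → ℝ) (θ : Fin K → ℝ) :
    S.scoreDual (phiExpansion P w v θ c) = ∑ k, (v k (typeProb P k) •
      ((typeProb P k)⁻¹ • (∑ a, S.scoreDual (onType k (aipwTerm P w k c a))) +
        -(θ k / typeProb P k) • S.scoreDual (onType k fun _ => 1)) +
      (deriv (v k) (typeProb P k) * θ k) •
        S.scoreDual (fun z => onType k (fun _ => 1) z + -typeProb P k)) := by
  have hF := memLp_onType_aipwTerm hc hp hw hB hY hg
  have h1 := memLp_onType_one (P := P)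
  unfold phiExpansion
  rw [S.scoreDual_sum _ fun k _ => memLp_phiExpansion_summand hc hp hw hB hY hg v θ k]
  refine Finset.sum_congr rfl fun k _ => ?_
  have hs : MemLp (fun z => ∑ a, onType k (aipwTerm P w k c a) z) 2 P :=
    memLp_finsetSum _ fun a _ => hF k a
  have i1 : MemLp (fun z => (typeProb P k)⁻¹ * (∑ a, onType k (aipwTerm P w k c a) z) +
      -(θ k / typeProb P k) * onType k (fun _ => 1) z) 2 P :=
    (hs.const_mul _).add ((h1 k).const_mul _)
  have i2 : MemLp (fun z => onType k (fun _ => 1) z + -typeProb P k) 2 P :=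
    (h1 k).add (memLp_const _)
  rw [S.scoreDual_add (i1.const_mul _) (i2.const_mul _),
    S.scoreDual_const_mul, S.scoreDual_const_mul,
    S.scoreDual_add (hs.const_mul _) ((h1 k).const_mul _), S.scoreDual_const_mul,
    S.scoreDual_const_mul, S.scoreDual_sum _ fun a _ => hF k a]

theorem hasGradientAt_tauFunctional (hS : S ∈ npSubmodels P m)
    (hg : ∀ k a, MemLp (outcomeReg P k a) 2 (covLaw P k))
    {w : Weights M d} (hw : ∀ k a, Measurable (w k a)) {B : ℝ} (hB : ∀ k a x, ‖w k a x‖ ≤ B)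
    {v : Fin K → ℝ → ℝ} (hv : ∀ k, ContDiffOn ℝ 1 (v k) (Set.Ioo 0 1)) :
    HasGradientAt (fun η => tauFunctional v w (S.law η))
      (WithLp.toLp 2 fun j => ∫ z, phi P v w (fun k => thetaFunctional w k P) z * S.score j z ∂P)
      S.truth := by
  obtain ⟨c, hc, C, hS⟩ := hS
  have hP := hS.self_of_nhds
  rw [S.law_eq_truth] at hP
  obtain ⟨hPprob, hPp, hPo, hPm⟩ := hP
  have hY : ∀ k, ∫⁻ o, ‖o.1‖ₑ ^ 2 ∂typeLaw P k < ∞ := fun k =>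
    (hPm k).trans_lt ENNReal.coe_lt_top
  rw [hasGradientAt_iff_hasFDerivAt]
  change HasFDerivAt _ (S.scoreDual _) _
  rw [S.scoreDual_congr (phi_ae_eq hPo v _), S.scoreDual_phiExpansion hc hPp hw hB hY hg]
  refine HasFDerivAt.fun_sum fun k _ => ?_
  -- The product rule for `v_k(p_k) θ_k` produces the two sums in `phi`.
  have h := (S.hasFDerivAt_comp_typeProb hS k (hv k)).mul
    (S.hasFDerivAt_thetaFunctional hc hS hg hw hB k)
  refine h.congr_fderiv ?_
  rw [S.law_eq_truth, smul_smul, mul_comm (thetaFunctional w k P)]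

end RegularSubmodel

/-! ### Circular submodels and density of their scores -/

section Submodels

variable {Z : Type*} [MeasurableSpace Z] {P : Measure Z}

theorem withDensity_ofReal_sq_toLp [IsFiniteMeasure P] {f : Z → ℝ} (hf : MemLp f 2 P) :
    P.withDensity (fun z => ENNReal.ofReal (hf.toLp f z ^ 2)) =
      P.withDensity (fun z => ENNReal.ofReal (f z ^ 2)) := by
  refine withDensity_congr_ae ?_
  filter_upwards [hf.coeFn_toLp] with z hz
  rw [hz]

theorem withDensity_ofReal_sq_one [IsFiniteMeasure P] :
    P.withDensity (fun z => ENNReal.ofReal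
      ((memLp_const (1 : ℝ) : MemLp (fun _ : Z => (1 : ℝ)) 2 P).toLp _ z ^ 2)) = P := by
  rw [withDensity_ofReal_sq_toLp]
  simp

theorem norm_toLp_one [IsProbabilityMeasure P] :
    ‖(memLp_const (1 : ℝ) : MemLp (fun _ : Z => (1 : ℝ)) 2 P).toLp _‖ = 1 := by
  rw [Lp.norm_toLp, eLpNorm_const _ (by norm_num) (IsProbabilityMeasure.ne_zero P)]
  simp

theorem toLp_one_nonneg [IsProbabilityMeasure P] :
    0 ≤ (memLp_const (1 : ℝ) : MemLp (fun _ : Z => (1 : ℝ)) 2 P).toLp _ := by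
  rw [← Lp.coeFn_nonneg]
  filter_upwards [(memLp_const (1 : ℝ) : MemLp (fun _ : Z => (1 : ℝ)) 2 P).coeFn_toLp] with z hz
  rw [hz]; simp

variable (P) in
/-- The submodel without parameters. -/
def pointSubmodel [IsProbabilityMeasure P] : RegularSubmodel P 0 where
  dominating := P
  sigmaFinite := inferInstance
  U := Set.univ
  isOpen_U := isOpen_univ
  truth := 0
  truth_mem := Set.mem_univ _
  root := fun _ => (memLp_const (1 : ℝ)).toLp fun _ => 1
  root_nonneg := fun _ _ => toLp_one_nonneg
  norm_root := fun _ _ => norm_toLp_one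
  contDiffOn_root := contDiffOn_const
  law_truth := withDensity_ofReal_sq_one
  information_nonsingular := by simp

theorem law_pointSubmodel [IsProbabilityMeasure P] (η : EuclideanSpace ℝ (Fin 0)) :
    (pointSubmodel P).law η = P :=
  withDensity_ofReal_sq_one (P := P)

/-- A path on the unit sphere of `L²(P)` in the direction of `h`. -/
def circleRoot [IsProbabilityMeasure P] {h : Z → ℝ} (h2 : MemLp h 2 P)
    (η : EuclideanSpace ℝ (Fin 1)) : Lp ℝ 2 P :=
  Real.cos (η 0) • (memLp_const (1 : ℝ)).toLp (fun _ => 1) + Real.sin (η 0) • h2.toLp h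

theorem coeFn_circleRoot [IsProbabilityMeasure P] {h : Z → ℝ} (h2 : MemLp h 2 P)
    (η : EuclideanSpace ℝ (Fin 1)) :
    circleRoot h2 η =ᵐ[P] fun z => Real.cos (η 0) + Real.sin (η 0) * h z := by
  filter_upwards [Lp.coeFn_add (Real.cos (η 0) •
      (memLp_const (1 : ℝ) : MemLp (fun _ : Z => (1 : ℝ)) 2 P).toLp (fun _ => 1))
      (Real.sin (η 0) • h2.toLp h), Lp.coeFn_smul (Real.cos (η 0))
      ((memLp_const (1 : ℝ) : MemLp (fun _ : Z => (1 : ℝ)) 2 P).toLp (fun _ => 1)),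
    Lp.coeFn_smul (Real.sin (η 0)) (h2.toLp h), h2.coeFn_toLp,
    (memLp_const (1 : ℝ) : MemLp (fun _ : Z => (1 : ℝ)) 2 P).coeFn_toLp] with z h1 h3 h4 h5 h6
  rw [circleRoot, h1, Pi.add_apply, h3, h4, Pi.smul_apply, Pi.smul_apply, h5, h6]
  simp

theorem contDiff_circleRoot [IsProbabilityMeasure P] {h : Z → ℝ} (h2 : MemLp h 2 P) :
    ContDiff ℝ 1 (circleRoot h2) := by
  have hp : ContDiff ℝ 1 fun η : EuclideanSpace ℝ (Fin 1) => η 0 :=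
    (EuclideanSpace.proj 0 : EuclideanSpace ℝ (Fin 1) →L[ℝ] ℝ).contDiff
  exact (hp.cos.smul contDiff_const).add (hp.sin.smul contDiff_const)

theorem fderiv_circleRoot [IsProbabilityMeasure P] {h : Z → ℝ} (h2 : MemLp h 2 P) :
    fderiv ℝ (circleRoot h2) 0 (EuclideanSpace.single 0 1) = h2.toLp h := by
  have hp : HasFDerivAt (fun η : EuclideanSpace ℝ (Fin 1) => η 0)
      (EuclideanSpace.proj 0 : EuclideanSpace ℝ (Fin 1) →L[ℝ] ℝ) 0 :=
    (EuclideanSpace.proj 0 : EuclideanSpace ℝ (Fin 1) →L[ℝ] ℝ).hasFDerivAt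
  have h1 := (hp.cos.smul_const ((memLp_const (1 : ℝ) :
    MemLp (fun _ : Z => (1 : ℝ)) 2 P).toLp (fun _ => 1))).add (hp.sin.smul_const (h2.toLp h))
  have h3 : HasFDerivAt (circleRoot h2) _ 0 := h1
  rw [h3.fderiv]
  simp

theorem circleRoot_zero [IsProbabilityMeasure P] {h : Z → ℝ} (h2 : MemLp h 2 P) :
    circleRoot h2 0 = (memLp_const (1 : ℝ)).toLp (fun _ => 1) := by
  simp [circleRoot]

theorem score_circleRoot [IsProbabilityMeasure P] {h : Z → ℝ} (h2 : MemLp h 2 P) :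
    (fun z => 2 * (fderiv ℝ (circleRoot h2) 0 (EuclideanSpace.single 0 1)) z / circleRoot h2 0 z)
      =ᵐ[P] fun z => 2 * h z := by
  filter_upwards [h2.coeFn_toLp,
    (memLp_const (1 : ℝ) : MemLp (fun _ : Z => (1 : ℝ)) 2 P).coeFn_toLp] with z h1 h3
  rw [fderiv_circleRoot, circleRoot_zero, h1, h3, div_one]

/-- The one-dimensional submodel with score `2 h` at the truth. -/
def circleSubmodel [IsProbabilityMeasure P] {h : Z → ℝ} (h2 : MemLp h 2 P) {B : ℝ}
    (hB : ∀ z, |h z| ≤ B) (hmean : ∫ z, h z ∂P = 0) (hvar : ∫ z, h z ^ 2 ∂P = 1) :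
    RegularSubmodel P 1 where
  dominating := P
  sigmaFinite := inferInstance
  -- On this set the root is at least `1 / 2`: it is nonnegative, and the law dominates `P / 4`.
  U := {η | 1 / 2 < Real.cos (η 0) - B * |Real.sin (η 0)|}
  isOpen_U := isOpen_lt continuous_const (by fun_prop)
  truth := 0
  truth_mem := by simp; norm_num
  root := circleRoot h2
  root_nonneg := by
    intro η hη
    rw [← Lp.coeFn_nonneg]
    filter_upwards [coeFn_circleRoot h2 η] with z hz
    rw [hz]
    have h1 : |Real.sin (η 0) * h z| ≤ B * |Real.sin (η 0)| := by
      rw [abs_mul, mul_comm]; exact mul_le_mul_of_nonneg_right (hB z) (abs_nonneg _)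
    have h3 := neg_abs_le (Real.sin (η 0) * h z)
    have h4 : 1 / 2 < Real.cos (η 0) - B * |Real.sin (η 0)| := hη
    simp only [Pi.zero_apply]
    linarith
  norm_root := by
    intro η _
    have hh : ‖h2.toLp h‖ = 1 := by
      have := lpNorm_two_sq h2
      rw [Lp.norm_toLp, toReal_eLpNorm h2.1]
      rw [hvar] at this
      exact (pow_eq_one_iff_of_nonneg lpNorm_nonneg two_ne_zero).1 this
    -- Mean zero and unit variance make `1` and `h` orthonormal, so the root moves on a unit circle.
    have horth : inner ℝ ((memLp_const (1 : ℝ) : MemLp (fun _ : Z => (1 : ℝ)) 2 P).toLp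
        (fun _ => 1)) (h2.toLp h) = 0 := by
      rw [L2.inner_def, ← hmean]
      refine integral_congr_ae ?_
      filter_upwards [h2.coeFn_toLp,
        (memLp_const (1 : ℝ) : MemLp (fun _ : Z => (1 : ℝ)) 2 P).coeFn_toLp] with z h1 h3
      rw [h1, h3]; simp
    have h1 : ‖circleRoot h2 η‖ ^ 2 = 1 := by
      rw [circleRoot, norm_add_sq_real, inner_smul_left, inner_smul_right, horth, norm_smul,
        norm_smul, norm_toLp_one, hh]
      simp only [mul_one, mul_zero, add_zero, Real.norm_eq_abs, sq_abs, Real.cos_sq_add_sin_sq]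
    exact (pow_eq_one_iff_of_nonneg (norm_nonneg _) two_ne_zero).1 h1
  contDiffOn_root := (contDiff_circleRoot h2).contDiffOn
  law_truth := by
    rw [circleRoot_zero]; exact withDensity_ofReal_sq_one
  information_nonsingular := by
    rw [Matrix.det_unique]
    have h1 : ∫ z, (2 * (fderiv ℝ (circleRoot h2) 0 (EuclideanSpace.single 0 1)) z /
        circleRoot h2 0 z) * (2 * (fderiv ℝ (circleRoot h2) 0 (EuclideanSpace.single 0 1)) z /
        circleRoot h2 0 z) ∂P = 4 := by
      have h3 : ∫ z, 4 * h z ^ 2 ∂P = 4 := by rw [integral_const_mul, hvar, mul_one]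
      rw [← h3]
      refine integral_congr_ae ?_
      filter_upwards [score_circleRoot h2] with z hz
      rw [hz]; ring
    simp only [Matrix.of_apply]
    have h3 : (default : Fin 1) = 0 := rfl
    rw [h3, h1]
    exact isUnit_iff_ne_zero.2 (by norm_num)

section

variable [IsProbabilityMeasure P] {h : Z → ℝ} (h2 : MemLp h 2 P) {B : ℝ}
  (hB : ∀ z, |h z| ≤ B) (hmean : ∫ z, h z ∂P = 0) (hvar : ∫ z, h z ^ 2 ∂P = 1)

theorem score_circleSubmodel :
    (circleSubmodel h2 hB hmean hvar).score 0 =ᵐ[P] fun z => 2 * h z :=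
  score_circleRoot h2

/-- The root lies between `1 / 2` and `1 + B`. That these bounds do not depend on `η` gives model
constants uniform near the truth. -/
theorem law_circleSubmodel_bounds {η : EuclideanSpace ℝ (Fin 1)}
    (hη : η ∈ (circleSubmodel h2 hB hmean hvar).U) :
    IsProbabilityMeasure ((circleSubmodel h2 hB hmean hvar).law η) ∧
    ENNReal.ofReal (1 / 4) • P ≤ (circleSubmodel h2 hB hmean hvar).law η ∧
      (circleSubmodel h2 hB hmean hvar).law η ≤ ENNReal.ofReal ((1 + B) ^ 2) • P := by
  have hη' : 1 / 2 < Real.cos (η 0) - B * |Real.sin (η 0)| := hη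
  have hlaw : (circleSubmodel h2 hB hmean hvar).law η =
      P.withDensity (fun z => ENNReal.ofReal (circleRoot h2 η z ^ 2)) := rfl
  have hbd : ∀ᵐ z ∂P, 1 / 2 ≤ circleRoot h2 η z ∧ circleRoot h2 η z ≤ 1 + B := by
    filter_upwards [coeFn_circleRoot h2 η] with z hz
    rw [hz]
    have h1 : |Real.sin (η 0) * h z| ≤ B * |Real.sin (η 0)| := by
      rw [abs_mul, mul_comm]; exact mul_le_mul_of_nonneg_right (hB z) (abs_nonneg _)
    have h3 := neg_abs_le (Real.sin (η 0) * h z)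
    have h4 := le_abs_self (Real.sin (η 0) * h z)
    have h5 : B * |Real.sin (η 0)| ≤ B * 1 := mul_le_mul_of_nonneg_left (Real.abs_sin_le_one _)
      ((abs_nonneg _).trans (hB z))
    have h6 := Real.cos_le_one (η 0)
    constructor <;> linarith
  refine ⟨⟨?_⟩, ?_, ?_⟩
  · have h1 := (circleSubmodel h2 hB hmean hvar).norm_root η hη
    change ‖circleRoot h2 η‖ = 1 at h1
    have h3 : ∫ z, circleRoot h2 η z ^ 2 ∂P = 1 := by
      rw [← lpNorm_two_sq (Lp.memLp _), ← norm_eq_lpNorm_two, h1, one_pow]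
    rw [hlaw, withDensity_apply _ MeasurableSet.univ, setLIntegral_univ,
      ← ofReal_integral_eq_lintegral_ofReal (Lp.memLp (circleRoot h2 η)).integrable_sq
      (ae_of_all _ fun _ => sq_nonneg _), h3, ENNReal.ofReal_one]
  · rw [hlaw, ← withDensity_const]
    refine withDensity_mono ?_
    filter_upwards [hbd] with z hz
    exact ENNReal.ofReal_le_ofReal (by nlinarith [hz.1])
  · rw [hlaw, ← withDensity_const]
    refine withDensity_mono ?_
    filter_upwards [hbd] with z hz
    exact ENNReal.ofReal_le_ofReal (pow_le_pow_left₀ (by linarith [hz.1]) hz.2 2)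

end

/-- A function of mean zero is approximated by bounded functions of mean zero. -/
theorem exists_bounded_mean_zero [IsProbabilityMeasure P] {t : Z → ℝ} (ht : MemLp t 2 P)
    (hmean : ∫ z, t z ∂P = 0) {ε : ℝ} (hε : 0 < ε) :
    ∃ h : Z → ℝ, Measurable h ∧ (∃ B, ∀ z, |h z| ≤ B) ∧ ∫ z, h z ∂P = 0 ∧
      lpNorm (fun z => t z - h z) 2 P ≤ ε := by
  have key : ∀ t : Z → ℝ, Measurable t → MemLp t 2 P → ∫ z, t z ∂P = 0 →
      ∃ h : Z → ℝ, Measurable h ∧ (∃ B, ∀ z, |h z| ≤ B) ∧ ∫ z, h z ∂P = 0 ∧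
      lpNorm (fun z => t z - h z) 2 P ≤ ε := by
    intro t htm ht hmean
    obtain ⟨n, hn⟩ := ((tendsto_lpNorm_tailInd_mul htm ht).eventually
      (gt_mem_nhds (half_pos hε))).exists
    have hcm : Measurable fun z => truncAt n (t z) := (measurable_truncAt n).comp htm
    have hcb : ∀ z, |truncAt n (t z)| ≤ n := fun z => abs_truncAt_le (Nat.cast_nonneg n) _
    have hci : Integrable (fun z => truncAt n (t z)) P :=
      Integrable.of_bound hcm.aestronglyMeasurable n (ae_of_all _ hcb)
    have hd : MemLp (fun z => tailInd n (t z) * t z) 2 P :=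
      ht.bdd_mul_two ((measurable_tailInd n).comp htm).aestronglyMeasurable
        fun z => abs_tailInd_le _ _
    set μ₀ := ∫ z, truncAt n (t z) ∂P with hμ₀
    refine ⟨fun z => truncAt n (t z) - μ₀, hcm.sub_const _, ⟨n + |μ₀|, fun z =>
      (abs_sub _ _).trans (add_le_add (hcb z) le_rfl)⟩, ?_, ?_⟩
    · rw [integral_sub hci (integrable_const _)]; simp [hμ₀]
    · have h1 : (fun z => t z - (truncAt n (t z) - μ₀)) =
          fun z => tailInd n (t z) * t z + μ₀ := by
        ext z; rw [truncAt_eq]; ring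
      -- As `t` has mean zero, the mean of its truncation is minus the mean of its tail, so
      -- recentring costs no more than truncating.
      have h3 : |μ₀| ≤ ε / 2 := by
        have h4 : μ₀ = -∫ z, 1 * (tailInd n (t z) * t z) ∂P := by
          have h5 : μ₀ = ∫ z, (t z - 1 * (tailInd n (t z) * t z)) ∂P := by
            rw [hμ₀]; refine integral_congr_ae (ae_of_all _ fun z => ?_)
            simp only [truncAt_eq]; ring
          rw [h5, integral_sub (ht.integrable (by norm_num))
            ((hd.integrable (by norm_num)).const_mul 1), hmean, zero_sub]
        rw [h4, abs_neg]
        refine (abs_integral_mul_le_lpNorm_two (memLp_const 1) hd).trans ?_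
        rw [lpNorm_const' (by norm_num) (by norm_num)]
        simpa using hn.le
      rw [h1]
      refine (lpNorm_two_add_le hd).trans ?_
      rw [lpNorm_const' (by norm_num) (by norm_num)]
      simp only [Real.norm_eq_abs, probReal_univ, Real.one_rpow, mul_one]
      linarith
  obtain ⟨h, h1, h2, h3, h4⟩ := key (ht.1.aemeasurable.mk t) ht.1.aemeasurable.measurable_mk
    (ht.ae_eq ht.1.aemeasurable.ae_eq_mk)
    (by rw [← hmean]; exact integral_congr_ae ht.1.aemeasurable.ae_eq_mk.symm)
  refine ⟨h, h1, h2, h3, le_trans (le_of_eq (lpNorm_two_congr ?_)) h4⟩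
  filter_upwards [ht.1.aemeasurable.ae_eq_mk] with z hz
  rw [hz]

/-- If a class of submodels contains the trivial submodel and the one-dimensional submodels with
bounded scores, then every square integrable function of mean zero is in the tangent space. -/
theorem mem_tangentSpace_of_integral_eq_zero [IsProbabilityMeasure P]
    {𝒮 : ∀ m : ℕ, Set (RegularSubmodel P m)} (h0 : pointSubmodel P ∈ 𝒮 0)
    (h1 : ∀ (h : Z → ℝ) (h2 : MemLp h 2 P) (B : ℝ) (hB : ∀ z, |h z| ≤ B)
      (hmean : ∫ z, h z ∂P = 0) (hvar : ∫ z, h z ^ 2 ∂P = 1),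
      circleSubmodel h2 hB hmean hvar ∈ 𝒮 1)
    {t : Z → ℝ} (ht : MemLp t 2 P) (hmean : ∫ z, t z ∂P = 0) : t ∈ tangentSpace 𝒮 := by
  refine ⟨ht, fun ε hε => ?_⟩
  obtain ⟨h, hm, ⟨B, hB⟩, hh, hth⟩ := exists_bounded_mean_zero ht hmean hε
  have hh2 : MemLp h 2 P := MemLp.of_bound hm.aestronglyMeasurable B (ae_of_all _ hB)
  have hth' : eLpNorm (fun z => t z - h z) 2 P ≤ ENNReal.ofReal ε := by
    rw [← ofReal_lpNorm (f := fun z => t z - h z) (ht.sub hh2)]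
    exact ENNReal.ofReal_le_ofReal hth
  by_cases hv : ∫ z, h z ^ 2 ∂P = 0
  -- Here `h` vanishes almost surely and cannot be normalised; the empty combination of scores of
  -- the point submodel takes its place.
  · refine ⟨0, _, h0, fun _ => 0, ?_⟩
    rw [integral_eq_zero_iff_of_nonneg (fun z => sq_nonneg _) hh2.integrable_sq] at hv
    refine le_trans (le_of_eq (eLpNorm_congr_ae ?_)) hth'
    filter_upwards [hv] with z hz
    have : h z = 0 := by simpa using hz
    simp [this]
  · have hpos : 0 < ∫ z, h z ^ 2 ∂P :=
      lt_of_le_of_ne (integral_nonneg fun z => sq_nonneg _) (Ne.symm hv)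
    set σ := Real.sqrt (∫ z, h z ^ 2 ∂P) with hσ
    have hσ0 : 0 < σ := Real.sqrt_pos.2 hpos
    have g2 : MemLp (fun z => σ⁻¹ * h z) 2 P := hh2.const_mul _
    have gB : ∀ z, |σ⁻¹ * h z| ≤ σ⁻¹ * B := fun z => by
      rw [abs_mul, abs_of_pos (inv_pos.2 hσ0)]
      exact mul_le_mul_of_nonneg_left (hB z) (inv_pos.2 hσ0).le
    have gm : ∫ z, σ⁻¹ * h z ∂P = 0 := by rw [integral_const_mul, hh, mul_zero]
    have gv : ∫ z, (σ⁻¹ * h z) ^ 2 ∂P = 1 := by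
      simp_rw [mul_pow]
      rw [integral_const_mul, inv_pow, Real.sq_sqrt hpos.le, inv_mul_cancel₀ hv]
    -- The score at the truth is `2 h / σ`, so the coefficient `σ / 2` returns `h`.
    refine ⟨1, _, h1 _ g2 _ gB gm gv, fun _ => σ / 2, ?_⟩
    refine le_trans (le_of_eq (eLpNorm_congr_ae ?_)) hth'
    filter_upwards [score_circleSubmodel g2 gB gm gv] with z hz
    simp only [Finset.univ_unique, Fin.default_eq_zero, Fin.isValue, Finset.sum_singleton, hz]
    field_simp

end Submodels

/-! ### Laws comparable to the truth stay in the model -/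

/-- Overlap is inherited by laws with a density bounded above and below. -/
theorem ae_le_condDistrib_of_comparable {m d : ℕ} {ρ σ : Measure (Obs m d)} [IsFiniteMeasure ρ]
    [IsFiniteMeasure σ] {S : Set (Treatment m)} {a b c : ℝ} {r : ℝ≥0∞} (ha : 0 < a) (hb : 0 < b)
    (hc : 0 < c) (hl : (r * ENNReal.ofReal a) • ρ ≤ σ) (hu : σ ≤ (r * ENNReal.ofReal b) • ρ)
    (h : ∀ᵐ x ∂ρ.map (fun o => o.2.2),
      c ≤ (condDistrib (fun o : Obs m d => o.2.1) (fun o => o.2.2) ρ x).real S) :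
    ∀ᵐ x ∂σ.map (fun o => o.2.2),
      c * a / b ≤ (condDistrib (fun o : Obs m d => o.2.1) (fun o => o.2.2) σ x).real S := by
  rw [ae_le_condDistrib_iff] at h ⊢
  intro B hB
  have hcab : ENNReal.ofReal (c * a / b) * ENNReal.ofReal b =
      ENNReal.ofReal a * ENNReal.ofReal c := by
    rw [← ENNReal.ofReal_mul (by positivity), ← ENNReal.ofReal_mul ha.le,
      div_mul_cancel₀ _ hb.ne', mul_comm]
  -- The factor `r` occurs in both comparisons, so the resulting constant does not depend on it.
  calc _ ≤ ENNReal.ofReal (c * a / b) * (r * ENNReal.ofReal b * ρ {o | o.2.2 ∈ B}) := by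
        gcongr; exact hu _
    _ = r * (ENNReal.ofReal (c * a / b) * ENNReal.ofReal b) * ρ {o | o.2.2 ∈ B} := by ring
    _ = r * ENNReal.ofReal a * (ENNReal.ofReal c * ρ {o | o.2.2 ∈ B}) := by rw [hcab]; ring
    _ ≤ r * ENNReal.ofReal a * ρ {o | o.2.2 ∈ B ∧ o.2.1 ∈ S} := by gcongr; exact h B hB
    _ ≤ _ := hl _

section Model

variable {K : ℕ} {M d : Fin K → ℕ} {P Q : Measure (ClusterObs M d)} [IsProbabilityMeasure P]
  [IsProbabilityMeasure Q]

/-- An upper bound on the propensity is a lower bound for the complementary event, so that only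
lower bounds have to be transferred. -/
theorem overlap_iff {c : ℝ} (hp : ∀ k, 0 < typeProb P k) : Overlap P c ↔
    ∀ k, ∀ a : Treatment (M k), ∀ᵐ x ∂covLaw P k, c < propensity P k a x ∧
      c < (condDistrib (fun o : Obs (M k) (d k) => o.2.1) (fun o => o.2.2)
        (typeLaw P k) x).real {a}ᶜ := by
  refine forall_congr' fun k => forall_congr' fun a => ?_
  have := isProbabilityMeasure_typeLaw P (hp k)
  refine Filter.eventually_congr (ae_of_all _ fun x => ?_)
  rw [propensity, probReal_compl_eq_one_sub (measurableSet_singleton a)]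
  constructor <;> rintro ⟨h1, h2⟩ <;> constructor <;> linarith

/-- `P` and `Q` are comparable: `a P ≤ Q ≤ b P`. -/
structure Comparable (P Q : Measure (ClusterObs M d)) (a b : ℝ) : Prop where
  pos_left : 0 < a
  pos_right : 0 < b
  le_right : ENNReal.ofReal a • P ≤ Q
  le_left : Q ≤ ENNReal.ofReal b • P

namespace Comparable

variable {a b : ℝ}

omit [IsProbabilityMeasure P] in
theorem typeProb_pos (h : Comparable P Q a b) {k : Fin K} (hp : 0 < typeProb P k) :
    0 < typeProb Q k := by
  have h' := h.le_right {z | z.1 = k}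
  rw [typeProb, measureReal_def, ENNReal.toReal_pos_iff] at hp ⊢
  refine ⟨lt_of_lt_of_le ?_ h', measure_lt_top _ _⟩
  exact ENNReal.mul_pos (by simpa using h.pos_left) hp.1.ne'

omit [IsProbabilityMeasure P] in
-- Conditioning normalises the two laws differently; the ratio `P(L = k) / Q(L = k)` is the `r` that
-- corrects for this, and it is at most `1 / a`.
theorem typeLaw_bounds (h : Comparable P Q a b) {k : Fin K} (hp : 0 < typeProb P k) :
    ∃ r : ℝ≥0∞, r ≤ (ENNReal.ofReal a)⁻¹ ∧
      (r * ENNReal.ofReal a) • typeLaw P k ≤ typeLaw Q k ∧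
      typeLaw Q k ≤ (r * ENNReal.ofReal b) • typeLaw P k := by
  have hq := h.typeProb_pos hp
  rw [typeProb, measureReal_def, ENNReal.toReal_pos_iff] at hp hq
  have he := measurableEmbedding_ofType (M := M) (d := d) k
  have hcancel : P {z | z.1 = k} * (P {z | z.1 = k})⁻¹ = 1 :=
    ENNReal.mul_inv_cancel hp.1.ne' hp.2.ne
  refine ⟨P {z | z.1 = k} * (Q {z | z.1 = k})⁻¹, ?_, ?_, ?_⟩
  · have h1 := h.le_right {z | z.1 = k}
    rw [Measure.smul_apply, smul_eq_mul] at h1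
    calc _ ≤ P {z | z.1 = k} * (ENNReal.ofReal a * P {z | z.1 = k})⁻¹ := by gcongr
      _ = (ENNReal.ofReal a)⁻¹ := by
        rw [ENNReal.mul_inv (Or.inr hp.2.ne) (Or.inr hp.1.ne'), mul_left_comm, hcancel, mul_one]
  · refine Measure.le_iff.2 fun s hs => ?_
    have h1 := h.le_right (ofType k '' s)
    simp only [typeLaw_eq_smul_comap, Measure.smul_apply, smul_eq_mul, he.comap_apply] at h1 ⊢
    calc _ = (P {z | z.1 = k} * (P {z | z.1 = k})⁻¹) * ((Q {z | z.1 = k})⁻¹ *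
          (ENNReal.ofReal a * P (ofType k '' s))) := by ring
      _ ≤ _ := by rw [hcancel, one_mul]; gcongr
  · refine Measure.le_iff.2 fun s hs => ?_
    have h1 := h.le_left (ofType k '' s)
    simp only [typeLaw_eq_smul_comap, Measure.smul_apply, smul_eq_mul, he.comap_apply] at h1 ⊢
    calc _ ≤ (Q {z | z.1 = k})⁻¹ * (ENNReal.ofReal b * P (ofType k '' s)) := by gcongr
      _ = (P {z | z.1 = k} * (P {z | z.1 = k})⁻¹) * ((Q {z | z.1 = k})⁻¹ *
          (ENNReal.ofReal b * P (ofType k '' s))) := by rw [hcancel, one_mul]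
      _ = _ := by ring

theorem overlap (h : Comparable P Q a b) {c : ℝ} (hc : 0 < c) (hp : ∀ k, 0 < typeProb P k)
    (ho : Overlap P c) : Overlap Q (c * a / b / 2) := by
  have ha := h.pos_left
  have hb := h.pos_right
  have hpos : 0 < c * a / b := by positivity
  rw [overlap_iff hp] at ho
  rw [overlap_iff fun k => h.typeProb_pos (hp k)]
  intro k t
  obtain ⟨r, -, h1, h2⟩ := h.typeLaw_bounds (hp k)
  filter_upwards [ae_le_condDistrib_of_comparable (S := {t}) ha hb hc h1 h2
      ((ho k t).mono fun _ hx => hx.1.le),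
    ae_le_condDistrib_of_comparable (S := {t}ᶜ) ha hb hc h1 h2
      ((ho k t).mono fun _ hx => hx.2.le)] with x hx1 hx2
  -- Halving the constant restores the strict inequalities of `Overlap`.
  exact ⟨(half_lt_self hpos).trans_le hx1, (half_lt_self hpos).trans_le hx2⟩

omit [IsProbabilityMeasure P] in
theorem lintegral_le (h : Comparable P Q a b) {k : Fin K} (hp : 0 < typeProb P k)
    (f : Obs (M k) (d k) → ℝ≥0∞) :
    ∫⁻ o, f o ∂typeLaw Q k ≤ (ENNReal.ofReal a)⁻¹ * ENNReal.ofReal b * ∫⁻ o, f o ∂typeLaw P k := by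
  obtain ⟨r, hr, -, h2⟩ := h.typeLaw_bounds hp
  calc _ ≤ ∫⁻ o, f o ∂((r * ENNReal.ofReal b) • typeLaw P k) := lintegral_mono' h2 le_rfl
    _ = r * ENNReal.ofReal b * ∫⁻ o, f o ∂typeLaw P k := by rw [lintegral_smul_measure]; rfl
    _ ≤ _ := by gcongr

end Comparable

/-- Laws comparable to a law of the nonparametric model belong to the nonparametric model, with
constants that depend only on the constants of comparison. -/
theorem exists_mem_npModel_of_comparable {a b : ℝ} (ha : 0 < a) (hb : 0 < b) {c : ℝ} (hc : 0 < c)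
    (hp : ∀ k, 0 < typeProb P k) (ho : Overlap P c)
    (hY : ∀ k, ∫⁻ o, ‖o.1‖ₑ ^ 2 ∂typeLaw P k < ∞) :
    ∃ c' : ℝ, 0 < c' ∧ ∃ C : ℝ≥0, ∀ Q : Measure (ClusterObs M d), IsProbabilityMeasure Q →
      ENNReal.ofReal a • P ≤ Q → Q ≤ ENNReal.ofReal b • P → Q ∈ npModel M d c' C := by
  have hfin : (ENNReal.ofReal a)⁻¹ * ENNReal.ofReal b *
      ∑ k, ∫⁻ o : Obs (M k) (d k), ‖o.1‖ₑ ^ 2 ∂typeLaw P k ≠ ∞ := by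
    refine ENNReal.mul_ne_top (ENNReal.mul_ne_top (ENNReal.inv_ne_top.2 (by simpa using ha))
      ENNReal.ofReal_ne_top) (ENNReal.sum_ne_top.2 fun k _ => (hY k).ne)
  refine ⟨c * a / b / 2, by positivity, ENNReal.toNNReal ((ENNReal.ofReal a)⁻¹ * ENNReal.ofReal b *
      ∑ k, ∫⁻ o : Obs (M k) (d k), ‖o.1‖ₑ ^ 2 ∂typeLaw P k), fun Q hQ h1 h2 => ?_⟩
  have h : Comparable P Q a b := ⟨ha, hb, h1, h2⟩
  refine ⟨hQ, fun k => h.typeProb_pos (hp k), h.overlap hc hp ho, fun k => ?_⟩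
  rw [ENNReal.coe_toNNReal hfin]
  refine (h.lintegral_le (hp k) _).trans ?_
  gcongr
  exact Finset.single_le_sum (f := fun k => ∫⁻ o : Obs (M k) (d k), ‖o.1‖ₑ ^ 2 ∂typeLaw P k)
    (fun _ _ => zero_le) (Finset.mem_univ k)

theorem pointSubmodel_mem_npSubmodels {c : ℝ} (hc : 0 < c) (hp : ∀ k, 0 < typeProb P k)
    (ho : Overlap P c) (hY : ∀ k, ∫⁻ o, ‖o.1‖ₑ ^ 2 ∂typeLaw P k < ∞) :
    pointSubmodel P ∈ npSubmodels P 0 := by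
  obtain ⟨c', hc', C, h⟩ := exists_mem_npModel_of_comparable one_pos one_pos hc hp ho hY
  refine ⟨c', hc', C, Filter.Eventually.of_forall fun η => ?_⟩
  rw [law_pointSubmodel]
  exact h P inferInstance (by simp) (by simp)

theorem circleSubmodel_mem_npSubmodels {c : ℝ} (hc : 0 < c) (hp : ∀ k, 0 < typeProb P k)
    (ho : Overlap P c) (hY : ∀ k, ∫⁻ o, ‖o.1‖ₑ ^ 2 ∂typeLaw P k < ∞)
    {h : ClusterObs M d → ℝ} (h2 : MemLp h 2 P) {B : ℝ} (hB : ∀ z, |h z| ≤ B)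
    (hmean : ∫ z, h z ∂P = 0) (hvar : ∫ z, h z ^ 2 ∂P = 1) :
    circleSubmodel h2 hB hmean hvar ∈ npSubmodels P 1 := by
  obtain ⟨z⟩ := nonempty_of_isProbabilityMeasure P
  have hB0 : 0 ≤ B := (abs_nonneg _).trans (hB z)
  obtain ⟨c', hc', C, hC⟩ := exists_mem_npModel_of_comparable (a := 1 / 4) (b := (1 + B) ^ 2)
    (by norm_num) (by positivity) hc hp ho hY
  refine ⟨c', hc', C, ?_⟩
  filter_upwards [(circleSubmodel h2 hB hmean hvar).isOpen_U.mem_nhds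
    (circleSubmodel h2 hB hmean hvar).truth_mem] with η hη
  obtain ⟨h3, h4, h5⟩ := law_circleSubmodel_bounds h2 hB hmean hvar hη
  exact hC _ h3 h4 h5

/-- The tangent space of the nonparametric model consists of all square integrable functions of
mean zero. -/
theorem mem_tangentSpace_npSubmodels {c : ℝ} (hc : 0 < c) (hp : ∀ k, 0 < typeProb P k)
    (ho : Overlap P c) (hY : ∀ k, ∫⁻ o, ‖o.1‖ₑ ^ 2 ∂typeLaw P k < ∞)
    {t : ClusterObs M d → ℝ} (ht : MemLp t 2 P) (hmean : ∫ z, t z ∂P = 0) :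
    t ∈ tangentSpace (npSubmodels P) :=
  mem_tangentSpace_of_integral_eq_zero (pointSubmodel_mem_npSubmodels hc hp ho hY)
    (fun _ h2 _ hB hmean hvar => circleSubmodel_mem_npSubmodels hc hp ho hY h2 hB hmean hvar)
    ht hmean

end Model

/-! ### Identification of potential outcome means -/

section PotentialOutcomes

variable {m d : ℕ} {Ω : Type*} [MeasurableSpace Ω] [StandardBorelSpace Ω] {ν : Measure Ω}
  [IsFiniteMeasure ν]

/-- Under conditional independence, the law of `(X, Y(a))` on the event `A = a` has the propensity
score as density with respect to the law of `(X, Y(a))`. -/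
theorem map_restrict_eq_withDensity_of_condIndepFun {α β γ : Type*} [MeasurableSpace α]
    [StandardBorelSpace α] [Nonempty α] [MeasurableSpace β] [StandardBorelSpace β] [Nonempty β]
    [MeasurableSpace γ] {X : Ω → γ} {Y : Ω → β} {A : Ω → α} (hX : Measurable X)
    (hY : Measurable Y) (hA : Measurable A)
    (h : CondIndepFun (MeasurableSpace.comap X inferInstance) hX.comap_le Y A ν)
    {S : Set α} (hS : MeasurableSet S) :
    (ν.restrict (A ⁻¹' S)).map (fun ω => (X ω, Y ω)) =
      (ν.map fun ω => (X ω, Y ω)).withDensity fun p => condDistrib A X ν p.1 S := by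
  rw [condIndepFun_iff_map_prod_eq_prod_condDistrib_prod_condDistrib hY hA hX] at h
  have hκ : Measurable fun x => condDistrib A X ν x S := Kernel.measurable_coe _ hS
  -- Conditional independence says that, given `X`, the joint law of outcome and treatment is a
  -- product; evaluation on rectangles suffices.
  refine Measure.ext_prod fun {s t} hs ht => ?_
  have h1 := congrArg (fun ρ => ρ (s ×ˢ t ×ˢ S)) h
  rw [Measure.map_apply (by fun_prop) (hs.prod (ht.prod hS)),
    Measure.bind_apply (hs.prod (ht.prod hS)) (by fun_prop)] at h1
  rw [Measure.map_apply (by fun_prop) (hs.prod ht),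
    Measure.restrict_apply ((hX.prodMk hY) (hs.prod ht)), withDensity_apply _ (hs.prod ht),
    ← compProd_map_condDistrib hY.aemeasurable, Measure.setLIntegral_compProd (by fun_prop) hs ht]
  simp only [Kernel.prod_apply_prod, Kernel.id_apply, Measure.dirac_apply' _ hs] at h1
  simp only [setLIntegral_const]
  rw [← lintegral_indicator hs]
  convert h1 using 1
  · congr 1; ext ω; simp [and_assoc]
  · refine lintegral_congr fun x => ?_
    by_cases hx : x ∈ s <;> simp [hx, mul_comm]

variable {X : Ω → Covariate d} {A : Ω → Treatment m} {Y Ypot : Ω → Outcome m}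
  {ρ : Measure (Obs m d)} [IsFiniteMeasure ρ]

omit [StandardBorelSpace Ω] in
-- A conditional distribution is determined by the joint law of the two variables.
theorem condDistrib_map_obs (hX : Measurable X) (hA : Measurable A) (hY : Measurable Y)
    (hρ : ρ = ν.map fun ω => (Y ω, A ω, X ω)) :
    condDistrib (fun o : Obs m d => o.2.1) (fun o => o.2.2) ρ = condDistrib A X ν := by
  have h : ρ.map (fun o => (o.2.2, o.2.1)) = ν.map fun ω => (X ω, A ω) := by
    rw [hρ, Measure.map_map (by fun_prop) (by fun_prop)]; rfl
  rw [condDistrib_def, condDistrib_def]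
  simp_rw [h]

/-- Identification of a weighted mean of the potential outcome `Y(a)`. -/
theorem integral_inner_potentialOutcome (hX : Measurable X) (hA : Measurable A) (hY : Measurable Y)
    (hYpot : Measurable Ypot)
    (h : CondIndepFun (MeasurableSpace.comap X inferInstance) hX.comap_le Ypot A ν)
    {a : Treatment m} (hcons : ∀ᵐ ω ∂ν, A ω = a → Y ω = Ypot ω) {c : ℝ} (hc : 0 < c)
    (hρ : ρ = ν.map fun ω => (Y ω, A ω, X ω))
    (hpos : ∀ᵐ x ∂ρ.map (fun o => o.2.2), c ≤ propensityOf ρ a x)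
    (hint : Integrable (fun o : Obs m d => o.1) ρ)
    {w : Covariate d → Outcome m} (hw : Measurable w) {B : ℝ} (hB : ∀ x, ‖w x‖ ≤ B) :
    Integrable (fun ω => inner ℝ (w (X ω)) (Ypot ω)) ν ∧
      ∫ ω, inner ℝ (w (X ω)) (Ypot ω) ∂ν =
        ∫ x, inner ℝ (w x) (regressionOf ρ a x) ∂ρ.map (fun o => o.2.2) := by
  have hO : Measurable fun ω => (Y ω, A ω, X ω) := by fun_prop
  have hXY : Measurable fun ω => (X ω, Ypot ω) := by fun_prop
  set e := clipPropensity ρ c a with he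
  have hem : Measurable e := measurable_clipPropensity ρ c a
  have hepos : ∀ x, 0 < e x := fun x => hc.trans_le (le_max_left _ _)
  have hA' : MeasurableSet (A ⁻¹' {a}) := hA (measurableSet_singleton a)
  have hF : Measurable fun p : Covariate d × Outcome m => (inner ℝ (w p.1) p.2 : ℝ) := by fun_prop
  have hdens : (ν.restrict (A ⁻¹' {a})).map (fun ω => (X ω, Ypot ω)) =
      (ν.map fun ω => (X ω, Ypot ω)).withDensity fun p => ENNReal.ofReal (e p.1) := by
    rw [map_restrict_eq_withDensity_of_condIndepFun hX hYpot hA h (measurableSet_singleton a)]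
    refine withDensity_congr_ae ?_
    have h1 : ∀ᵐ ω ∂ν, e (X ω) = propensityOf ρ a (X ω) := by
      have h2 : ∀ g : Covariate d → ℝ, (∀ᵐ o ∂ρ, e o.2.2 = g o.2.2) →
          ∀ᵐ ω ∂ν, e (X ω) = g (X ω) := by
        intro g hg
        rw [hρ] at hg
        exact ae_of_ae_map hO.aemeasurable hg
      exact h2 _ (clipPropensity_ae_eq hpos)
    have hm : MeasurableSet {p : Covariate d × Outcome m |
        condDistrib A X ν p.1 {a} = ENNReal.ofReal (e p.1)} :=
      measurableSet_eq_fun ((Kernel.measurable_coe _ (measurableSet_singleton a)).comp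
        measurable_fst) (by fun_prop)
    refine (ae_map_iff hXY.aemeasurable hm).2 ?_
    filter_upwards [h1] with ω hω
    rw [hω, propensityOf, condDistrib_map_obs hX hA hY hρ, ofReal_measureReal]
  have hmean : Integrable Y ν := by
    rw [hρ] at hint
    exact (integrable_map_measure (by fun_prop) hO.aemeasurable).1 hint
  have heq : ∀ᵐ ω ∂ν.restrict (A ⁻¹' {a}), Y ω = Ypot ω :=
    (ae_restrict_iff' hA').2 hcons
  have hiR : Integrable (fun p : Covariate d × Outcome m => (inner ℝ (w p.1) p.2 : ℝ))
      ((ν.restrict (A ⁻¹' {a})).map fun ω => (X ω, Ypot ω)) := by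
    refine (integrable_map_measure hF.aestronglyMeasurable hXY.aemeasurable).2 ?_
    have hi : Integrable (fun ω => inner ℝ (w (X ω)) (Y ω)) (ν.restrict (A ⁻¹' {a})) :=
      (hmean.integrableOn (s := A ⁻¹' {a})).norm.const_mul B |>.mono' (by fun_prop)
        (ae_of_all _ fun ω => (norm_inner_le_norm _ _).trans
          (mul_le_mul_of_nonneg_right (hB _) (norm_nonneg _)))
    refine hi.congr ?_
    filter_upwards [heq] with ω hω
    simp [hω]
  rw [hdens, integrable_withDensity_iff_integrable_smul' (by fun_prop)
    (ae_of_all _ fun _ => ENNReal.ofReal_lt_top)] at hiR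
  -- As `e ≥ c`, integrability against the density `e` implies integrability without it. Thus
  -- consistency and the observed moments yield the existence of the potential outcome mean.
  have hiN : Integrable (fun p : Covariate d × Outcome m => (inner ℝ (w p.1) p.2 : ℝ))
      (ν.map fun ω => (X ω, Ypot ω)) := by
    refine (hiR.norm.const_mul c⁻¹).mono' hF.aestronglyMeasurable (ae_of_all _ fun p => ?_)
    rw [ENNReal.toReal_ofReal (hepos _).le, norm_smul, Real.norm_of_nonneg (hepos _).le,
      ← mul_assoc]
    refine le_mul_of_one_le_left (norm_nonneg _) ?_
    rw [← div_eq_inv_mul, one_le_div hc]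
    exact le_max_left _ _
  refine ⟨(integrable_map_measure hF.aestronglyMeasurable hXY.aemeasurable).1 hiN, ?_⟩
  have hr := measurable_regressionOf ρ a
  have hti := measurable_treatedInd (d := d) a
  have h1 : ∫ o, treatedInd a o * inner ℝ (w o.2.2) o.1 / e o.2.2 ∂ρ =
      ∫ ω, treatedInd a (Y ω, A ω, X ω) * inner ℝ (w (X ω)) (Y ω) / e (X ω) ∂ν := by
    rw [hρ, integral_map hO.aemeasurable (Measurable.aestronglyMeasurable (by fun_prop))]
  rw [integral_map (by fun_prop) (by fun_prop), ← integral_ipw_eq hc hpos hint hw hB, ← he, h1]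
  have h2 : ∫ ω, treatedInd a (Y ω, A ω, X ω) * inner ℝ (w (X ω)) (Y ω) / e (X ω) ∂ν =
      ∫ ω in A ⁻¹' {a}, inner ℝ (w (X ω)) (Ypot ω) / e (X ω) ∂ν := by
    rw [← integral_indicator hA']
    refine integral_congr_ae ?_
    filter_upwards [hcons] with ω hω
    by_cases hωa : A ω = a
    · simp [treatedInd, hωa, hω hωa]
    · simp [treatedInd, hωa]
  have h3 : ∫ ω in A ⁻¹' {a}, inner ℝ (w (X ω)) (Ypot ω) / e (X ω) ∂ν =
      ∫ p, inner ℝ (w p.1) p.2 / e p.1 ∂(ν.restrict (A ⁻¹' {a})).map fun ω => (X ω, Ypot ω) := by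
    rw [integral_map hXY.aemeasurable (Measurable.aestronglyMeasurable (by fun_prop))]
  have h4 : ∫ ω, inner ℝ (w (X ω)) (Ypot ω) ∂ν =
      ∫ p, inner ℝ (w p.1) p.2 ∂ν.map fun ω => (X ω, Ypot ω) := by
    rw [integral_map hXY.aemeasurable (by fun_prop)]
  refine Eq.trans ?_ h2.symm
  -- The density `e` of the law on `A = a` cancels the inverse weight.
  rw [h3, h4, hdens, integral_withDensity_eq_integral_toReal_smul (by fun_prop)
    (ae_of_all _ fun _ => ENNReal.ofReal_lt_top)]
  refine integral_congr_ae (ae_of_all _ fun p => ?_)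
  simp only [ENNReal.toReal_ofReal (hepos _).le, smul_eq_mul]
  rw [mul_div_cancel₀ _ (hepos _).ne']

end PotentialOutcomes

/-! ### The observed law of a random cluster -/

namespace RandomCluster

variable {K : ℕ} {M d : Fin K → ℕ} {Ω : Type*} [MeasurableSpace Ω] (D : RandomCluster M d Ω)
  {μ : Measure Ω}

theorem measurableSet_type (k : Fin K) : MeasurableSet {ω | D.L ω = k} :=
  D.measurable_L (measurableSet_singleton k)

/-- The observed data of a cluster of type `k`. -/
def obsOfType (k : Fin K) (ω : Ω) : Obs (M k) (d k) := (D.Y k ω, D.A k ω, D.X k ω)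

theorem measurable_obsOfType (k : Fin K) : Measurable (D.obsOfType k) :=
  (D.measurable_Y k).prodMk ((D.measurable_A k).prodMk (D.measurable_X k))

theorem obs_eq {k : Fin K} {ω : Ω} (h : D.L ω = k) : D.obs ω = ofType k (D.obsOfType k ω) := by
  subst h; rfl

theorem obs_fst (ω : Ω) : (D.obs ω).1 = D.L ω := rfl

theorem measurable_obs : Measurable D.obs := by
  intro s hs
  have h : D.obs ⁻¹' s = ⋃ k, {ω | D.L ω = k} ∩ D.obsOfType k ⁻¹' (ofType k ⁻¹' s) := by
    ext ω
    simp only [Set.mem_preimage, Set.mem_iUnion, Set.mem_inter_iff, Set.mem_ofPred_eq]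
    constructor
    · intro hω; exact ⟨D.L ω, rfl, hω⟩
    · rintro ⟨k, hk, hω⟩; rwa [D.obs_eq hk]
  rw [h]
  exact MeasurableSet.iUnion fun k => (D.measurableSet_type k).inter
    (D.measurable_obsOfType k ((measurableEmbedding_ofType k).measurable hs))

theorem map_obs_type (k : Fin K) : μ.map D.obs {z | z.1 = k} = μ {ω | D.L ω = k} := by
  rw [Measure.map_apply D.measurable_obs (_root_.measurableSet_type k)]; rfl

theorem typeProb_map_obs (k : Fin K) : typeProb (μ.map D.obs) k = μ.real {ω | D.L ω = k} := by
  rw [typeProb, measureReal_def, map_obs_type, measureReal_def]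

/-- Identifies the observed law of type `k` with a law under `given μ k`, where the irrelevant
values of the variables off the event `L = k` carry no mass. -/
theorem typeLaw_map_obs (k : Fin K) :
    typeLaw (μ.map D.obs) k = (D.given μ k).map (D.obsOfType k) := by
  ext s hs
  rw [typeLaw_eq_smul_comap, Measure.smul_apply, (measurableEmbedding_ofType k).comap_apply,
    map_obs_type, Measure.map_apply D.measurable_obs
      ((measurableEmbedding_ofType k).measurableSet_image.2 hs),
    Measure.map_apply (D.measurable_obsOfType k) hs, given, cond_apply (D.measurableSet_type k),
    smul_eq_mul]
  congr 2
  ext ω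
  simp only [Set.mem_preimage, Set.mem_inter_iff, Set.mem_ofPred_eq]
  constructor
  · rintro ⟨o, ho, hω⟩
    have hk : D.L ω = k := by rw [← obs_fst, ← hω]; rfl
    rw [D.obs_eq hk] at hω
    rw [← (measurableEmbedding_ofType k).injective hω]
    exact ⟨hk, ho⟩
  · rintro ⟨hk, hω⟩
    exact ⟨_, hω, (D.obs_eq hk).symm⟩

variable [StandardBorelSpace Ω] {D}

theorem integral_inner_Ypot (hcons : D.Consistency μ) (hign : D.Ignorability μ) {c : ℝ}
    (hc : 0 < c) (ho : Overlap (μ.map D.obs) c)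
    (hY : ∀ k, ∫⁻ o, ‖o.1‖ₑ ^ 2 ∂typeLaw (μ.map D.obs) k < ∞)
    {w : Weights M d} (hw : ∀ k a, Measurable (w k a)) {B : ℝ} (hB : ∀ k a x, ‖w k a x‖ ≤ B)
    (k : Fin K) (a : Treatment (M k)) :
    Integrable (fun ω => inner ℝ (w k a (D.X k ω)) (D.Ypot k a ω)) (D.given μ k) ∧
      ∫ ω, inner ℝ (w k a (D.X k ω)) (D.Ypot k a ω) ∂D.given μ k =
        ∫ x, inner ℝ (w k a x) (outcomeReg (μ.map D.obs) k a x) ∂covLaw (μ.map D.obs) k := by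
  have hpos := ae_le_propensityOf_of_overlap ho k a
  have hint := integrable_fst_typeLaw (hY k)
  have hlaw : typeLaw (μ.map D.obs) k = (D.given μ k).map fun ω => (D.Y k ω, D.A k ω, D.X k ω) :=
    D.typeLaw_map_obs k
  have hc' : ∀ᵐ ω ∂D.given μ k, D.A k ω = a → D.Y k ω = D.Ypot k a ω := by
    have h1 : ∀ᵐ ω ∂D.given μ k, D.L ω = k := ae_cond_mem (D.measurableSet_type k)
    filter_upwards [h1, cond_absolutelyContinuous.ae_le hcons] with ω h2 h3 h4
    rw [h3 k h2, h4]
  exact integral_inner_potentialOutcome (D.measurable_X k) (D.measurable_A k) (D.measurable_Y k)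
    (D.measurable_Ypot k a) (hign k a) hc' hc hlaw hpos hint (hw k a) (hB k a)

end RandomCluster

/-! ### Conclusion -/

theorem lintegral_outcome_sq_lt_top_of_momentConditions {K : ℕ} {M d : Fin K → ℕ}
    {P : Measure (ClusterObs M d)} (h : MomentConditions P) (k : Fin K) :
    ∫⁻ o, ‖o.1‖ₑ ^ 2 ∂typeLaw P k < ∞ :=
  lintegral_enorm_outcome_sq_lt_top _ (h.memLp_outcomeLaw k) (h.memLp_outcomeReg k)
    fun a i => h.integrable_outcomeCov k a i i

theorem isEfficientInfluenceFunction_phi {K : ℕ} {M d : Fin K → ℕ} {P : Measure (ClusterObs M d)}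
    [IsProbabilityMeasure P] (hp : ∀ k, 0 < typeProb P k) {c : ℝ} (hc : 0 < c) (ho : Overlap P c)
    (hM : MomentConditions P) {w : Weights M d} (hw : ∀ k a, Measurable (w k a)) {B : ℝ}
    (hB : ∀ k a x, ‖w k a x‖ ≤ B) {v : Fin K → ℝ → ℝ}
    (hv : ∀ k, ContDiffOn ℝ 1 (v k) (Set.Ioo 0 1)) :
    IsEfficientInfluenceFunction (npSubmodels P) (tauFunctional v w)
      (phi P v w fun k => thetaFunctional w k P) := by
  have hY := lintegral_outcome_sq_lt_top_of_momentConditions hM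
  have hae := phi_ae_eq ho v (w := w) fun k => thetaFunctional w k P
  refine ⟨fun m S hS => S.hasGradientAt_tauFunctional hS hM.memLp_outcomeReg hw hB hv,
    mem_tangentSpace_npSubmodels hc hp ho hY ?_ ?_⟩
  · exact (memLp_phiExpansion hc hp hw hB hY hM.memLp_outcomeReg v _).ae_eq hae.symm
  · rw [integral_congr_ae hae]
    exact integral_phiExpansion hc hp hw hB hY hM.memLp_outcomeReg v

end

theorem theorem1 {K : ℕ} (M d : Fin K → ℕ)
    {Ω : Type*} [MeasurableSpace Ω] [StandardBorelSpace Ω]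
    (μ : Measure Ω) [IsProbabilityMeasure μ] (D : RandomCluster M d Ω)
    (P : Measure (ClusterObs M d)) (hP : P = μ.map D.obs)
    (hp : ∀ k, 0 < typeProb P k)
    (hConsistency : D.Consistency μ)
    (hIgnorability : D.Ignorability μ)
    (hPositivity : ∃ c : ℝ, 0 < c ∧ Overlap P c)
    (hMoments : MomentConditions P)
    (w : Weights M d) (hw_meas : ∀ k a, Measurable (w k a))
    (hw_bdd : ∃ B : ℝ, ∀ k a x, ‖w k a x‖ ≤ B)
    (v : Fin K → ℝ → ℝ) (hv : ∀ k, ContDiffOn ℝ 1 (v k) (Set.Ioo 0 1)) :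
    (∀ k a, Integrable (fun ω => inner ℝ (w k a (D.X k ω)) (D.Ypot k a ω)) (D.given μ k)) ∧
    (∀ k, D.causalTheta μ w k = thetaFunctional w k P) ∧
    D.causalTau μ v w = tauFunctional v w P ∧
    IsEfficientInfluenceFunction (npSubmodels P) (tauFunctional v w)
      (phi P v w (D.causalTheta μ w)) ∧
    (∀ ψ, IsEfficientInfluenceFunction (npSubmodels P) (tauFunctional v w) ψ →
      ψ =ᵐ[P] phi P v w (D.causalTheta μ w)) ∧
    IsEfficiencyBound (npSubmodels P) (tauFunctional v w)
      (variance (phi P v w (D.causalTheta μ w)) P) := by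
  obtain ⟨c, hc, ho⟩ := hPositivity
  obtain ⟨B, hB⟩ := hw_bdd
  subst hP
  have : IsProbabilityMeasure (μ.map D.obs) :=
    Measure.isProbabilityMeasure_map D.measurable_obs.aemeasurable
  have hY := lintegral_outcome_sq_lt_top_of_momentConditions hMoments
  have hcausal := RandomCluster.integral_inner_Ypot hConsistency hIgnorability hc ho hY hw_meas hB
  have hθ : ∀ k, D.causalTheta μ w k = thetaFunctional w k (μ.map D.obs) := fun k =>
    Finset.sum_congr rfl fun a _ => (hcausal k a).2
  have hφ := isEfficientInfluenceFunction_phi hp hc ho hMoments hw_meas hB hv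
  rw [← funext hθ] at hφ
  refine ⟨fun k a => (hcausal k a).1, hθ, ?_, hφ, fun ψ hψ => hφ.ae_eq hψ, hφ.isEfficiencyBound⟩
  exact Finset.sum_congr rfl fun k _ => by rw [hθ k, D.typeProb_map_obs k]
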